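/- Let $(R,\mu)$ and $(S,\nu)$ be nonatomic probability spaces, let $\mathcal M(R,\mu)$ denote the (classes of a.e. equal) $\mu$-measurable complex-valued functions on $R$, and let $(0,1)$ carry Lebesgue measure. For $f\in\mathcal M(R,\mu)$ put $f^*(t)=\inf\{\lambda>0:\mu(\{|f|>\lambda\})\le t\}$, $t\in(0,1)$. A rearrangement-invariant (r.i.) quasi-Banach function norm is a functional $\|\cdot\|_{X(0,1)}$ on nonnegative measurable functions on $(0,1)$ with values in $[0,\infty]$ such that: $\|f\|=0$ iff $f=0$ a.e.; $\|\lambda f\|=\lambda\|f\|$ for $\lambda\ge0$; $\|f+g\|\le C(\|f\|+\|g\|)$ for some constant $C\ge 1$; $\|f\|\le\|g\|$ if $f\le g$ a.e.; $\|f_k\|\nearrow\|f\|$ if $f_k\nearrow f$ a.e.; $\|1\|<\infty$; and $\|f\|=\|g\|$ if $f^*=g^*$. It is an r.i. Banach function norm if moreover one may take $C=1$ and $\int_0^1f\le C_X\|f\|$ for some constant $C_X$. Put $\|f\|_{X(R,\mu)}=\|f^*\|_{X(0,1)}$ and $X(R,\mu)=\{f\in\mathcal M(R,\mu):\|f\|_{X(R,\mu)}<\infty\}$.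 For $p\in(0,\infty)$ put $\|f\|_{X^{1/p}(0,1)}=\|f^{1/p}\|_{X(0,1)}^p$; $X$ is $p$-convex if this is an r.i. Banach function norm. The associate norm of $\|\cdot\|_{Z(0,1)}$ is $\|f\|_{Z'(0,1)}=\sup\{\int_0^1fg: g\ge0,\ \|g\|_{Z(0,1)}\le1\}$. Let $p\in(0,\infty)$, $0\le\alpha<\frac1p$, $\beta=\frac1p-\alpha$, $\ell(t)=1-\log t$, $b_1=\ell^\alpha$ and $b_2=\ell^{-\beta}$ on $(0,1)$. Let $\sigma:[0,1]\to[0,1]$ be the increasing bijection with $$t^p=\frac1C\int_0^{\sigma(t)^p}\Big[\frac{b_1(s)}{b_2(s)}\Big]^p\,ds\quad(t\in[0,1]),\qquad C=\int_0^1\Big[\frac{b_1(s)}{b_2(s)}\Big]^p\,ds .$$ Let $L^p(\log L)^\alpha$ and $\exp L^{1/\beta}$ be the spaces of all $g\in\mathcal M(S,\nu)$ with finite quasinorm $\|\ell^\alpha g^*\|_{L^p(0,1)}$, respectively $\|\ell^{-\beta}g^*\|_{L^\infty(0,1)}$. For two such spaces put $K(f,t;X_0,X_1)=\inf\{\|g\|_{X_0}+t\|h\|_{X_1}: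 f=g+h,\ g\in X_0,\ h\in X_1\}$ ($=\infty$ if there is no such decomposition). For $f\in\mathcal M(0,1)$ and $t\in(0,1)$ put $$U_{\ell^\alpha,\ell^{-\beta},p}f(t)=\frac{f^*(\sigma^{-1}(t^{1/p})^p)}{b_2(t)},\qquad T_{\ell^\alpha,\ell^{-\beta},p}f(t)=\sup_{t\le s<1}\frac{f^*(\sigma(s^{1/p})^p)}{b_1(\sigma(s^{1/p})^p)^p}.$$ An operator $T:L^p(R,\mu)\to\mathcal M(S,\nu)$ (an arbitrary map, not necessarily linear) is $(p,b_1,b_2)$-gaussible if there is a constant $c$ such that, for all $f\in L^p(R,\mu)$ and $t\in(0,1)$, $$\int_0^t[(Tf)^*(s)b_1(s)]^p\,ds\le c\int_0^t\big[f^*(\sigma^{-1}(s^{1/p})^p)\,b_1(s)b_2(s)^{-1}\big]^p\,ds .$$ An operator is bounded from one space to another if the (quasi)norm of the image of each function of the first space is at most a constant times the (quasi)norm of the function. (If $X$ is $p$-convex, then $X(R,\mu)\subseteq L^p(R,\mu)$.) **Theorem.** Let $X$ and $Y$ be given by $p$-convex r.i. quasi-Banach function norms on $(0,1)$. The following four statements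 are equivalent. 1. Every $(p,\ell^\alpha,\ell^{-\beta})$-gaussible operator is bounded from $X(R,\mu)$ to $Y(S,\nu)$. 2. Every operator $T:L^p(R,\mu)\to\mathcal M(S,\nu)$ for which there is a constant $c$ with $$K(Tf,t;L^p(\log L)^\alpha,\exp L^{1/\beta})\le c\,K(f,t;L^p,L^\infty)\quad\text{for all }f\in L^p(R,\mu),\ t\in(0,1),$$ is bounded from $X(R,\mu)$ to $Y(S,\nu)$. 3. The operator $U_{\ell^\alpha,\ell^{-\beta},p}$ is bounded from $X(0,1)$ to $Y(0,1)$. 4. The operator $T_{\ell^\alpha,\ell^{-\beta},p}$ is bounded from $(Y^{1/p})'(0,1)$ to $(X^{1/p})'(0,1)$. (The case $p=1$, $\alpha=\beta=\frac12$ is the one of Gaussian--Sobolev embeddings.) -/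

import Mathlib

open MeasureTheory Set
open scoped ENNReal NNReal

noncomputable section

/-- A measure is nonatomic if every measurable set of positive measure has a measurable
subset of strictly smaller positive measure. -/
def IsNonatomic {R : Type*} [MeasurableSpace R] (μ : Measure R) : Prop :=
  ∀ A, MeasurableSet A → 0 < μ A → ∃ B, B ⊆ A ∧ MeasurableSet B ∧ 0 < μ B ∧ μ B < μ A

/-- Lebesgue measure on the interval `(0,1)`. -/
def lam01 : Measure ℝ := volume.restrict (Ioo 0 1)

/-- The nonincreasing rearrangement `f^*`, only used at points `t ∈ (0,1)`. -/
def rearr {R E : Type*} [MeasurableSpace R] [ENorm E] (μ : Measure R) (f : R → E) (t : ℝ) :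
    ℝ≥0∞ :=
  sInf {l : ℝ≥0∞ | μ {x | l < ‖f x‖ₑ} ≤ ENNReal.ofReal t}

/-! ### Rearrangement-invariant function norms

A function norm on `(0,1)` is a functional on functions `ℝ → ℝ≥0∞`; only its values at functions
that are Lebesgue measurable on `(0,1)` matter, and these depend only on the restriction to
`(0,1)` up to null sets (by monotonicity). -/

/-- The properties shared by r.i. Banach and r.i. quasi-Banach function norms. -/
structure IsRIFunctional (X : (ℝ → ℝ≥0∞) → ℝ≥0∞) : Prop where
  eq_zero_iff : ∀ f, AEMeasurable f lam01 → (X f = 0 ↔ f =ᵐ[lam01] 0)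
  smul : ∀ f, AEMeasurable f lam01 → ∀ c : ℝ≥0, X (fun t => c * f t) = c * X f
  mono : ∀ f g, AEMeasurable f lam01 → AEMeasurable g lam01 → f ≤ᵐ[lam01] g → X f ≤ X g
  iSup_of_monotone : ∀ (F : ℕ → ℝ → ℝ≥0∞) (f : ℝ → ℝ≥0∞),
    (∀ k, AEMeasurable (F k) lam01) → AEMeasurable f lam01 →
    (∀ᵐ t ∂lam01, Monotone (fun k => F k t) ∧ f t = ⨆ k, F k t) → X f = ⨆ k, X (F k)
  one_lt_top : X (fun _ => 1) < ∞
  rearr_inv : ∀ f g, AEMeasurable f lam01 → AEMeasurable g lam01 →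
    (∀ t ∈ Ioo (0 : ℝ) 1, rearr lam01 f t = rearr lam01 g t) → X f = X g

/-- Rearrangement-invariant Banach function norm on `(0,1)`. -/
structure IsRIBanachNorm (X : (ℝ → ℝ≥0∞) → ℝ≥0∞) : Prop extends IsRIFunctional X where
  add_le : ∀ f g, AEMeasurable f lam01 → AEMeasurable g lam01 →
    X (fun t => f t + g t) ≤ X f + X g
  lintegral_le : ∃ C : ℝ≥0, ∀ f, AEMeasurable f lam01 → ∫⁻ t, f t ∂lam01 ≤ C * X f

/-- Rearrangement-invariant quasi-Banach function norm on `(0,1)`. -/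
structure IsRIQuasiBanachNorm (X : (ℝ → ℝ≥0∞) → ℝ≥0∞) : Prop extends IsRIFunctional X where
  add_le : ∃ C : ℝ≥0, 1 ≤ C ∧ ∀ f g, AEMeasurable f lam01 → AEMeasurable g lam01 →
    X (fun t => f t + g t) ≤ C * (X f + X g)

/-- The functional `‖f‖_{X^{1/p}(0,1)} = ‖f^{1/p}‖_{X(0,1)}^p`. -/
def powNorm (p : ℝ) (X : (ℝ → ℝ≥0∞) → ℝ≥0∞) (f : ℝ → ℝ≥0∞) : ℝ≥0∞ :=
  X (fun t => f t ^ (1 / p)) ^ p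

/-- `p`-convexity of a r.i. quasi-Banach function norm. -/
def IsPConvex (p : ℝ) (X : (ℝ → ℝ≥0∞) → ℝ≥0∞) : Prop :=
  IsRIBanachNorm (powNorm p X)

/-- The associate functional `‖·‖_{X'(0,1)}`. -/
def assocNorm (X : (ℝ → ℝ≥0∞) → ℝ≥0∞) (f : ℝ → ℝ≥0∞) : ℝ≥0∞ :=
  ⨆ (g : ℝ → ℝ≥0∞) (_ : AEMeasurable g lam01) (_ : X g ≤ 1), ∫⁻ t, f t * g t ∂lam01

/-- The functional `‖f‖_{X(R,μ)} = ‖f^*‖_{X(0,1)}`; `f` belongs to `X(R,μ)` iff it is finite. -/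
def riNorm {R E : Type*} [MeasurableSpace R] [ENorm E] (X : (ℝ → ℝ≥0∞) → ℝ≥0∞) (μ : Measure R)
    (f : R → E) : ℝ≥0∞ :=
  X (rearr μ f)

/-- The functional `‖f‖_{L^{q,b}} = ‖b f^*‖_{L^q(0,1)}`, `q ∈ (0,∞]`. -/
def karamataNorm {R : Type*} [MeasurableSpace R] (q : ℝ≥0∞) (b : ℝ → ℝ) (μ : Measure R)
    (f : R → ℂ) : ℝ≥0∞ :=
  eLpNorm (fun t => ENNReal.ofReal (b t) * rearr μ f t) q lam01

/-- The `K`-functional of `f` for the couple of spaces given by the functionals `N₀`, `N₁`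
(infinite if `f` has no admissible decomposition). -/
def kFunctional {R : Type*} [MeasurableSpace R] {μ : Measure R} (N₀ N₁ : (R → ℂ) → ℝ≥0∞)
    (f : R →ₘ[μ] ℂ) (t : ℝ) : ℝ≥0∞ :=
  ⨅ (g : R →ₘ[μ] ℂ) (h : R →ₘ[μ] ℂ) (_ : f = g + h) (_ : N₀ g < ∞) (_ : N₁ h < ∞),
    N₀ g + ENNReal.ofReal t * N₁ h

/-! ### The function `σ` and the operators -/

/-- The inverse of `σ`: `σ⁻¹(u)^p = (1/C) ∫_0^{u^p} (b₁/b₂)^p` with `C = ∫_0^1 (b₁/b₂)^p`. -/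
def sigmaInv (b₁ b₂ : ℝ → ℝ) (p u : ℝ) : ℝ :=
  ((∫ s in (0 : ℝ)..u ^ p, (b₁ s * (b₂ s)⁻¹) ^ p) /
    ∫ s in (0 : ℝ)..1, (b₁ s * (b₂ s)⁻¹) ^ p) ^ (1 / p)

/-- The function `σ = σ(b₁,b₂,p) : [0,1] → [0,1]`, the inverse of the bijection `sigmaInv`
of `[0,1]`; see `sigma_spec`. -/
def sigma (b₁ b₂ : ℝ → ℝ) (p : ℝ) : ℝ → ℝ :=
  Function.invFunOn (sigmaInv b₁ b₂ p) (Icc 0 1)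

/-- `T : L^p(R,μ) → M(S,ν)` is `(p,b₁,b₂)`-gaussible. -/
def IsGaussible {R S : Type*} [MeasurableSpace R] [MeasurableSpace S] {μ : Measure R}
    {ν : Measure S} (p : ℝ) (b₁ b₂ : ℝ → ℝ) (T : Lp ℂ (ENNReal.ofReal p) μ → (S →ₘ[ν] ℂ)) :
    Prop :=
  ∃ C : ℝ≥0, ∀ f : Lp ℂ (ENNReal.ofReal p) μ, ∀ t ∈ Ioo (0 : ℝ) 1,
    ∫⁻ s in Ioo 0 t, (rearr ν (T f) s * ENNReal.ofReal (b₁ s)) ^ p ≤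
      C * ∫⁻ s in Ioo 0 t, (rearr μ f (sigmaInv b₁ b₂ p (s ^ (1 / p)) ^ p) *
        ENNReal.ofReal (b₁ s) * (ENNReal.ofReal (b₂ s))⁻¹) ^ p

/-- `T : L^p(R,μ) → M(S,ν)` satisfies the `K`-inequality
`K(Tf,t;L^{p,b₁},L^{∞,b₂}) ≲ K(f,t;L^p,L^∞)` for all `f ∈ L^p(R,μ)` and `t ∈ (0,1)`. -/
def SatisfiesKInequality {R S : Type*} [MeasurableSpace R] [MeasurableSpace S] {μ : Measure R}
    {ν : Measure S} (p : ℝ) (b₁ b₂ : ℝ → ℝ) (T : Lp ℂ (ENNReal.ofReal p) μ → (S →ₘ[ν] ℂ)) :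
    Prop :=
  ∃ C : ℝ≥0, ∀ f : Lp ℂ (ENNReal.ofReal p) μ, ∀ t ∈ Ioo (0 : ℝ) 1,
    kFunctional (karamataNorm (ENNReal.ofReal p) b₁ ν) (karamataNorm ∞ b₂ ν) (T f) t ≤
      C * kFunctional (fun g => eLpNorm g (ENNReal.ofReal p) μ) (fun h => eLpNorm h ∞ μ)
        (f : R →ₘ[μ] ℂ) t

/-- Boundedness of `T : L^p(R,μ) → M(S,ν)` from `X(R,μ)` to `Y(S,ν)`
(one has `X(R,μ) ⊆ L^p(R,μ)` if `X` is `p`-convex). -/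
def IsBoundedOp {R S : Type*} [MeasurableSpace R] [MeasurableSpace S] {μ : Measure R}
    {ν : Measure S} {p : ℝ} (X Y : (ℝ → ℝ≥0∞) → ℝ≥0∞)
    (T : Lp ℂ (ENNReal.ofReal p) μ → (S →ₘ[ν] ℂ)) : Prop :=
  ∃ C : ℝ≥0, ∀ f : Lp ℂ (ENNReal.ofReal p) μ, riNorm X μ f < ∞ →
    riNorm Y ν (T f) ≤ C * riNorm X μ f

/-- The operator `U_{b₁,b₂,p}`. -/
def opU (b₁ b₂ : ℝ → ℝ) (p : ℝ) (f : ℝ → ℂ) (t : ℝ) : ℝ≥0∞ :=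
  rearr lam01 f (sigmaInv b₁ b₂ p (t ^ (1 / p)) ^ p) * (ENNReal.ofReal (b₂ t))⁻¹

/-- The operator `T_{b₁,b₂,p}`. -/
def opT (b₁ b₂ : ℝ → ℝ) (p : ℝ) (f : ℝ → ℂ) (t : ℝ) : ℝ≥0∞ :=
  ⨆ s ∈ Ico t 1, rearr lam01 f (sigma b₁ b₂ p (s ^ (1 / p)) ^ p) /
    ENNReal.ofReal (b₁ (sigma b₁ b₂ p (s ^ (1 / p)) ^ p) ^ p)

/-- Boundedness from `X(0,1)` to `Y(0,1)` of an operator defined on `M(0,1)` whose values are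
nonnegative functions on `(0,1)`. -/
def IsBounded01 (X Y : (ℝ → ℝ≥0∞) → ℝ≥0∞) (A : (ℝ → ℂ) → ℝ → ℝ≥0∞) : Prop :=
  ∃ C : ℝ≥0, ∀ f : ℝ → ℂ, AEStronglyMeasurable f lam01 → riNorm X lam01 f < ∞ →
    Y (A f) ≤ C * riNorm X lam01 f

/-- The function `ℓ(t) = 1 - log t`. -/
def ell (t : ℝ) : ℝ := 1 - Real.log t

/-- `sigma` is the increasing bijection of `[0,1]` with `t^p = (1/C) ∫_0^{σ(t)^p} (b₁/b₂)^p`,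
and `sigmaInv` is its inverse. -/
theorem sigma_spec (b₁ b₂ : ℝ → ℝ) (p : ℝ) (hp : 0 < p)
    (h₁ : ∀ t ∈ Ioo (0 : ℝ) 1, 0 < b₁ t) (h₂ : ∀ t ∈ Ioo (0 : ℝ) 1, 0 < b₂ t)
    (hint : IntervalIntegrable (fun s => (b₁ s * (b₂ s)⁻¹) ^ p) volume 0 1) :
    BijOn (sigma b₁ b₂ p) (Icc 0 1) (Icc 0 1) ∧ StrictMonoOn (sigma b₁ b₂ p) (Icc 0 1) ∧
    (∀ t ∈ Icc (0 : ℝ) 1, t ^ p = (∫ s in (0 : ℝ)..sigma b₁ b₂ p t ^ p, (b₁ s * (b₂ s)⁻¹) ^ p) /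
      ∫ s in (0 : ℝ)..1, (b₁ s * (b₂ s)⁻¹) ^ p) ∧
    InvOn (sigmaInv b₁ b₂ p) (sigma b₁ b₂ p) (Icc 0 1) (Icc 0 1) := by
  set w : ℝ → ℝ := fun s => (b₁ s * (b₂ s)⁻¹) ^ p with hw
  have wpos : ∀ s ∈ Ioo (0 : ℝ) 1, 0 < w s := fun s hs =>
    Real.rpow_pos_of_pos (mul_pos (h₁ s hs) (inv_pos.2 (h₂ s hs))) p
  have hsub : ∀ a ∈ Icc (0 : ℝ) 1, ∀ b ∈ Icc (0 : ℝ) 1, IntervalIntegrable w volume a b := by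
    intro a ha b hb
    refine hint.mono_set ?_
    rw [uIcc_of_le zero_le_one]
    exact (convex_Icc (0 : ℝ) 1).ordConnected.uIcc_subset ha hb
  set W : ℝ → ℝ := fun x => ∫ s in (0 : ℝ)..x, w s with hWdef
  have W0 : W 0 = 0 := by simp [hWdef]
  have z0 : (0 : ℝ) ∈ Icc (0 : ℝ) 1 := by simp
  have z1 : (1 : ℝ) ∈ Icc (0 : ℝ) 1 := by simp
  have Wmono : StrictMonoOn W (Icc 0 1) := by
    intro a ha b hb hab
    have h : W b - W a = ∫ s in a..b, w s :=
      intervalIntegral.integral_interval_sub_left (hsub 0 z0 b hb) (hsub 0 z0 a ha)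
    have : 0 < ∫ s in a..b, w s :=
      intervalIntegral.intervalIntegral_pos_of_pos_on (hsub a ha b hb)
        (fun x hx => wpos x ⟨ha.1.trans_lt hx.1, hx.2.trans_le hb.2⟩) hab
    linarith
  have Wcont : ContinuousOn W (Icc 0 1) := by
    have := intervalIntegral.continuousOn_primitive_interval' hint (a := 0) (by simp)
    rwa [uIcc_of_le zero_le_one] at this
  have W1 : 0 < W 1 := by
    have := Wmono z0 z1 zero_lt_one
    rwa [W0] at this
  have powmem : ∀ u ∈ Icc (0 : ℝ) 1, ∀ q : ℝ, 0 < q → u ^ q ∈ Icc (0 : ℝ) 1 := fun u hu q hq =>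
    ⟨Real.rpow_nonneg hu.1 q, Real.rpow_le_one hu.1 hu.2 hq.le⟩
  have hp' : 0 < 1 / p := by positivity
  have eq : ∀ u, sigmaInv b₁ b₂ p u = (W (u ^ p) / W 1) ^ (1 / p) := fun u => rfl
  have Wn : ∀ u ∈ Icc (0 : ℝ) 1, 0 ≤ W u := fun u hu => by
    have := Wmono.monotoneOn z0 hu hu.1
    rwa [W0] at this
  have smono : StrictMonoOn (sigmaInv b₁ b₂ p) (Icc 0 1) := by
    intro a ha b hb hab
    rw [eq, eq]
    have hW := Wmono (powmem a ha p hp) (powmem b hb p hp) (Real.rpow_lt_rpow ha.1 hab hp)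
    exact Real.rpow_lt_rpow (div_nonneg (Wn _ (powmem a ha p hp)) W1.le)
      (div_lt_div_of_pos_right hW W1) hp'
  have scont : ContinuousOn (sigmaInv b₁ b₂ p) (Icc 0 1) := by
    have c1 : ContinuousOn (fun u : ℝ => u ^ p) (Icc 0 1) :=
      (Real.continuous_rpow_const hp.le).continuousOn
    have c2 : ContinuousOn (fun u : ℝ => W (u ^ p)) (Icc 0 1) :=
      Wcont.comp c1 (fun u hu => powmem u hu p hp)
    exact (c2.div_const (W 1)).rpow_const (fun _ _ => Or.inr hp'.le)
  have s0 : sigmaInv b₁ b₂ p 0 = 0 := by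
    rw [eq, Real.zero_rpow hp.ne', W0, zero_div, Real.zero_rpow hp'.ne']
  have s1 : sigmaInv b₁ b₂ p 1 = 1 := by
    rw [eq, Real.one_rpow, div_self W1.ne', Real.one_rpow]
  have sbij : BijOn (sigmaInv b₁ b₂ p) (Icc 0 1) (Icc 0 1) := by
    refine ⟨fun u hu => ⟨?_, ?_⟩, smono.injOn, ?_⟩
    · rw [← s0]; exact smono.monotoneOn z0 hu hu.1
    · rw [← s1]; exact smono.monotoneOn hu z1 hu.2
    · have := intermediate_value_Icc zero_le_one scont
      rwa [s0, s1] at this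
  have inv : InvOn (sigma b₁ b₂ p) (sigmaInv b₁ b₂ p) (Icc 0 1) (Icc 0 1) :=
    sbij.invOn_invFunOn
  have bij : BijOn (sigma b₁ b₂ p) (Icc 0 1) (Icc 0 1) := (bijOn_comm inv.symm).1 sbij
  refine ⟨bij, ?_, ?_, inv.symm⟩
  · intro a ha b hb hab
    rw [← smono.lt_iff_lt (bij.mapsTo ha) (bij.mapsTo hb), inv.2 ha, inv.2 hb]
    exact hab
  · intro t ht
    have h := inv.2 ht
    have hm := powmem _ (bij.mapsTo ht) p hp
    rw [eq] at h
    change t ^ p = W (sigma b₁ b₂ p t ^ p) / W 1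
    conv_lhs => rw [← h]
    rw [← Real.rpow_mul (div_nonneg (Wn _ hm) W1.le), one_div_mul_cancel hp.ne', Real.rpow_one]

end

/-! ### Lebesgue measure on the unit interval -/

/-! Since `(α + β) p = 1`, the weight `(b₁/b₂)^p` is `ell` itself, and `t ↦ σ⁻¹(t^(1/p))^p` is the
map `phi` with derivative `ell / 2`, whatever `p` is. Taking `p`-th powers and replacing `X`, `Y` by
the Banach norms `powNorm p X`, `powNorm p Y` removes `p` from the problem. With `a = α p ∈ [0,1)`
and `psi = phi⁻¹`, the two operators become `h ↦ h^*(phi t) ell(t)^(1-a)` and `supOp a`, the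
supremum over `u ≥ s` of `k(psi u) / ell(psi u)^a`, where `k = f^*`.

1 → 2: the `K`-inequality implies gaussibility. A lower estimate of the target `K`-functional
(`setLIntegral_weighted_le_kFunctional`) and an upper estimate of the source one
(`kFunctional_le_setLIntegral_rearr`), both at `phi(x)^(1/p)`, turn one condition into the other.

2 → 3: a nonatomic probability space carries a measure preserving map `τ` onto `(0,1)` in the sense
of image measures (`IsNonatomic.exists_measurePreserving`). The model operator `f ↦ W ∘ τ`, `W =
f^*(phi) ell^β`, satisfies the `K`-inequality (`satisfiesKInequality_compClass`) and has the
rearrangement of `W`. Its boundedness is thus that of `U`.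

3 → 4: let `H(s) = k(psi s) / ell(psi s)^a`, so that `supOp` is the least nonincreasing majorant of
`H`. It has to be paired with a nonincreasing `g` in the unit ball of `X`. Where the majorant is
constant on `[c,d)`, `g` may be replaced by its mean there, which does not increase the norm
(`IsRIBanachNorm.meanOn_le`), and the majorant by `2 H`, because `H(d)` is at most twice the mean of
`H` over `[c,d)` (`setLIntegral_mean_bound`). The pairing is therefore at most twice that of `H`
with another nonincreasing `f'` of no larger norm (`IsRIBanachNorm.exists_setLIntegral_iSup_le`).
The substitution `s = phi t` makes this the pairing of `k` with `U f'`, and Hölder's inequality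
finishes.

4 → 1: the norm of a nonincreasing `G` is tested by nonincreasing `K` in the associate unit ball
(`IsRIBanachNorm.le_of_forall_antitone`). Majorising `K / ell^a` by the nonincreasing function
`supOp a K^* ∘ phi` allows Hardy's lemma to be applied to the gaussible inequality, and after the
same substitution Hölder's inequality in `X` brings in the bound for `supOp`. -/

instance isProbabilityMeasure_lam01 : IsProbabilityMeasure lam01 :=
  ⟨by simp [lam01]⟩

instance nullSingletonClass_lam01 : NullSingletonClass lam01 := by
  unfold lam01; infer_instance

theorem ae_lam01_mem : ∀ᵐ t ∂lam01, t ∈ Ioo (0 : ℝ) 1 :=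
  ae_restrict_mem measurableSet_Ioo

theorem lam01_restrict_Ioo {a b : ℝ} (ha : 0 ≤ a) (hb : b ≤ 1) :
    lam01.restrict (Ioo a b) = volume.restrict (Ioo a b) := by
  rw [lam01, Measure.restrict_restrict measurableSet_Ioo,
    inter_eq_left.2 (Ioo_subset_Ioo ha hb)]

theorem lam01_Iio {c : ℝ} (h1 : c ≤ 1) : lam01 (Iio c) = ENNReal.ofReal c := by
  have : Iio c ∩ Ioo (0 : ℝ) 1 = Ioo 0 c := by
    ext x; simp only [mem_inter_iff, mem_Iio, mem_Ioo]
    exact ⟨fun h => ⟨h.2.1, h.1⟩, fun h => ⟨h.2, h.1, h.2.trans_le h1⟩⟩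
  rw [lam01, Measure.restrict_apply measurableSet_Iio, this]; simp

theorem lam01_setOf_ofReal_lt {m : ℝ≥0∞} (hm : m ≤ 1) : lam01 {t | ENNReal.ofReal t < m} = m := by
  have hne : m ≠ ∞ := (hm.trans_lt ENNReal.one_lt_top).ne
  have h1 : m.toReal ≤ 1 := ENNReal.toReal_le_of_le_ofReal zero_le_one (by simpa using hm)
  have : lam01 {t | ENNReal.ofReal t < m} = lam01 (Iio m.toReal) := by
    refine measure_congr ?_
    filter_upwards [ae_lam01_mem] with t ht
    have : (ENNReal.ofReal t < m) = (t < m.toReal) := by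
      rw [ENNReal.ofReal_lt_iff_lt_toReal ht.1.le hne]
    exact this
  rw [this, lam01_Iio h1, ENNReal.ofReal_toReal hne]

/-! ### Hardy's lemma -/

/-- Layer cake: the superlevel sets of `h` are lower sets, that is half-lines up to an endpoint,
which `m₁` does not charge. Neither measure need be finite. -/
theorem lintegral_le_lintegral_of_Iio_le {m₁ m₂ : Measure ℝ} [NullSingletonClass m₁] {h : ℝ → ℝ≥0∞}
    (hh : Antitone h) (H : ∀ c, m₁ (Iio c) ≤ m₂ (Iio c)) : ∫⁻ t, h t ∂m₁ ≤ ∫⁻ t, h t ∂m₂ := by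
  have low : ∀ L : Set ℝ, IsLowerSet L → m₁ L ≤ m₂ L := by
    intro L hL
    rcases L.eq_empty_or_nonempty with rfl | hne
    · simp
    by_cases hb : BddAbove L
    · have h1 : L ⊆ Iic (sSup L) := fun x hx => le_csSup hb hx
      have h2 : Iio (sSup L) ⊆ L := fun x hx => by
        obtain ⟨y, hy, hxy⟩ := exists_lt_of_lt_csSup hne hx
        exact hL hxy.le hy
      calc m₁ L ≤ m₁ (Iic (sSup L)) := measure_mono h1
        _ = m₁ (Iio (sSup L)) := measure_congr Iio_ae_eq_Iic.symm
        _ ≤ m₂ (Iio (sSup L)) := H _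
        _ ≤ m₂ L := measure_mono h2
    · have : L = ⋃ n : ℕ, Iio (n : ℝ) := by
        ext x
        simp only [mem_iUnion, mem_Iio]
        refine ⟨fun _ => exists_nat_gt x, fun _ => ?_⟩
        rw [not_bddAbove_iff] at hb
        obtain ⟨y, hy, hxy⟩ := hb x
        exact hL hxy.le hy
      have mono : Monotone fun n : ℕ => Iio (n : ℝ) := fun a b hab =>
        Iio_subset_Iio (by exact_mod_cast hab)
      rw [this, mono.measure_iUnion, mono.measure_iUnion]
      exact iSup_mono fun n => H n
  -- The layer cake formula is for real-valued functions, hence the truncation.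
  have bdd : ∀ n : ℕ, ∫⁻ t, min (h t) n ∂m₁ ≤ ∫⁻ t, min (h t) n ∂m₂ := by
    intro n
    have hA : Antitone fun t => min (h t) (n : ℝ≥0∞) := fun a b hab => min_le_min_right _ (hh hab)
    have hfin : ∀ t, min (h t) (n : ℝ≥0∞) ≠ ∞ := fun t =>
      ((min_le_right _ _).trans_lt (ENNReal.natCast_lt_top n)).ne
    have key : ∀ m : Measure ℝ, ∫⁻ t, min (h t) (n : ℝ≥0∞) ∂m =
        ∫⁻ l in Ioi (0 : ℝ), m {t | l < (min (h t) (n : ℝ≥0∞)).toReal} := by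
      intro m
      rw [← lintegral_eq_lintegral_meas_lt m (ae_of_all _ fun t => ENNReal.toReal_nonneg)
        hA.measurable.ennreal_toReal.aemeasurable]
      exact lintegral_congr fun t => (ENNReal.ofReal_toReal (hfin t)).symm
    rw [key, key]
    refine lintegral_mono fun l => low _ fun a b hab hb => ?_
    exact lt_of_lt_of_le hb (ENNReal.toReal_mono (hfin _) (hA hab))
  have sup : ∀ m : Measure ℝ, ∫⁻ t, h t ∂m = ⨆ n : ℕ, ∫⁻ t, min (h t) (n : ℝ≥0∞) ∂m := by
    intro m
    rw [← lintegral_iSup]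
    · refine lintegral_congr fun t => ?_
      rw [← inf_iSup_eq, ENNReal.iSup_natCast, inf_top_eq]
    · exact fun n => hh.measurable.min measurable_const
    · exact fun i j hij t => min_le_min_left _ (by exact_mod_cast hij)
  rw [sup, sup]
  exact iSup_mono bdd

theorem lintegral_mul_le_of_setLIntegral_le {f g h : ℝ → ℝ≥0∞} (hf : AEMeasurable f lam01)
    (hg : AEMeasurable g lam01) (hh : Antitone h)
    (H : ∀ t ∈ Ioo (0 : ℝ) 1, ∫⁻ s in Ioo 0 t, f s ≤ ∫⁻ s in Ioo 0 t, g s) :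
    ∫⁻ t, f t * h t ∂lam01 ≤ ∫⁻ t, g t * h t ∂lam01 := by
  have hm : AEMeasurable h lam01 := hh.measurable.aemeasurable
  have e : ∀ {f : ℝ → ℝ≥0∞}, AEMeasurable f lam01 →
      ∫⁻ t, f t * h t ∂lam01 = ∫⁻ t, h t ∂(lam01.withDensity f) := fun hf => by
    rw [lintegral_withDensity_eq_lintegral_mul₀ hf hm]; rfl
  rw [e hf, e hg]
  have small : ∀ f : ℝ → ℝ≥0∞, ∀ t ≤ 1, lam01.withDensity f (Iio t) = ∫⁻ s in Ioo 0 t, f s := by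
    intro f t ht
    rw [withDensity_apply _ measurableSet_Iio, lam01, Measure.restrict_restrict measurableSet_Iio]
    congr 2
    ext x; simp only [mem_inter_iff, mem_Iio, mem_Ioo]
    exact ⟨fun h => ⟨h.2.1, h.1⟩, fun h => ⟨h.2, h.1, h.2.trans_le ht⟩⟩
  have lt1 : ∀ t < 1, lam01.withDensity f (Iio t) ≤ lam01.withDensity g (Iio t) := by
    intro t ht
    rw [small _ _ ht.le, small _ _ ht.le]
    rcases le_or_gt t 0 with h0 | h0
    · simp [Ioo_eq_empty (not_lt.2 h0)]
    · exact H t ⟨h0, ht⟩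
  -- The hypothesis stops short of `t = 1`; the full interval is reached by monotone exhaustion.
  have one : lam01.withDensity f (Iio 1) ≤ lam01.withDensity g (Iio 1) := by
    obtain ⟨u, hu, hu1, hlim⟩ := exists_seq_strictMono_tendsto (1 : ℝ)
    have mono : Monotone fun n => Iio (u n) := fun a b hab => Iio_subset_Iio (hu.monotone hab)
    have : Iio (1 : ℝ) = ⋃ n, Iio (u n) := by
      ext x; simp only [mem_Iio, mem_iUnion]
      exact ⟨fun hx => ((tendsto_order.1 hlim).1 x hx).exists, fun ⟨n, hn⟩ => hn.trans (hu1 n)⟩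
    rw [this, mono.measure_iUnion, mono.measure_iUnion]
    exact iSup_mono fun n => lt1 _ (hu1 n)
  refine lintegral_le_lintegral_of_Iio_le hh fun c => ?_
  rcases lt_or_ge c 1 with hc | hc
  · exact lt1 c hc
  have : ∀ f : ℝ → ℝ≥0∞, lam01.withDensity f (Iio c) = lam01.withDensity f (Iio 1) := by
    intro f
    refine measure_congr ?_
    filter_upwards [withDensity_absolutelyContinuous lam01 f ae_lam01_mem] with x hx
    have hx : x ∈ Ioo (0 : ℝ) 1 := hx
    exact propext ⟨fun _ => hx.2, fun _ => hx.2.trans_le hc⟩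
  rw [this, this]
  exact one

/-! ### The nonincreasing rearrangement -/

section Rearrangement

variable {R E : Type*} [MeasurableSpace R] [ENorm E] {μ : Measure R}

theorem antitone_rearr (μ : Measure R) (f : R → E) : Antitone (rearr μ f) := fun _ _ hab =>
  sInf_le_sInf fun _ hl => le_trans hl (ENNReal.ofReal_le_ofReal hab)

theorem measurable_rearr (μ : Measure R) (f : R → E) : Measurable (rearr μ f) :=
  (antitone_rearr μ f).measurable

theorem rearr_le_of_meas_le {f : R → E} {l : ℝ≥0∞} {t : ℝ}
    (h : μ {x | l < ‖f x‖ₑ} ≤ ENNReal.ofReal t) : rearr μ f t ≤ l := sInf_le h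

/-- Continuity of `μ` from below makes the distribution function right continuous in the level, so
the infimum defining `rearr` is attained. Equimeasurability and the behaviour under powers are read
off from this equivalence. -/
theorem lt_rearr_iff {f : R → E} {l : ℝ≥0∞} {t : ℝ} :
    l < rearr μ f t ↔ ENNReal.ofReal t < μ {x | l < ‖f x‖ₑ} := by
  refine ⟨fun h => not_le.1 fun h' => not_le.2 h (rearr_le_of_meas_le h'), fun h => ?_⟩
  have hl : l < ∞ := by
    by_contra hl
    rw [not_lt, top_le_iff] at hl
    simp [hl] at h
  obtain ⟨u, hu, hul, hlim⟩ := exists_seq_strictAnti_tendsto' hl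
  have e : {x | l < ‖f x‖ₑ} = ⋃ n, {x | u n < ‖f x‖ₑ} := by
    ext x; simp only [mem_ofPred_eq, mem_iUnion]
    exact ⟨fun hx => ((tendsto_order.1 hlim).2 _ hx).exists, fun ⟨n, hn⟩ => (hul n).1.trans hn⟩
  have mono : Monotone fun n => {x | u n < ‖f x‖ₑ} := fun a b hab x hx =>
    lt_of_le_of_lt (hu.antitone hab) hx
  rw [e, mono.measure_iUnion, lt_iSup_iff] at h
  obtain ⟨n, hn⟩ := h
  refine (hul n).1.trans_le (le_sInf fun k hk => ?_)
  by_contra hkn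
  rw [not_le] at hkn
  refine absurd (hn.trans_le ?_) (not_lt.2 hk)
  exact measure_mono fun x hx => hkn.trans hx

theorem meas_rearr_le {f : R → E} (t : ℝ) :
    μ {x | rearr μ f t < ‖f x‖ₑ} ≤ ENNReal.ofReal t :=
  not_lt.1 fun h => lt_irrefl _ (lt_rearr_iff.2 h)

theorem rearr_eq_of_meas_eq {S F : Type*} [MeasurableSpace S] [ENorm F] {ν : Measure S}
    {f : R → E} {g : S → F} (h : ∀ l, μ {x | l < ‖f x‖ₑ} = ν {x | l < ‖g x‖ₑ}) :
    rearr μ f = rearr ν g := by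
  funext t; simp only [rearr, h]

theorem rearr_mono {F : Type*} [ENorm F] {f : R → E} {g : R → F}
    (h : ∀ᵐ x ∂μ, ‖f x‖ₑ ≤ ‖g x‖ₑ) (t : ℝ) : rearr μ f t ≤ rearr μ g t :=
  sInf_le_sInf fun _ hl => le_trans (measure_mono_ae
    (h.mono fun _ hx (hlt : _ < _) => lt_of_lt_of_le hlt hx)) hl

theorem rearr_congr {F : Type*} [ENorm F] {f : R → E} {g : R → F}
    (h : ∀ᵐ x ∂μ, ‖f x‖ₑ = ‖g x‖ₑ) : rearr μ f = rearr μ g :=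
  funext fun t => le_antisymm (rearr_mono (h.mono fun _ => le_of_eq) t)
    (rearr_mono (h.mono fun _ => ge_of_eq) t)

theorem meas_lt_rearr [IsProbabilityMeasure μ] (f : R → E) (l : ℝ≥0∞) :
    lam01 {t | l < rearr μ f t} = μ {x | l < ‖f x‖ₑ} := by
  simp only [lt_rearr_iff]
  exact lam01_setOf_ofReal_lt prob_le_one

theorem rearr_rearr [IsProbabilityMeasure μ] (f : R → E) :
    rearr lam01 (rearr μ f) = rearr μ f :=
  rearr_eq_of_meas_eq fun l => meas_lt_rearr f l

theorem map_rearr [IsProbabilityMeasure μ] {g : R → ℝ≥0∞} (hg : AEMeasurable g μ) :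
    lam01.map (rearr μ g) = μ.map g := by
  have : IsProbabilityMeasure (lam01.map (rearr μ g)) :=
    Measure.isProbabilityMeasure_map (measurable_rearr μ g).aemeasurable
  have : IsProbabilityMeasure (μ.map g) := Measure.isProbabilityMeasure_map hg
  have e : ∀ l, lam01.map (rearr μ g) (Ioi l) = μ.map g (Ioi l) := fun l => by
    rw [Measure.map_apply (measurable_rearr μ g) measurableSet_Ioi,
      Measure.map_apply_of_aemeasurable hg measurableSet_Ioi]
    exact meas_lt_rearr g l
  refine Measure.ext_of_Iic _ _ fun l => ?_
  rw [← compl_Ioi, prob_compl_eq_one_sub measurableSet_Ioi,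
    prob_compl_eq_one_sub measurableSet_Ioi, e]

theorem lintegral_rearr [IsProbabilityMeasure μ] {g : R → ℝ≥0∞} (hg : AEMeasurable g μ)
    {Φ : ℝ≥0∞ → ℝ≥0∞} (hΦ : Measurable Φ) :
    ∫⁻ t, Φ (rearr μ g t) ∂lam01 = ∫⁻ x, Φ (g x) ∂μ := by
  rw [← lintegral_map hΦ (measurable_rearr μ g), map_rearr hg,
    lintegral_map' hΦ.aemeasurable hg]

/-- Right continuity of `f^*`, in the form that lets the supremum in `supOp` be taken over a
countable set. -/
theorem exists_lt_rearr {f : R → E} {t : ℝ} {l : ℝ≥0∞} (h : l < rearr μ f t) :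
    ∃ s, t < s ∧ l < rearr μ f s := by
  rw [lt_rearr_iff] at h
  obtain ⟨u, hu, hu'⟩ := ENNReal.lt_iff_exists_real_btwn.1 h
  refine ⟨u, ?_, lt_rearr_iff.2 hu'.2⟩
  by_contra hut
  exact absurd hu'.1 (not_lt.2 (ENNReal.ofReal_le_ofReal (not_lt.1 hut)))

theorem rearr_le_of_antitoneOn {h : ℝ → ℝ≥0∞} (hh : AntitoneOn h (Ioo 0 1)) {t : ℝ}
    (ht : t ∈ Ioo (0 : ℝ) 1) : rearr lam01 h t ≤ h t := by
  refine rearr_le_of_meas_le ((measure_mono_ae (t := Iio t) ?_).trans (lam01_Iio ht.2.le).le)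
  filter_upwards [ae_lam01_mem] with x hx (hlt : h t < h x)
  exact not_le.1 fun hxt => absurd (hlt.trans_le (hh ht hx hxt)) (lt_irrefl _)

theorem le_rearr_of_antitone {h : ℝ → ℝ≥0∞} (hh : Antitone h) {s t : ℝ} (ht : 0 ≤ t) (hts : t < s)
    (hs : s ≤ 1) : h s ≤ rearr lam01 h t := by
  refine le_of_forall_lt fun l hl => lt_rearr_iff.2 ?_
  calc ENNReal.ofReal t < ENNReal.ofReal s := (ENNReal.ofReal_lt_ofReal_iff (ht.trans_lt hts)).2 hts
    _ = lam01 (Iio s) := (lam01_Iio hs).symm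
    _ ≤ _ := measure_mono fun x hx => hl.trans_le (hh (le_of_lt hx))

/-- Equality holds at every continuity point of `h` in `(0,1)`, and a monotone function has only
countably many other points. -/
theorem rearr_ae_eq_of_antitone {h : ℝ → ℝ≥0∞} (hh : Antitone h) :
    rearr lam01 h =ᵐ[lam01] h := by
  filter_upwards [hh.countable_not_continuousAt.ae_notMem lam01, ae_lam01_mem] with t hc ht
  have hc : ContinuousAt h t := not_not.1 hc
  refine le_antisymm (rearr_le_of_antitoneOn (hh.antitoneOn _) ht) ?_
  have hlim : Filter.Tendsto h (nhdsWithin t (Ioi t)) (nhds (h t)) :=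
    hc.tendsto.mono_left nhdsWithin_le_nhds
  refine le_of_tendsto hlim ?_
  filter_upwards [Ioo_mem_nhdsGT ht.2] with s hs
  exact le_rearr_of_antitone hh ht.1.le hs.1 hs.2.le

theorem rearr_add_le {g h : R → ℝ≥0∞} {f : R → E} (hf : ∀ᵐ x ∂μ, ‖f x‖ₑ ≤ g x + h x) {s t : ℝ}
    (hs : 0 ≤ s) (ht : 0 ≤ t) : rearr μ f (s + t) ≤ rearr μ g s + rearr μ h t := by
  refine rearr_le_of_meas_le ?_
  have : μ {x | rearr μ g s + rearr μ h t < ‖f x‖ₑ} ≤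
      μ ({x | rearr μ g s < ‖g x‖ₑ} ∪ {x | rearr μ h t < ‖h x‖ₑ}) := by
    refine measure_mono_ae (hf.mono fun x hx (hlt : _ < _) => ?_)
    by_contra hn
    have hn : ¬ (rearr μ g s < g x ∨ rearr μ h t < h x) := hn
    rw [not_or, not_lt, not_lt] at hn
    exact absurd (hlt.trans_le (hx.trans (add_le_add hn.1 hn.2))) (lt_irrefl _)
  refine this.trans ((measure_union_le _ _).trans ?_)
  rw [ENNReal.ofReal_add hs ht]
  exact add_le_add (meas_rearr_le s) (meas_rearr_le t)

theorem rearr_rpow (g : R → ℝ≥0∞) {q : ℝ} (hq : 0 < q) (t : ℝ) :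
    rearr μ (fun x => g x ^ q) t = rearr μ g t ^ q := by
  refine eq_of_forall_lt_iff fun l => ?_
  rw [← ENNReal.rpow_inv_lt_iff hq, lt_rearr_iff, lt_rearr_iff]
  simp only [enorm_eq_self, ENNReal.rpow_inv_lt_iff hq]

theorem rearr_lt_top [IsFiniteMeasure μ] {f : R → ℝ≥0∞} (hf : AEMeasurable f μ)
    (hfin : ∀ᵐ x ∂μ, f x < ∞) {t : ℝ} (ht : 0 < t) : rearr μ f t < ∞ := by
  obtain ⟨f', hf', hff'⟩ := hf
  have hanti : Antitone fun n : ℕ => {x | (n : ℝ≥0∞) < f' x} := fun a b hab x hx => by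
    rw [mem_ofPred_eq] at hx ⊢
    exact lt_of_le_of_lt (Nat.cast_le.2 hab) hx
  have hlim := tendsto_measure_iInter_atTop (μ := μ)
    (fun n : ℕ => (measurableSet_lt measurable_const hf').nullMeasurableSet) hanti
    ⟨0, measure_ne_top _ _⟩
  have h0 : μ (⋂ n : ℕ, {x | (n : ℝ≥0∞) < f' x}) = 0 := by
    refine measure_mono_null (fun x hx => ?_) (ae_iff.1 (hff'.and hfin))
    simp only [mem_iInter, mem_ofPred_eq] at hx ⊢
    rintro ⟨h1, h2⟩
    rw [h1] at h2
    obtain ⟨n, hn⟩ := ENNReal.exists_nat_gt h2.ne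
    exact absurd (hx n) (not_lt.2 hn.le)
  rw [h0] at hlim
  obtain ⟨n, hn⟩ := ((tendsto_order.1 hlim).2 _ (ENNReal.ofReal_pos.2 ht)).exists
  rw [rearr_congr (f := f) (g := f') (hff'.mono fun x hx => by rw [hx])]
  exact (rearr_le_of_meas_le hn.le).trans_lt (ENNReal.natCast_lt_top n)

theorem rearr_comp {S : Type*} [MeasurableSpace S] {ν : Measure S} {τ : S → R}
    (hτ : MeasurePreserving τ ν μ) {f : R → ℝ≥0∞} (hf : AEMeasurable f μ) :
    rearr ν (fun x => f (τ x)) = rearr μ f := by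
  refine rearr_eq_of_meas_eq fun l => ?_
  exact hτ.measure_preimage (nullMeasurableSet_lt aemeasurable_const hf)

end Rearrangement

/-- The Hardy–Littlewood inequality against a nonincreasing weight. -/
theorem lintegral_mul_le_rearr {f h : ℝ → ℝ≥0∞} (hf : AEMeasurable f lam01) (hh : Antitone h) :
    ∫⁻ t, f t * h t ∂lam01 ≤ ∫⁻ t, rearr lam01 f t * h t ∂lam01 := by
  refine lintegral_mul_le_of_setLIntegral_le hf (measurable_rearr _ _).aemeasurable hh
    fun t ht => ?_
  have hg : AEMeasurable ((Ioo 0 t).indicator f) lam01 := hf.indicator measurableSet_Ioo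
  calc ∫⁻ s in Ioo 0 t, f s = ∫⁻ s, (Ioo 0 t).indicator f s ∂lam01 := by
        rw [lintegral_indicator measurableSet_Ioo, lam01_restrict_Ioo le_rfl ht.2.le]
    _ = ∫⁻ s, rearr lam01 ((Ioo 0 t).indicator f) s ∂lam01 :=
        (lintegral_rearr hg measurable_id).symm
    -- The rearrangement of `f` cut off at `t` is below `f^*`, and it vanishes from `t` on because
    -- the support has measure at most `t`.
    _ ≤ ∫⁻ s, (Ioo 0 t).indicator (rearr lam01 f) s ∂lam01 := by
        refine lintegral_mono_ae (ae_lam01_mem.mono fun s hs => ?_)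
        rcases lt_or_ge s t with hst | hst
        · rw [indicator_of_mem (mem_Ioo.2 ⟨hs.1, hst⟩)]
          exact rearr_mono (ae_of_all _ fun x => indicator_le_self' (fun _ _ => zero_le) x) s
        · refine (rearr_le_of_meas_le (l := 0) ?_).trans zero_le
          calc _ ≤ lam01 (Iio t) := measure_mono fun x hx => by
                by_contra hn
                rw [mem_ofPred_eq, indicator_of_notMem (fun h => hn h.2)] at hx
                simp at hx
            _ = ENNReal.ofReal t := lam01_Iio ht.2.le
            _ ≤ ENNReal.ofReal s := ENNReal.ofReal_le_ofReal hst
    _ = ∫⁻ s in Ioo 0 t, rearr lam01 f s := by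
        rw [lintegral_indicator measurableSet_Ioo, lam01_restrict_Ioo le_rfl ht.2.le]

/-! ### Nonatomic probability spaces -/

section Nonatomic

variable {R : Type*} [MeasurableSpace R] {μ : Measure R}

/-- Of the two parts into which nonatomicity splits `A`, the smaller one will do. -/
theorem IsNonatomic.exists_subset_two_mul_le [IsFiniteMeasure μ] (hμ : IsNonatomic μ) {A : Set R}
    (hA : MeasurableSet A) (h0 : 0 < μ A) :
    ∃ B ⊆ A, MeasurableSet B ∧ 0 < μ B ∧ 2 * μ B ≤ μ A := by
  obtain ⟨B, hBA, hB, hB0, hlt⟩ := hμ A hA h0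
  have hsum : μ (A \ B) + μ B = μ A := by
    have := measure_sdiff_add_inter (μ := μ) A hB
    rwa [inter_eq_right.2 hBA] at this
  rcases le_total (μ B) (μ (A \ B)) with h | h
  · exact ⟨B, hBA, hB, hB0, by rw [two_mul, ← hsum]; gcongr⟩
  · refine ⟨A \ B, sdiff_subset, hA.diff hB, ?_, by rw [two_mul, ← hsum]; gcongr⟩
    rw [pos_iff_ne_zero]
    intro h0
    rw [h0, zero_add] at hsum
    exact hlt.ne hsum

theorem IsNonatomic.exists_subset_le [IsFiniteMeasure μ] (hμ : IsNonatomic μ) {A : Set R}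
    (hA : MeasurableSet A) (h0 : 0 < μ A) {ε : ℝ≥0∞} (hε : 0 < ε) :
    ∃ B ⊆ A, MeasurableSet B ∧ 0 < μ B ∧ μ B ≤ ε := by
  have iter : ∀ n : ℕ, ∃ B ⊆ A, MeasurableSet B ∧ 0 < μ B ∧ 2 ^ n * μ B ≤ μ A := by
    intro n
    induction n with
    | zero => exact ⟨A, Subset.rfl, hA, h0, by simp⟩
    | succ n ih =>
      obtain ⟨B, hBA, hB, hB0, hle⟩ := ih
      obtain ⟨B', hBB', hB', hB'0, hle'⟩ := hμ.exists_subset_two_mul_le hB hB0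
      refine ⟨B', hBB'.trans hBA, hB', hB'0, ?_⟩
      calc (2 : ℝ≥0∞) ^ (n + 1) * μ B' = 2 ^ n * (2 * μ B') := by ring
        _ ≤ 2 ^ n * μ B := by gcongr
        _ ≤ μ A := hle
  obtain ⟨n, hn⟩ := ENNReal.exists_nat_mul_gt hε.ne' (measure_ne_top μ A)
  obtain ⟨B, hBA, hB, hB0, hle⟩ := iter n
  refine ⟨B, hBA, hB, hB0, not_lt.1 fun hlt => ?_⟩
  refine absurd hle (not_le.2 (hn.trans_le ?_))
  gcongr
  exact_mod_cast (Nat.lt_two_pow_self (n := n)).le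

/-- Sierpiński's theorem. -/
theorem IsNonatomic.exists_subset_eq [IsFiniteMeasure μ] (hμ : IsNonatomic μ) {A : Set R}
    (hA : MeasurableSet A) {t : ℝ≥0∞} (ht : t ≤ μ A) :
    ∃ B ⊆ A, MeasurableSet B ∧ μ B = t := by
  let P : Set R → Prop := fun B => B ⊆ A ∧ MeasurableSet B ∧ μ B ≤ t
  -- Greedy exhaustion: `B'` nearly maximises the measure among the admissible supersets of `B`,
  -- with error `1/(n+1)`. The union of the resulting chain has maximal measure, and if it fell
  -- short of `t` a small set could still be added.
  have next : ∀ (n : ℕ) (B : {B // P B}), ∃ B' : {B // P B}, B.1 ⊆ B'.1 ∧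
      ∀ D, P D → B.1 ⊆ D → μ D ≤ μ B'.1 + ((n : ℝ≥0∞) + 1)⁻¹ := by
    intro n B
    set s := ⨆ (D : Set R) (_ : P D ∧ B.1 ⊆ D), μ D with hs
    have hle : ∀ D, P D → B.1 ⊆ D → μ D ≤ s := fun D h1 h2 =>
      le_iSup₂ (f := fun (D : Set R) (_ : P D ∧ B.1 ⊆ D) => μ D) D ⟨h1, h2⟩
    have hst : s ≤ t := iSup₂_le fun D hD => hD.1.2.2
    have hsfin : s ≠ ∞ := (hst.trans_lt (ht.trans_lt (measure_lt_top μ A))).ne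
    by_cases hs0 : s = 0
    · exact ⟨B, Subset.rfl, fun D h1 h2 => ((hle D h1 h2).trans hs0.le).trans zero_le⟩
    have hlt : s - ((n : ℝ≥0∞) + 1)⁻¹ < s := ENNReal.sub_lt_self hsfin hs0 (by simp)
    rw [hs] at hlt
    simp only [lt_iSup_iff] at hlt
    obtain ⟨D, hD, hlt⟩ := hlt
    refine ⟨⟨D, hD.1⟩, hD.2, fun E h1 h2 => (hle E h1 h2).trans ?_⟩
    exact tsub_le_iff_right.1 hlt.le
  choose N hN1 hN2 using next
  let Q : ℕ → {B // P B} := fun n => Nat.rec ⟨∅, empty_subset _, MeasurableSet.empty, by simp⟩ N n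
  have hQ : ∀ n, Q (n + 1) = N n (Q n) := fun n => rfl
  have mono : Monotone fun n => (Q n).1 := monotone_nat_of_le_succ fun n => by
    rw [hQ]; exact hN1 n _
  set B := ⋃ n, (Q n).1 with hBdef
  have hB : MeasurableSet B := MeasurableSet.iUnion fun n => (Q n).2.2.1
  have hBA : B ⊆ A := iUnion_subset fun n => (Q n).2.1
  have hBt : μ B ≤ t := by
    rw [hBdef, mono.measure_iUnion]
    exact iSup_le fun n => (Q n).2.2.2
  have max : ∀ D, P D → B ⊆ D → μ D ≤ μ B := by
    intro D hD hBD
    have h1 : ∀ n : ℕ, μ D ≤ μ B + ((n : ℝ≥0∞) + 1)⁻¹ := fun n => by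
      refine (hN2 n (Q n) D hD ((subset_iUnion _ n).trans hBD)).trans ?_
      rw [← hQ]
      gcongr
      exact subset_iUnion (fun n => (Q n).1) (n + 1)
    refine ENNReal.le_of_forall_pos_le_add fun ε hε _ => ?_
    obtain ⟨n, hn⟩ := ENNReal.exists_inv_nat_lt (a := (ε : ℝ≥0∞)) (by exact_mod_cast hε.ne')
    refine (h1 n).trans ?_
    gcongr
    refine le_trans ?_ hn.le
    gcongr
    exact le_self_add
  refine ⟨B, hBA, hB, hBt.antisymm (not_lt.1 fun hlt => ?_)⟩
  have hd : μ (A \ B) = μ A - μ B := measure_sdiff hBA hB.nullMeasurableSet (measure_ne_top _ _)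
  obtain ⟨D, hDA, hD, hD0, hDle⟩ := hμ.exists_subset_le (hA.diff hB)
    (by rw [hd]; exact tsub_pos_of_lt (hlt.trans_le ht)) (tsub_pos_of_lt hlt)
  have hu : μ (B ∪ D) = μ B + μ D :=
    measure_union (disjoint_sdiff_right.mono_right hDA) hD
  have h1 := max (B ∪ D) ⟨union_subset hBA (hDA.trans sdiff_subset), hB.union hD, by
    rw [hu]; exact (add_le_add_right hDle _).trans (add_tsub_cancel_of_le hBt).le⟩ subset_union_left
  rw [hu] at h1
  exact absurd h1 (not_le.2 (ENNReal.lt_add_right (measure_ne_top _ _) hD0.ne'))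

/-- A nonatomic probability space has a nested dyadic family of sets of prescribed measures. -/
theorem IsNonatomic.exists_dyadic_chain [IsProbabilityMeasure μ] (hμ : IsNonatomic μ) :
    ∃ A : ℕ → ℕ → Set R, (∀ n i, MeasurableSet (A n i)) ∧ (∀ n, Monotone (A n)) ∧
      (∀ n, ∀ i ≤ 2 ^ n, μ (A n i) = i / 2 ^ n) ∧ (∀ n i, A (n + 1) (2 * i) = A n i) ∧
      A 0 1 = univ := by
  have half : ∀ B : {B : Set R // MeasurableSet B}, ∃ H ⊆ B.1, MeasurableSet H ∧
      μ H = μ B.1 / 2 := fun B => hμ.exists_subset_eq B.2 ENNReal.half_le_self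
  choose H hH1 hH2 hH3 using half
  -- Refinement of a chain: even indices repeat the old sets, odd ones add half of the gap to the
  -- next set.
  let F : (ℕ → {B : Set R // MeasurableSet B}) → ℕ → {B : Set R // MeasurableSet B} := fun A i =>
    ⟨(A (i / 2)).1 ∪ if i % 2 = 0 then ∅ else
      H ⟨(A (i / 2 + 1)).1 \ (A (i / 2)).1, (A _).2.diff (A _).2⟩, (A _).2.union (by
        split_ifs
        exacts [MeasurableSet.empty, hH2 _])⟩
  let A : ℕ → ℕ → {B : Set R // MeasurableSet B} := fun n => Nat.rec
    (fun i => if i = 0 then ⟨∅, MeasurableSet.empty⟩ else ⟨univ, MeasurableSet.univ⟩)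
    (fun _ => F) n
  have hA : ∀ n, A (n + 1) = F (A n) := fun n => rfl
  have even : ∀ n i, (A (n + 1) (2 * i)).1 = (A n i).1 := fun n i => by
    simp [hA, F]
  have odd : ∀ n i, (A (n + 1) (2 * i + 1)).1 = (A n i).1 ∪
      H ⟨(A n (i + 1)).1 \ (A n i).1, (A _ _).2.diff (A _ _).2⟩ := fun n i => by
    have h1 : (2 * i + 1) / 2 = i := by omega
    have h2 : (2 * i + 1) % 2 ≠ 0 := by omega
    simp [hA, F, h1]
  have mono : ∀ n, Monotone fun i => (A n i).1 := by
    intro n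
    induction n with
    | zero =>
      refine monotone_nat_of_le_succ fun i => ?_
      have : (A 0 (i + 1)).1 = univ := by simp [A]
      rw [this]; exact subset_univ _
    | succ n ih =>
      refine monotone_nat_of_le_succ fun i => ?_
      obtain ⟨j, rfl | rfl⟩ := Nat.even_or_odd' i
      · rw [even, odd]; exact subset_union_left
      · rw [odd, show 2 * j + 1 + 1 = 2 * (j + 1) by ring, even]
        exact union_subset (ih j.le_succ) ((hH1 _).trans sdiff_subset)
  refine ⟨fun n i => (A n i).1, fun n i => (A n i).2, mono, fun n => ?_, even, by simp [A]⟩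
  induction n with
  | zero =>
    intro i hi
    have : i = 0 ∨ i = 1 := by simp at hi; omega
    rcases this with rfl | rfl <;> simp [A]
  | succ n ih =>
    intro i hi
    have hpow : (2 : ℝ≥0∞) ^ (n + 1) = 2 * 2 ^ n := pow_succ' 2 n
    have hi : i ≤ 2 * 2 ^ n := by rwa [pow_succ'] at hi
    obtain ⟨j, rfl | rfl⟩ := Nat.even_or_odd' i
    · change μ (A (n + 1) (2 * j)).1 = _
      rw [even, show μ (A n j).1 = _ from ih j (by omega), hpow]
      push_cast
      rw [ENNReal.mul_div_mul_left _ _ (by simp) (by simp)]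
    · change μ (A (n + 1) (2 * j + 1)).1 = _
      rw [odd, measure_union ((disjoint_sdiff_right).mono_right (hH1 _)) (hH2 _), hH3]
      simp only
      rw [measure_sdiff (mono n j.le_succ) (A n j).2.nullMeasurableSet (measure_ne_top _ _),
        show μ (A n j).1 = _ from ih j (by omega),
        show μ (A n (j + 1)).1 = _ from ih (j + 1) (by omega), hpow]
      have h1 : ((j + 1 : ℕ) : ℝ≥0∞) / 2 ^ n - j / 2 ^ n = 1 / 2 ^ n := by
        rw [← ENNReal.sub_div (by simp)]
        push_cast
        rw [ENNReal.add_sub_cancel_left (by simp)]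
      rw [h1]
      push_cast
      rw [ENNReal.add_div, ENNReal.mul_div_mul_left _ _ (by simp) (by simp)]
      congr 1
      rw [div_eq_mul_inv, div_eq_mul_inv, div_eq_mul_inv, one_mul, one_mul,
        ENNReal.mul_inv (by simp) (by simp), mul_comm]

/-- `τ x` is the infimum of the dyadic numbers whose set in the chain contains `x`. Then `{τ < t}`
is the union of the sets of index below `t`, a nested family, and has measure `t` by density of the
dyadics. -/
theorem IsNonatomic.exists_measurePreserving [IsProbabilityMeasure μ] (hμ : IsNonatomic μ) :
    ∃ τ : R → ℝ, MeasurePreserving τ μ lam01 := by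
  obtain ⟨A, hmeas, hmono, hval, heven, hA1⟩ := hμ.exists_dyadic_chain
  have lift : ∀ k n i, A (n + k) (2 ^ k * i) = A n i := by
    intro k
    induction k with
    | zero => simp
    | succ k ih => intro n i; rw [← ih n i, ← heven (n + k), pow_succ', mul_assoc]; rfl
  let I := {q : ℕ × ℕ // q.2 ≤ 2 ^ q.1}
  let v : I → ℝ := fun q => q.1.2 / 2 ^ q.1.1
  have vnn : ∀ q, 0 ≤ v q := fun q => by positivity
  have vle : ∀ q, v q ≤ 1 := fun q => by
    refine div_le_one_of_le₀ ?_ (by positivity)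
    exact_mod_cast q.2
  have vval : ∀ q : I, μ (A q.1.1 q.1.2) = ENNReal.ofReal (v q) := fun q => by
    rw [hval _ _ q.2, ENNReal.ofReal_div_of_pos (by positivity), ENNReal.ofReal_natCast,
      ENNReal.ofReal_pow (by norm_num)]
    simp
  have nested : ∀ q r : I, v q ≤ v r → A q.1.1 q.1.2 ⊆ A r.1.1 r.1.2 := by
    intro q r h
    rw [← lift r.1.1 q.1.1 q.1.2, ← lift q.1.1 r.1.1 r.1.2, add_comm r.1.1]
    refine hmono _ ?_
    rw [div_le_div_iff₀ (by positivity) (by positivity)] at h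
    have h' : q.1.2 * 2 ^ r.1.1 ≤ r.1.2 * 2 ^ q.1.1 := by exact_mod_cast h
    linarith
  let S : R → Set ℝ := fun x => v '' {q | x ∈ A q.1.1 q.1.2}
  have Sbdd : ∀ x, BddBelow (S x) := fun x => ⟨0, by rintro _ ⟨q, -, rfl⟩; exact vnn q⟩
  have Sne : ∀ x, (S x).Nonempty := fun x => ⟨_, ⟨(0, 1), by simp⟩, by simp [hA1], rfl⟩
  let τ : R → ℝ := fun x => sInf (S x)
  have pre : ∀ t, τ ⁻¹' Iio t = ⋃ q : {q : I // v q < t}, A q.1.1.1 q.1.1.2 := by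
    intro t
    ext x
    simp only [mem_preimage, mem_Iio, mem_iUnion, τ, csInf_lt_iff (Sbdd x) (Sne x)]
    constructor
    · rintro ⟨_, ⟨q, hq, rfl⟩, hlt⟩
      exact ⟨⟨q, hlt⟩, hq⟩
    · rintro ⟨⟨q, hlt⟩, hq⟩
      exact ⟨_, ⟨q, hq, rfl⟩, hlt⟩
  have hτ : Measurable τ := measurable_of_Iio fun t => by
    rw [pre]; exact MeasurableSet.iUnion fun q => hmeas _ _
  have hpre : ∀ t, μ (τ ⁻¹' Iio t) = ⨆ q : {q : I // v q < t}, ENNReal.ofReal (v q.1) := by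
    intro t
    rw [pre, Directed.measure_iUnion]
    · exact iSup_congr fun q => vval q.1
    · intro q r
      rcases le_total (v q.1) (v r.1) with h | h
      · exact ⟨r, nested _ _ h, Subset.rfl⟩
      · exact ⟨q, Subset.rfl, nested _ _ h⟩
  have hval : ∀ t ∈ Icc (0 : ℝ) 1, μ (τ ⁻¹' Iio t) = ENNReal.ofReal t := by
    intro t ht
    rw [hpre]
    refine le_antisymm (iSup_le fun q => ENNReal.ofReal_le_ofReal q.2.le) ?_
    refine le_of_forall_lt fun l hl => ?_
    obtain ⟨u, hu, hu'⟩ := ENNReal.lt_iff_exists_real_btwn.1 hl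
    have hut : u < t := by
      by_contra h
      exact absurd hu'.2 (not_lt.2 (ENNReal.ofReal_le_ofReal (not_lt.1 h)))
    obtain ⟨n, hn⟩ := exists_pow_lt_of_lt_one (sub_pos.2 hut) (by norm_num : (1 / 2 : ℝ) < 1)
    have hpos : (0 : ℝ) < 2 ^ n := by positivity
    have hc : 0 < t := by
      rcases ht.1.eq_or_lt with h | h
      · rw [← h] at hl; simp at hl
      · exact h
    -- `i / 2^n` is the largest dyadic of level `n` strictly below `t`; the ceiling minus one is
    -- used because `t` may be dyadic itself.
    obtain ⟨i, hi⟩ : ∃ i, ⌈t * 2 ^ n⌉₊ = i + 1 :=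
      Nat.exists_eq_succ_of_ne_zero (Nat.ceil_pos.2 (by positivity)).ne'
    have h1 : (i : ℝ) < t * 2 ^ n := Nat.lt_ceil.1 (by omega)
    have h2 : t * 2 ^ n ≤ i + 1 := by
      have := Nat.le_ceil (t * 2 ^ n); rw [hi] at this; exact_mod_cast this
    have h3 : i ≤ 2 ^ n := by
      have : (i : ℝ) ≤ 2 ^ n := h1.le.trans (by nlinarith [ht.2])
      exact_mod_cast this
    have hvt : v ⟨(n, i), h3⟩ < t := (div_lt_iff₀ hpos).2 h1
    have hv : u < v ⟨(n, i), h3⟩ := by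
      refine (lt_div_iff₀ hpos).2 ?_
      have : (1 / 2 : ℝ) ^ n * 2 ^ n = 1 := by rw [← mul_pow]; norm_num
      nlinarith
    refine hu'.1.trans_le (le_trans (ENNReal.ofReal_le_ofReal hv.le) ?_)
    exact le_iSup (fun q : {q : I // v q < t} => ENNReal.ofReal (v q.1)) ⟨_, hvt⟩
  refine ⟨τ, hτ, ?_⟩
  have : IsProbabilityMeasure (μ.map τ) := Measure.isProbabilityMeasure_map hτ.aemeasurable
  have hIio : ∀ t, μ.map τ (Iio t) = lam01 (Iio t) := by
    intro t
    rw [Measure.map_apply hτ measurableSet_Iio]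
    rcases lt_or_ge t 0 with h0 | h0
    · have h1 : μ (τ ⁻¹' Iio t) ≤ 0 := by
        refine (measure_mono (preimage_mono (Iio_subset_Iio h0.le))).trans ?_
        rw [hval 0 (by simp)]; simp
      have h2 : lam01 (Iio t) ≤ 0 := by
        refine (measure_mono (Iio_subset_Iio h0.le)).trans ?_
        rw [lam01_Iio zero_le_one]; simp
      rw [nonpos_iff_eq_zero.1 h1, nonpos_iff_eq_zero.1 h2]
    rcases le_or_gt t 1 with h1 | h1
    · rw [hval t ⟨h0, h1⟩, lam01_Iio h1]
    · refine le_antisymm (prob_le_one.trans ?_) (prob_le_one.trans ?_)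
      · calc (1 : ℝ≥0∞) = lam01 (Iio 1) := by rw [lam01_Iio le_rfl]; simp
          _ ≤ _ := measure_mono (Iio_subset_Iio h1.le)
      · calc (1 : ℝ≥0∞) = μ (τ ⁻¹' Iio 1) := by rw [hval 1 (by simp)]; simp
          _ ≤ _ := measure_mono (preimage_mono (Iio_subset_Iio h1.le))
  refine Measure.ext_of_Ici _ _ fun t => ?_
  rw [← compl_Iio, prob_compl_eq_one_sub measurableSet_Iio,
    prob_compl_eq_one_sub measurableSet_Iio, hIio]

end Nonatomic

/-! ### Step functions on equal cells -/

/-- The function equal to `v i` on the `i`-th of `N` equal cells of `[c,d)`, and to `h` outside. -/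
noncomputable def cellStep (N : ℕ) (c d : ℝ) (v : ℕ → ℝ≥0∞) (h : ℝ → ℝ≥0∞) (x : ℝ) : ℝ≥0∞ :=
  (Ico c d).piecewise (fun x => v ⌊(x - c) / (d - c) * N⌋₊) h x

theorem measurable_cell (N : ℕ) (c d : ℝ) (v : ℕ → ℝ≥0∞) :
    Measurable fun x : ℝ => v ⌊(x - c) / (d - c) * N⌋₊ :=
  (measurable_from_nat (f := v)).comp
    (Nat.measurable_floor.comp (((measurable_id.sub_const c).div_const (d - c)).mul_const _))

theorem measurable_cellStep (N : ℕ) (c d : ℝ) (v : ℕ → ℝ≥0∞) {h : ℝ → ℝ≥0∞} (hh : Measurable h) :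
    Measurable (cellStep N c d v h) :=
  (measurable_cell N c d v).piecewise measurableSet_Ico hh

theorem cell_eq_iff {N : ℕ} (hN : 0 < N) {c d x : ℝ} (hcd : c < d) (hx : c ≤ x) (i : ℕ) :
    ⌊(x - c) / (d - c) * N⌋₊ = i ↔
      x ∈ Ico (c + i * ((d - c) / N)) (c + (i + 1) * ((d - c) / N)) := by
  have hN' : (0 : ℝ) < N := Nat.cast_pos.2 hN
  have hd : 0 < d - c := sub_pos.2 hcd
  have h0 : 0 ≤ (x - c) / (d - c) * N := by
    have := sub_nonneg.2 hx
    positivity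
  rw [Nat.floor_eq_iff h0, mem_Ico]
  have e : (x - c) / (d - c) * N = (x - c) / ((d - c) / N) := by field_simp
  rw [e, le_div_iff₀ (by positivity), div_lt_iff₀ (by positivity)]
  constructor <;> rintro ⟨h1, h2⟩ <;> constructor <;> linarith

theorem cell_lt {N : ℕ} (hN : 0 < N) {c d x : ℝ} (hx : x ∈ Ico c d) :
    ⌊(x - c) / (d - c) * N⌋₊ < N := by
  have hN' : (0 : ℝ) < N := Nat.cast_pos.2 hN
  have hd : 0 < d - c := sub_pos.2 (hx.1.trans_lt hx.2)
  have h0 := sub_nonneg.2 hx.1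
  rw [Nat.floor_lt (by positivity)]
  have : (x - c) / (d - c) < 1 := (div_lt_one hd).2 (by linarith [hx.2])
  nlinarith

theorem setLIntegral_cell {N : ℕ} (hN : 0 < N) {c d : ℝ} (hcd : c < d) (w : ℕ → ℝ≥0∞)
    (f : ℝ → ℝ≥0∞) :
    ∫⁻ x in Ico c d, w ⌊(x - c) / (d - c) * N⌋₊ * f x = ∑ i ∈ Finset.range N,
      ∫⁻ x in Ico (c + i * ((d - c) / N)) (c + (i + 1) * ((d - c) / N)), w i * f x := by
  have hN' : (0 : ℝ) < N := Nat.cast_pos.2 hN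
  have hd : 0 < d - c := sub_pos.2 hcd
  have hδ : 0 < (d - c) / N := by positivity
  have hU : Ico c d = ⋃ i ∈ Finset.range N,
      Ico (c + i * ((d - c) / N)) (c + (i + 1) * ((d - c) / N)) := by
    ext x
    simp only [mem_iUnion, exists_prop, Finset.mem_range]
    constructor
    · intro hx
      exact ⟨_, cell_lt hN hx, (cell_eq_iff hN hcd hx.1 _).1 rfl⟩
    · rintro ⟨i, hi, h1, h2⟩
      have : ((i : ℝ) + 1) ≤ N := by exact_mod_cast hi
      have h3 : ((i : ℝ) + 1) * ((d - c) / N) ≤ N * ((d - c) / N) := by gcongr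
      rw [mul_div_cancel₀ _ hN'.ne'] at h3
      have h4 : 0 ≤ (i : ℝ) * ((d - c) / N) := by positivity
      constructor <;> linarith
  conv_lhs => rw [hU]
  rw [lintegral_biUnion_finset _ fun i _ => measurableSet_Ico]
  · refine Finset.sum_congr rfl fun i _ => setLIntegral_congr_fun measurableSet_Ico fun x hx => ?_
    have hcx : c ≤ x := by
      have h4 : 0 ≤ (i : ℝ) * ((d - c) / N) := by positivity
      linarith [hx.1]
    simp only [(cell_eq_iff hN hcd hcx i).2 hx]
  · intro i _ j _ hij
    refine disjoint_left.2 fun x hxi hxj => hij ?_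
    have hcx : c ≤ x := by
      have h4 : 0 ≤ (i : ℝ) * ((d - c) / N) := by positivity
      linarith [hxi.1]
    exact ((cell_eq_iff hN hcd hcx i).2 hxi).symm.trans ((cell_eq_iff hN hcd hcx j).2 hxj)

theorem setLIntegral_cell_const {N : ℕ} (hN : 0 < N) {c d : ℝ} (hcd : c < d) (w : ℕ → ℝ≥0∞) :
    ∫⁻ x in Ico c d, w ⌊(x - c) / (d - c) * N⌋₊ =
      (∑ i ∈ Finset.range N, w i) * ENNReal.ofReal ((d - c) / N) := by
  have := setLIntegral_cell hN hcd w 1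
  simp only [Pi.one_apply, mul_one] at this
  rw [this, Finset.sum_mul]
  refine Finset.sum_congr rfl fun i _ => ?_
  rw [setLIntegral_const, Real.volume_Ico]
  ring_nf

theorem lam01_restrict_Ico {a b : ℝ} (ha : 0 ≤ a) (hb : b ≤ 1) :
    lam01.restrict (Ico a b) = volume.restrict (Ico a b) := by
  rw [← restrict_Ioo_eq_restrict_Ico (μ := volume), ← lam01_restrict_Ioo ha hb]
  exact Measure.restrict_congr_set Ioo_ae_eq_Ico.symm

/-- The hypothesis `H` says that the two lists of values agree up to order. As the cells have equal
length, the functions are then equimeasurable. -/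
theorem rearr_cellStep_congr {N : ℕ} (hN : 0 < N) {c d : ℝ} (hc : 0 ≤ c) (hcd : c < d) (hd : d ≤ 1)
    {v v' : ℕ → ℝ≥0∞} (h : ℝ → ℝ≥0∞)
    (H : ∀ w : ℝ≥0∞ → ℝ≥0∞, ∑ i ∈ Finset.range N, w (v i) = ∑ i ∈ Finset.range N, w (v' i)) :
    rearr lam01 (cellStep N c d v h) = rearr lam01 (cellStep N c d v' h) := by
  refine rearr_eq_of_meas_eq fun l => ?_
  have key : ∀ v : ℕ → ℝ≥0∞, lam01 {x | l < ‖cellStep N c d v h x‖ₑ} =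
      (∑ i ∈ Finset.range N, (Ioi l).indicator 1 (v i)) * ENNReal.ofReal ((d - c) / N) +
        lam01 ({x | l < h x} \ Ico c d) := by
    intro v
    rw [← measure_inter_add_sdiff _ (measurableSet_Ico (a := c) (b := d))]
    congr 1
    · rw [← setLIntegral_cell_const hN hcd fun i => (Ioi l).indicator 1 (v i),
        ← lam01_restrict_Ico hc hd]
      have hms : MeasurableSet {x : ℝ | l < v ⌊(x - c) / (d - c) * N⌋₊} :=
        measurableSet_lt measurable_const (measurable_cell N c d v)
      have e : (fun x : ℝ => (Ioi l).indicator (1 : ℝ≥0∞ → ℝ≥0∞) (v ⌊(x - c) / (d - c) * N⌋₊)) =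
          {x : ℝ | l < v ⌊(x - c) / (d - c) * N⌋₊}.indicator 1 := by
        funext x; simp [indicator_apply]
      rw [e, lintegral_indicator_one hms, Measure.restrict_apply hms]
      congr 1
      ext x
      simp only [mem_inter_iff, mem_ofPred_eq, enorm_eq_self, and_congr_left_iff]
      intro hx
      rw [cellStep, piecewise_eq_of_mem _ _ _ hx]
    · congr 1
      ext x
      simp only [mem_sdiff, mem_ofPred_eq, enorm_eq_self, and_congr_left_iff]
      intro hx
      rw [cellStep, piecewise_eq_of_notMem _ _ _ hx]
  rw [key, key, H]

theorem sum_range_add_mod {N : ℕ} (i : ℕ) (f : ℕ → ℝ≥0∞) :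
    ∑ k ∈ Finset.range N, f ((i + k) % N) = ∑ k ∈ Finset.range N, f k := by
  have h := congrArg (fun s : Multiset ℕ => (s.map f).sum) (Nat.multiset_Ico_map_mod i N)
  simp only [Multiset.map_map] at h
  change ∑ k ∈ Finset.Ico i (i + N), f (k % N) = ∑ k ∈ Finset.range N, f k at h
  rw [← h, Finset.sum_Ico_eq_sum_range]
  simp

/-! ### Properties of function norms -/

namespace IsRIFunctional

variable {X : (ℝ → ℝ≥0∞) → ℝ≥0∞}

theorem congr_ae (hX : IsRIFunctional X) {f g : ℝ → ℝ≥0∞} (hf : AEMeasurable f lam01)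
    (h : f =ᵐ[lam01] g) : X f = X g :=
  le_antisymm (hX.mono _ _ hf (hf.congr h) h.le) (hX.mono _ _ (hf.congr h) hf h.symm.le)

theorem map_rearr (hX : IsRIFunctional X) {f : ℝ → ℝ≥0∞} (hf : AEMeasurable f lam01) :
    X (rearr lam01 f) = X f :=
  hX.rearr_inv _ _ (measurable_rearr _ _).aemeasurable hf fun t _ => by rw [rearr_rearr]

end IsRIFunctional

namespace IsRIBanachNorm

variable {X : (ℝ → ℝ≥0∞) → ℝ≥0∞}

theorem map_zero (hX : IsRIBanachNorm X) : X (fun _ => 0) = 0 :=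
  (hX.eq_zero_iff _ aemeasurable_const).2 Filter.EventuallyEq.rfl

theorem sum_le (hX : IsRIBanachNorm X) {ι : Type*} (s : Finset ι) {F : ι → ℝ → ℝ≥0∞}
    (hF : ∀ i, AEMeasurable (F i) lam01) : X (fun t => ∑ i ∈ s, F i t) ≤ ∑ i ∈ s, X (F i) := by
  classical
  induction s using Finset.induction_on with
  | empty => simp [hX.map_zero]
  | insert a s ha ih =>
    simp only [Finset.sum_insert ha]
    exact (hX.add_le _ _ (hF a) (Finset.aemeasurable_fun_sum s fun i _ => hF i)).trans (by gcongr)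

theorem lintegral_lt_top (hX : IsRIBanachNorm X) {f : ℝ → ℝ≥0∞} (hf : AEMeasurable f lam01)
    (h : X f < ∞) : ∫⁻ t, f t ∂lam01 < ∞ := by
  obtain ⟨C, hC⟩ := hX.lintegral_le
  exact (hC f hf).trans_lt (ENNReal.mul_lt_top ENNReal.coe_lt_top h)

theorem map_const_lt_top (hX : IsRIBanachNorm X) (c : ℝ≥0) : X (fun _ => c) < ∞ := by
  have := hX.smul (fun _ => 1) aemeasurable_const c
  simp only [mul_one] at this
  rw [this]
  exact ENNReal.mul_lt_top ENNReal.coe_lt_top hX.one_lt_top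

theorem cellStep_average_le (hX : IsRIBanachNorm X) {N : ℕ} (hN : 0 < N) {c d : ℝ} (hc : 0 ≤ c)
    (hcd : c < d) (hd : d ≤ 1) (v : ℕ → ℝ≥0∞) {h : ℝ → ℝ≥0∞} (hh : Measurable h) :
    X (cellStep N c d (fun _ => (∑ i ∈ Finset.range N, v i) / N) h) ≤ X (cellStep N c d v h) := by
  have hN0 : (N : ℝ≥0∞) ≠ 0 := by exact_mod_cast hN.ne'
  have hNt : (N : ℝ≥0∞) ≠ ∞ := ENNReal.natCast_ne_top N
  let F : ℕ → ℝ → ℝ≥0∞ := fun k => cellStep N c d (fun i => v ((i + k) % N)) h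
  have hF : ∀ k, AEMeasurable (F k) lam01 := fun k => (measurable_cellStep _ _ _ _ hh).aemeasurable
  have hinv : ((N⁻¹ : ℝ≥0) : ℝ≥0∞) = (N : ℝ≥0∞)⁻¹ := by
    rw [ENNReal.coe_inv (by exact_mod_cast hN.ne')]; simp
  have e : cellStep N c d (fun _ => (∑ i ∈ Finset.range N, v i) / N) h =
      fun t => ((N⁻¹ : ℝ≥0) : ℝ≥0∞) * ∑ k ∈ Finset.range N, F k t := by
    funext t
    rw [hinv]
    by_cases ht : t ∈ Ico c d
    · have : ∀ k, F k t = v ((⌊(t - c) / (d - c) * N⌋₊ + k) % N) := fun k =>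
        piecewise_eq_of_mem _ _ _ ht
      simp only [this]
      rw [sum_range_add_mod, cellStep, piecewise_eq_of_mem _ _ _ ht, div_eq_mul_inv, mul_comm]
    · have : ∀ k, F k t = h t := fun k => piecewise_eq_of_notMem _ _ _ ht
      simp only [this, Finset.sum_const, Finset.card_range, nsmul_eq_mul]
      rw [cellStep, piecewise_eq_of_notMem _ _ _ ht, ← mul_assoc, ENNReal.inv_mul_cancel hN0 hNt,
        one_mul]
  have eq : ∀ k, X (F k) = X (cellStep N c d v h) := fun k => by
    refine hX.rearr_inv _ _ (hF k) (measurable_cellStep _ _ _ _ hh).aemeasurable fun t _ => ?_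
    rw [rearr_cellStep_congr hN hc hcd hd h fun w => ?_]
    simp only [add_comm _ k]
    exact sum_range_add_mod k fun i => w (v i)
  rw [e, hX.smul _ (Finset.aemeasurable_fun_sum _ fun i _ => hF i)]
  calc _ ≤ ((N⁻¹ : ℝ≥0) : ℝ≥0∞) * ∑ k ∈ Finset.range N, X (F k) := by
        gcongr; exact hX.sum_le _ hF
    _ = X (cellStep N c d v h) := by
        simp only [eq, Finset.sum_const, Finset.card_range, nsmul_eq_mul]
        rw [hinv, ← mul_assoc, ENNReal.inv_mul_cancel hN0 hNt, one_mul]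

end IsRIBanachNorm

/-! ### Lower dyadic step functions and averages -/

/-- The right endpoint of the dyadic cell containing `x` decreases to `x`. Hence a nonincreasing
function is a.e. an increasing limit of step functions, as the Fatou property of the norms requires.
-/
theorem lowerStep_spec {f : ℝ → ℝ≥0∞} (hf : Antitone f) {c d : ℝ} {x : ℝ}
    (hx : x ∈ Ico c d) :
    Monotone (fun m : ℕ => f (c + ((⌊(x - c) / (d - c) * (2 ^ m : ℕ)⌋₊ : ℝ) + 1) *
      ((d - c) / (2 ^ m : ℕ)))) ∧ (ContinuousAt f x → f x = ⨆ m : ℕ,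
      f (c + ((⌊(x - c) / (d - c) * (2 ^ m : ℕ)⌋₊ : ℝ) + 1) * ((d - c) / (2 ^ m : ℕ)))) := by
  have hcd : c < d := hx.1.trans_lt hx.2
  have hd : 0 < d - c := sub_pos.2 hcd
  set y := (x - c) / (d - c) with hy
  have hy0 : 0 ≤ y := div_nonneg (sub_nonneg.2 hx.1) hd.le
  have hyx : c + y * (d - c) = x := by rw [hy]; field_simp; ring
  let r : ℕ → ℝ := fun m => c + ((⌊y * (2 ^ m : ℕ)⌋₊ : ℝ) + 1) * ((d - c) / (2 ^ m : ℕ))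
  have rsucc : ∀ m, r (m + 1) ≤ r m := by
    intro m
    have h1 : ⌊y * (2 ^ (m + 1) : ℕ)⌋₊ < 2 * (⌊y * (2 ^ m : ℕ)⌋₊ + 1) := by
      rw [Nat.floor_lt (by positivity)]
      have := Nat.lt_floor_add_one (y * (2 ^ m : ℕ))
      push_cast at this ⊢
      rw [pow_succ]; linarith
    have h2 : ((⌊y * (2 ^ (m + 1) : ℕ)⌋₊ : ℝ) + 1) ≤ 2 * (⌊y * (2 ^ m : ℕ)⌋₊ + 1) := by
      exact_mod_cast h1
    have h3 : (d - c) / (2 ^ m : ℕ) = 2 * ((d - c) / (2 ^ (m + 1) : ℕ)) := by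
      push_cast; rw [pow_succ]; field_simp
    simp only [r]
    rw [h3]
    have : 0 < (d - c) / (2 ^ (m + 1) : ℕ) := by positivity
    nlinarith
  have ranti : Antitone r := antitone_nat_of_succ_le rsucc
  have hxr : ∀ m, x ≤ r m := fun m => by
    have hpos : (0 : ℝ) < (2 ^ m : ℕ) := by positivity
    have h1 := (Nat.lt_floor_add_one (y * (2 ^ m : ℕ))).le
    have h2 : y * (d - c) = y * (2 ^ m : ℕ) * ((d - c) / (2 ^ m : ℕ)) := by field_simp
    have h3 : 0 < (d - c) / (2 ^ m : ℕ) := by positivity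
    rw [← hyx, h2]
    simp only [r]
    gcongr
  have hrx : ∀ m, r m ≤ x + (d - c) * (1 / 2) ^ m := fun m => by
    have hpos : (0 : ℝ) < (2 ^ m : ℕ) := by positivity
    have h1 := Nat.floor_le (a := y * (2 ^ m : ℕ)) (by positivity)
    have h2 : y * (d - c) = y * (2 ^ m : ℕ) * ((d - c) / (2 ^ m : ℕ)) := by field_simp
    have h3 : 0 < (d - c) / (2 ^ m : ℕ) := by positivity
    have h4 : (d - c) * (1 / 2) ^ m = (d - c) / (2 ^ m : ℕ) := by
      push_cast; rw [one_div, inv_pow]; rfl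
    rw [h4, ← hyx, h2]
    simp only [r]
    nlinarith
  have hlim : Filter.Tendsto r Filter.atTop (nhds x) := by
    refine tendsto_of_tendsto_of_tendsto_of_le_of_le tendsto_const_nhds ?_ hxr hrx
    have := ((tendsto_pow_atTop_nhds_zero_of_lt_one (by norm_num : (0 : ℝ) ≤ 1 / 2)
      (by norm_num)).const_mul (d - c)).const_add x
    simpa using this
  have hmono : Monotone fun m => f (r m) := fun a b hab => hf (ranti hab)
  refine ⟨hmono, fun hcont => ?_⟩
  exact tendsto_nhds_unique (hcont.tendsto.comp hlim) (tendsto_atTop_iSup hmono)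

/-- The function equal to the mean of `f` on `[c,d)`, and to `f` outside. -/
noncomputable def meanOn (c d : ℝ) (f : ℝ → ℝ≥0∞) : ℝ → ℝ≥0∞ :=
  (Ico c d).piecewise (fun _ => (∫⁻ x in Ico c d, f x) / ENNReal.ofReal (d - c)) f

theorem setLIntegral_le_of_antitone {f : ℝ → ℝ≥0∞} (hf : Antitone f) {c d : ℝ} (hcd : c < d) :
    (∫⁻ x in Ico c d, f x) / ENNReal.ofReal (d - c) ≤ f c ∧
      f d ≤ (∫⁻ x in Ico c d, f x) / ENNReal.ofReal (d - c) := by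
  have hpos : ENNReal.ofReal (d - c) ≠ 0 := by simpa using hcd
  constructor
  · rw [ENNReal.div_le_iff hpos ENNReal.ofReal_ne_top]
    calc ∫⁻ x in Ico c d, f x ≤ ∫⁻ x in Ico c d, f c :=
          setLIntegral_mono measurable_const fun x hx => hf hx.1
      _ = _ := by rw [setLIntegral_const, Real.volume_Ico]
  · rw [ENNReal.le_div_iff_mul_le (Or.inl hpos) (Or.inl ENNReal.ofReal_ne_top)]
    calc _ = ∫⁻ x in Ico c d, f d := by rw [setLIntegral_const, Real.volume_Ico]
      _ ≤ _ := setLIntegral_mono hf.measurable fun x hx => hf hx.2.le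

theorem antitone_meanOn {f : ℝ → ℝ≥0∞} (hf : Antitone f) {c d : ℝ} (hcd : c < d) :
    Antitone (meanOn c d f) := by
  obtain ⟨h1, h2⟩ := setLIntegral_le_of_antitone hf hcd
  intro x y hxy
  by_cases hx : x ∈ Ico c d <;> by_cases hy : y ∈ Ico c d <;>
    simp only [meanOn, piecewise_eq_of_mem _ _ _, piecewise_eq_of_notMem _ _ _, hx, hy,
      not_false_eq_true]
  · exact le_rfl
  · refine le_trans (hf ?_) h2
    by_contra h
    exact hy ⟨hx.1.trans hxy, not_le.1 h⟩
  · refine h1.trans (hf ?_)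
    by_contra h
    exact hx ⟨(not_le.1 h).le, hxy.trans_lt hy.2⟩
  · exact hf hxy

theorem setLIntegral_meanOn {f : ℝ → ℝ≥0∞} {c d : ℝ} (hcd : c < d) :
    ∫⁻ x in Ico c d, meanOn c d f x = ∫⁻ x in Ico c d, f x := by
  have hpos : ENNReal.ofReal (d - c) ≠ 0 := by simpa using hcd
  rw [setLIntegral_congr_fun measurableSet_Ico (g := fun _ =>
    (∫⁻ x in Ico c d, f x) / ENNReal.ofReal (d - c)) fun x hx => piecewise_eq_of_mem _ _ _ hx,
    setLIntegral_const, Real.volume_Ico, ENNReal.div_mul_cancel hpos ENNReal.ofReal_ne_top]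

/-- The lower dyadic step functions lie below `f`, so averaging their values over `[c,d)` gives
functions of norm at most `X f`. The averages increase to the mean of `f`, and the Fatou property
passes to the limit. -/
theorem IsRIBanachNorm.meanOn_le {X : (ℝ → ℝ≥0∞) → ℝ≥0∞} (hX : IsRIBanachNorm X) {f : ℝ → ℝ≥0∞}
    (hf : Antitone f) {c d : ℝ} (hc : 0 ≤ c) (hcd : c < d) (hd : d ≤ 1) :
    X (meanOn c d f) ≤ X f := by
  have hdc : 0 < d - c := sub_pos.2 hcd
  let v : ℕ → ℕ → ℝ≥0∞ := fun m i => f (c + ((i : ℝ) + 1) * ((d - c) / (2 ^ m : ℕ)))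
  let A : ℕ → ℝ≥0∞ := fun m => (∑ i ∈ Finset.range (2 ^ m), v m i) / (2 ^ m : ℕ)
  have hpos : ENNReal.ofReal (d - c) ≠ 0 := by simpa using hcd
  have hA : ∀ m, A m = (∫⁻ x in Ico c d, v m ⌊(x - c) / (d - c) * (2 ^ m : ℕ)⌋₊) /
      ENNReal.ofReal (d - c) := by
    intro m
    have h3 : ENNReal.ofReal ((2 ^ m : ℕ) : ℝ) = ((2 ^ m : ℕ) : ℝ≥0∞) := ENNReal.ofReal_natCast _
    rw [setLIntegral_cell_const (by positivity) hcd, ENNReal.ofReal_div_of_pos (by positivity), h3,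
      div_eq_mul_inv (ENNReal.ofReal _), mul_div_assoc,
      mul_comm (ENNReal.ofReal _), ENNReal.mul_div_cancel_right hpos ENNReal.ofReal_ne_top]
    rfl
  have hAmono : Monotone A := fun m n hmn => by
    rw [hA, hA]
    refine ENNReal.div_le_div_right ?_ _
    exact setLIntegral_mono (measurable_cell _ _ _ _) fun x hx => (lowerStep_spec hf hx).1 hmn
  have hAsup : (∫⁻ x in Ico c d, f x) / ENNReal.ofReal (d - c) = ⨆ m, A m := by
    simp only [hA]
    rw [← ENNReal.iSup_div, ← lintegral_iSup']
    · congr 1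
      refine lintegral_congr_ae ?_
      filter_upwards [ae_restrict_mem measurableSet_Ico,
        hf.countable_not_continuousAt.ae_notMem (volume.restrict (Ico c d))] with x hx hcont
      exact (lowerStep_spec hf hx).2 (not_not.1 hcont)
    · exact fun m => (measurable_cell _ _ _ _).aemeasurable
    · filter_upwards [ae_restrict_mem measurableSet_Ico] with x hx
      exact (lowerStep_spec hf hx).1
  have step : ∀ m, X (cellStep (2 ^ m) c d (fun _ => A m) f) ≤ X f := by
    intro m
    refine (hX.cellStep_average_le (by positivity) hc hcd hd (v m) hf.measurable).trans ?_
    refine hX.mono _ _ (measurable_cellStep _ _ _ _ hf.measurable).aemeasurable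
      hf.measurable.aemeasurable (ae_of_all _ fun x => ?_)
    by_cases hx : x ∈ Ico c d
    · rw [cellStep, piecewise_eq_of_mem _ _ _ hx]
      refine hf ?_
      have hN : 0 < 2 ^ m := by positivity
      exact ((cell_eq_iff hN hcd hx.1 _).1 rfl).2.le
    · rw [cellStep, piecewise_eq_of_notMem _ _ _ hx]
  rw [hX.iSup_of_monotone (fun m => cellStep (2 ^ m) c d (fun _ => A m) f) (meanOn c d f)
    (fun m => (measurable_cellStep _ _ _ _ hf.measurable).aemeasurable)
    (antitone_meanOn hf hcd).measurable.aemeasurable (ae_of_all _ fun x => ?_)]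
  · exact iSup_le step
  · by_cases hx : x ∈ Ico c d <;>
      simp only [meanOn, cellStep, piecewise_eq_of_mem _ _ _, piecewise_eq_of_notMem _ _ _, hx,
        not_false_eq_true]
    · exact ⟨hAmono, hAsup⟩
    · exact ⟨monotone_const, by simp⟩

/-! ### Duality for nonincreasing functions -/

namespace IsRIBanachNorm

variable {X : (ℝ → ℝ≥0∞) → ℝ≥0∞}

theorem cellStep_mean_le (hX : IsRIBanachNorm X) {f : ℝ → ℝ≥0∞} (hf : Antitone f) {N : ℕ}
    (hN : 0 < N) :
    X (cellStep N 0 1 (fun i => (∫⁻ x in Ico (i * (1 / N : ℝ)) ((i + 1) * (1 / N : ℝ)), f x) /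
      ENNReal.ofReal (1 / N)) 0) ≤ X f := by
  have hN' : (0 : ℝ) < N := Nat.cast_pos.2 hN
  set J : ℕ → Set ℝ := fun i => Ico (i * (1 / N : ℝ)) ((i + 1) * (1 / N : ℝ)) with hJ
  have hfl : ∀ {x : ℝ}, 0 ≤ x → ∀ i, ⌊(x - 0) / (1 - 0) * N⌋₊ = i ↔ x ∈ J i := fun hx i => by
    rw [cell_eq_iff hN zero_lt_one hx]; simp [hJ]
  have hnn : ∀ {x : ℝ} {i : ℕ}, x ∈ J i → 0 ≤ x := fun {x i} hx =>
    le_trans (by positivity) hx.1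
  have hdisj : ∀ {x : ℝ} {i j : ℕ}, x ∈ J i → x ∈ J j → i = j := fun hi hj =>
    ((hfl (hnn hi) _).2 hi).symm.trans ((hfl (hnn hi) _).2 hj)
  -- The cells are averaged one after the other. Monotonicity is carried along for the next use of
  -- `meanOn_le`, and the unchanged cell integrals ensure that the later means are still those of
  -- `f`.
  have key : ∀ j ≤ N, ∃ g : ℝ → ℝ≥0∞, Antitone g ∧ X g ≤ X f ∧
      (∀ i, ∫⁻ x in J i, g x = ∫⁻ x in J i, f x) ∧
      ∀ i < j, ∀ x ∈ J i, g x = (∫⁻ x in J i, f x) / ENNReal.ofReal (1 / N) := by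
    intro j
    induction j with
    | zero => exact fun _ => ⟨f, hf, le_rfl, fun _ => rfl, by simp⟩
    | succ j ih =>
      intro hj
      obtain ⟨g, hg, hgX, hgi, hgj⟩ := ih (by omega)
      have hlt : (j : ℝ) * (1 / N) < (j + 1) * (1 / N) := by
        have : (0 : ℝ) < 1 / N := by positivity
        linarith
      have hlen : ((j : ℝ) + 1) * (1 / N) - j * (1 / N) = 1 / N := by ring
      have hle : ((j : ℝ) + 1) * (1 / N) ≤ 1 := by
        rw [mul_one_div, div_le_one hN']; exact_mod_cast hj
      have hne : ∀ i, i ≠ j → ∀ x ∈ J i, meanOn (j * (1 / N)) ((j + 1) * (1 / N)) g x = g x :=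
        fun i hij x hx => piecewise_eq_of_notMem _ _ _ fun h => hij (hdisj hx h)
      refine ⟨meanOn (j * (1 / N)) ((j + 1) * (1 / N)) g, antitone_meanOn hg hlt,
        (hX.meanOn_le hg (by positivity) hlt hle).trans hgX, fun i => ?_, fun i hi x hx => ?_⟩
      · rw [← hgi]
        by_cases hij : i = j
        · rw [hij]; exact setLIntegral_meanOn hlt
        · exact setLIntegral_congr_fun measurableSet_Ico (hne i hij)
      · by_cases hij : i = j
        · subst hij
          rw [← hgi, meanOn, piecewise_eq_of_mem _ _ _ hx, hlen]
        · rw [hne i hij x hx]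
          exact hgj i (by omega) x hx
  obtain ⟨g, hg, hgX, -, hgN⟩ := key N le_rfl
  refine le_trans (le_of_eq (hX.congr_ae ?_ ?_)) hgX
  · exact (measurable_cellStep _ _ _ _ measurable_const).aemeasurable
  · filter_upwards [ae_lam01_mem] with x hx
    have hx' : x ∈ Ico (0 : ℝ) 1 := ⟨hx.1.le, hx.2⟩
    rw [cellStep, piecewise_eq_of_mem _ _ _ hx']
    exact (hgN _ (cell_lt hN hx') x ((hfl hx'.1 _).1 rfl)).symm

/-- Hahn–Banach in `ℝ^N` gives a linear functional below the norm of step functions and equal to it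
at `v`. Sorting its coefficients decreasingly keeps the upper bound, by rearrangement invariance,
and does not lower the value at `v`, by the rearrangement inequality. -/
theorem exists_antitone_dual (hX : IsRIBanachNorm X) {N : ℕ} (hN : 0 < N) {v : ℕ → ℝ≥0}
    (hv : Antitone v) :
    ∃ κ : ℕ → ℝ≥0, Antitone κ ∧
      (∀ w : ℕ → ℝ≥0, ((∑ i ∈ Finset.range N, κ i * w i : ℝ≥0) : ℝ≥0∞) ≤
        X (cellStep N 0 1 (fun i => w i) 0)) ∧
      X (cellStep N 0 1 (fun i => v i) 0) = (∑ i ∈ Finset.range N, κ i * v i : ℝ≥0) := by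
  -- `ENNReal.ofReal` takes the positive part. The resulting `P` is sublinear and vanishes at
  -- `-e_i`, which forces the dominated functional to have nonnegative coefficients.
  let ex : (Fin N → ℝ) → ℕ → ℝ≥0∞ := fun u i => if h : i < N then ENNReal.ofReal (u ⟨i, h⟩) else 0
  let S : (Fin N → ℝ) → ℝ → ℝ≥0∞ := fun u => cellStep N 0 1 (ex u) 0
  have hS : ∀ u, AEMeasurable (S u) lam01 := fun u =>
    (measurable_cellStep _ _ _ _ measurable_const).aemeasurable
  have hval : ∀ (w : ℕ → ℝ≥0∞), ∀ x ∈ Ico (0 : ℝ) 1, ∃ i < N, cellStep N 0 1 w 0 x = w i :=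
    fun w x hx => ⟨_, cell_lt hN hx, piecewise_eq_of_mem _ _ _ hx⟩
  have hmono : ∀ w w' : ℕ → ℝ≥0∞, (∀ i < N, w i ≤ w' i) →
      X (cellStep N 0 1 w 0) ≤ X (cellStep N 0 1 w' 0) := fun w w' h =>
    hX.mono _ _ (measurable_cellStep _ _ _ _ measurable_const).aemeasurable
      (measurable_cellStep _ _ _ _ measurable_const).aemeasurable (ae_of_all _ fun x => by
        by_cases hx : x ∈ Ico (0 : ℝ) 1
        · rw [cellStep, cellStep, piecewise_eq_of_mem _ _ _ hx, piecewise_eq_of_mem _ _ _ hx]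
          exact h _ (cell_lt hN hx)
        · rw [cellStep, cellStep, piecewise_eq_of_notMem _ _ _ hx,
            piecewise_eq_of_notMem _ _ _ hx])
  have hexlt : ∀ u i (h : i < N), ex u i = ENNReal.ofReal (u ⟨i, h⟩) := fun u i h => dif_pos h
  have hSin : ∀ u, ∀ (t : ℝ) (ht : t ∈ Ico (0 : ℝ) 1),
      S u t = ENNReal.ofReal (u ⟨⌊(t - 0) / (1 - 0) * N⌋₊, cell_lt hN ht⟩) := fun u t ht =>
    (piecewise_eq_of_mem _ _ _ ht).trans (hexlt u _ (cell_lt hN ht))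
  have hSout : ∀ u, ∀ (t : ℝ) (_ : t ∉ Ico (0 : ℝ) 1), S u t = 0 := fun u t ht =>
    piecewise_eq_of_notMem _ _ _ ht
  have hfin : ∀ u, X (S u) < ∞ := by
    intro u
    refine lt_of_le_of_lt ?_ (hX.map_const_lt_top (∑ i, ‖u i‖₊))
    refine hX.mono _ _ (hS u) aemeasurable_const (ae_of_all _ fun x => ?_)
    by_cases hx : x ∈ Ico (0 : ℝ) 1
    · obtain ⟨i, hi, h⟩ := hval (ex u) x hx
      change cellStep N 0 1 (ex u) 0 x ≤ _
      rw [h, hexlt u i hi]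
      refine le_trans (ENNReal.ofReal_le_ofReal (le_abs_self _)) ?_
      rw [← Real.norm_eq_abs, ofReal_norm, enorm_eq_nnnorm]
      refine ENNReal.coe_le_coe.2 ?_
      exact Finset.single_le_sum (f := fun i => ‖u i‖₊) (fun _ _ => zero_le)
        (Finset.mem_univ (⟨i, hi⟩ : Fin N))
    · change cellStep N 0 1 (ex u) 0 x ≤ _
      rw [cellStep, piecewise_eq_of_notMem _ _ _ hx]
      exact zero_le
  let P : (Fin N → ℝ) → ℝ := fun u => (X (S u)).toReal
  have Pnn : ∀ u, 0 ≤ P u := fun u => ENNReal.toReal_nonneg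
  have Phom : ∀ c : ℝ, 0 < c → ∀ u, P (c • u) = c * P u := by
    intro c hc u
    have e : S (c • u) = fun t => ((c.toNNReal : ℝ≥0) : ℝ≥0∞) * S u t := by
      funext t
      by_cases ht : t ∈ Ico (0 : ℝ) 1
      · rw [hSin _ _ ht, hSin _ _ ht, Pi.smul_apply, smul_eq_mul, ENNReal.ofReal_mul hc.le]
        rfl
      · rw [hSout _ _ ht, hSout _ _ ht, mul_zero]
    simp only [P]
    rw [e, hX.smul _ (hS u), ENNReal.toReal_mul]
    simp [hc.le]
  have Padd : ∀ u w, P (u + w) ≤ P u + P w := by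
    intro u w
    simp only [P]
    rw [← ENNReal.toReal_add (hfin u).ne (hfin w).ne]
    refine ENNReal.toReal_mono (ENNReal.add_lt_top.2 ⟨hfin u, hfin w⟩).ne ?_
    refine (hX.mono _ (fun t => S u t + S w t) (hS _) ((hS u).add (hS w))
      (ae_of_all _ fun t => ?_)).trans (hX.add_le _ _ (hS u) (hS w))
    by_cases ht : t ∈ Ico (0 : ℝ) 1
    · simp only [hSin _ _ ht]
      exact ENNReal.ofReal_add_le
    · simp only [hSout _ _ ht]; simp
  let ev : (ℕ → ℝ≥0) → Fin N → ℝ := fun w i => w i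
  let v' := ev v
  have hwS : ∀ w : ℕ → ℝ≥0, X (S (ev w)) = X (cellStep N 0 1 (fun i => w i) 0) := by
    intro w
    refine le_antisymm (hmono _ _ fun i hi => ?_) (hmono _ _ fun i hi => ?_) <;>
      rw [hexlt (ev w) _ hi] <;> simp [ev]
  obtain ⟨g, hg1, hg2⟩ : ∃ g : (Fin N → ℝ) →ₗ[ℝ] ℝ, g v' = P v' ∧ ∀ x, g x ≤ P x := by
    by_cases hv0 : v' = 0
    · refine ⟨0, ?_, fun x => Pnn x⟩
      have : S v' = fun _ => 0 := by
        funext t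
        by_cases ht : t ∈ Ico (0 : ℝ) 1
        · rw [hSin _ _ ht, hv0]; simp
        · exact hSout _ _ ht
      simp [P, this, hX.map_zero]
    · obtain ⟨g, hg1, hg2⟩ := exists_extension_of_le_sublinear
        (LinearPMap.mkSpanSingleton (K := ℝ) v' (P v') hv0) P Phom Padd (by
          rintro ⟨x, hx⟩
          obtain ⟨a, rfl⟩ := Submodule.mem_span_singleton.1 hx
          change LinearPMap.mkSpanSingleton' _ _ _ _ ≤ _
          rw [LinearPMap.mkSpanSingleton'_apply, smul_eq_mul]
          rcases lt_or_ge 0 a with ha | ha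
          · exact (Phom a ha v').ge
          · exact (mul_nonpos_of_nonpos_of_nonneg ha (Pnn _)).trans (Pnn _))
      refine ⟨g, ?_, hg2⟩
      exact (hg1 ⟨v', Submodule.mem_span_singleton_self v'⟩).trans
        (LinearPMap.mkSpanSingleton_apply ℝ ℝ hv0 _)
  let k : Fin N → ℝ := fun i => g (Pi.single i 1)
  have hgk : ∀ u, g u = ∑ i, k i * u i := by
    intro u
    rw [LinearMap.pi_apply_eq_sum_univ g u]
    refine Finset.sum_congr rfl fun i _ => ?_
    rw [smul_eq_mul, mul_comm]
    congr 2
    funext j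
    simp [Pi.single_apply, eq_comm]
  have knn : ∀ i, 0 ≤ k i := by
    intro i
    have h1 := hg2 (-Pi.single i 1)
    have h2 : S (-Pi.single i 1) = fun _ => 0 := by
      funext t
      by_cases ht : t ∈ Ico (0 : ℝ) 1
      · rw [hSin _ _ ht]
        simp only [Pi.neg_apply, ENNReal.ofReal_eq_zero, Left.neg_nonpos_iff, Pi.single_apply]
        split_ifs <;> norm_num
      · exact hSout _ _ ht
    have h3 : P (-Pi.single i 1) = 0 := by simp [P, h2, hX.map_zero]
    rw [h3, map_neg] at h1
    simpa [k] using h1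
  let σ : Equiv.Perm (Fin N) := Tuple.sort fun i => OrderDual.toDual (k i)
  have hσ : Antitone (k ∘ σ) := fun i j hij => Tuple.monotone_sort (fun i => OrderDual.toDual (k i)) hij
  have Pperm : ∀ u, P (u ∘ σ.symm) = P u := by
    intro u
    simp only [P]
    congr 1
    refine hX.rearr_inv _ _ (hS _) (hS _) fun t _ => ?_
    simp only [S]
    rw [rearr_cellStep_congr hN le_rfl zero_lt_one le_rfl 0 fun w => ?_]
    have h : ∀ u : Fin N → ℝ, ∑ i ∈ Finset.range N, w (ex u i) = ∑ i, w (ENNReal.ofReal (u i)) :=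
      fun u => by
        rw [Finset.sum_range]
        exact Finset.sum_congr rfl fun i _ => by rw [hexlt u i i.2]
    rw [h, h]
    exact Equiv.sum_comp σ.symm fun i => w (ENNReal.ofReal (u i))
  let κ : ℕ → ℝ≥0 := fun i => if h : i < N then (k (σ ⟨i, h⟩)).toNNReal else 0
  have hκ : ∀ w : ℕ → ℝ≥0, ((∑ i ∈ Finset.range N, κ i * w i : ℝ≥0) : ℝ) =
      ∑ i : Fin N, k (σ i) * w i := by
    intro w
    rw [Finset.sum_range]
    push_cast
    refine Finset.sum_congr rfl fun i _ => ?_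
    simp [κ, knn]
  have hupper : ∀ w : ℕ → ℝ≥0, ((∑ i ∈ Finset.range N, κ i * w i : ℝ≥0) : ℝ) ≤ P (ev w) := by
    intro w
    rw [hκ, ← Pperm (ev w)]
    refine le_trans (le_of_eq ?_) (hg2 _)
    rw [hgk, ← Equiv.sum_comp σ fun i => k i * (ev w ∘ σ.symm) i]
    simp [ev]
  have hle : ∀ w : ℕ → ℝ≥0, ((∑ i ∈ Finset.range N, κ i * w i : ℝ≥0) : ℝ≥0∞) ≤
      X (cellStep N 0 1 (fun i => w i) 0) := by
    intro w
    rw [← hwS, ← ENNReal.ofReal_coe_nnreal]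
    exact ENNReal.ofReal_le_of_le_toReal (hupper w)
  refine ⟨κ, ?_, hle, le_antisymm ?_ (hle v)⟩
  · intro i j hij
    by_cases hj : j < N
    · have hi : i < N := hij.trans_lt hj
      simp only [κ, dif_pos hi, dif_pos hj]
      exact Real.toNNReal_le_toNNReal (hσ (show (⟨i, hi⟩ : Fin N) ≤ ⟨j, hj⟩ from hij))
    · simp [κ, dif_neg hj]
  · rw [← hwS v, ← ENNReal.ofReal_toReal (hfin (ev v)).ne, ← ENNReal.ofReal_coe_nnreal]
    refine ENNReal.ofReal_le_ofReal ?_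
    rw [hκ]
    change P v' ≤ _
    rw [← hg1, hgk]
    -- Both the sorted coefficients and `v` are nonincreasing, so this pairing is the largest among
    -- all permutations.
    have hvm : Monovary (k ∘ σ) v' := hσ.monovary fun i j hij => NNReal.coe_le_coe.2 (hv hij)
    have := hvm.sum_comp_perm_mul_le_sum_mul (σ := σ.symm)
    simpa using this

/-- The Lorentz–Luxemburg theorem for nonincreasing functions. -/
theorem le_of_forall_antitone (hX : IsRIBanachNorm X) {G : ℝ → ℝ≥0∞} (hG : Antitone G)
    (hfin : ∀ t, 0 < t → G t < ∞) {M : ℝ≥0∞}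
    (H : ∀ K : ℝ → ℝ≥0∞, Antitone K → (∀ t, K t < ∞) → assocNorm X K ≤ 1 →
      ∫⁻ t, G t * K t ∂lam01 ≤ M) : X G ≤ M := by
  have hr : ∀ (m i : ℕ), (0 : ℝ) < 0 + ((i : ℝ) + 1) * ((1 - 0) / (2 ^ m : ℕ)) := fun m i => by
    push_cast; positivity
  let v : ℕ → ℕ → ℝ≥0 := fun m i => (G (0 + ((i : ℝ) + 1) * ((1 - 0) / (2 ^ m : ℕ)))).toNNReal
  have hv : ∀ m i, (v m i : ℝ≥0∞) = G (0 + ((i : ℝ) + 1) * ((1 - 0) / (2 ^ m : ℕ))) := fun m i =>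
    ENNReal.coe_toNNReal (hfin _ (hr m i)).ne
  have hvanti : ∀ m, Antitone (v m) := fun m i j hij => by
    rw [← ENNReal.coe_le_coe, hv, hv]
    refine hG ?_
    gcongr
  let L : ℕ → ℝ → ℝ≥0∞ := fun m => cellStep (2 ^ m) 0 1 (fun i => v m i) 0
  have hL : ∀ m, ∀ x ∈ Ioo (0 : ℝ) 1, L m x =
      G (0 + ((⌊(x - 0) / (1 - 0) * (2 ^ m : ℕ)⌋₊ : ℝ) + 1) * ((1 - 0) / (2 ^ m : ℕ))) :=
    fun m x hx => by
      rw [← hv]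
      exact piecewise_eq_of_mem _ _ _ (Ioo_subset_Ico_self hx)
  rw [hX.iSup_of_monotone L G
    (fun m => (measurable_cellStep _ _ _ _ measurable_const).aemeasurable)
    hG.measurable.aemeasurable]
  swap
  · filter_upwards [ae_lam01_mem, hG.countable_not_continuousAt.ae_notMem lam01] with x hx hc
    simp only [hL _ x hx]
    have := lowerStep_spec hG (Ioo_subset_Ico_self hx)
    exact ⟨this.1, this.2 (not_not.1 hc)⟩
  -- By the Fatou property it suffices to treat the lower dyadic step functions of `G`, for which
  -- the finite-dimensional duality supplies a test function.
  refine iSup_le fun m => ?_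
  have hN : 0 < 2 ^ m := by positivity
  obtain ⟨κ, hκ, hκle, hκeq⟩ := hX.exists_antitone_dual hN (hvanti m)
  set N := 2 ^ m with hNdef
  have hN' : (0 : ℝ) < N := Nat.cast_pos.2 hN
  have hNe : ENNReal.ofReal ((1 - 0) / N) = (N : ℝ≥0∞)⁻¹ := by
    rw [sub_zero, one_div, ENNReal.ofReal_inv_of_pos hN', ENNReal.ofReal_natCast]
  have hN0 : (N : ℝ≥0∞) ≠ 0 := by exact_mod_cast hN.ne'
  have hNt : (N : ℝ≥0∞) ≠ ∞ := ENNReal.natCast_ne_top N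
  -- The factor `N` compensates for the cell length `1/N`. `Nat.floor` is monotone on all of `ℝ`
  -- with value `0` at negative numbers, so `K` is nonincreasing on the whole line.
  let K : ℝ → ℝ≥0∞ := fun x => N * κ ⌊(x - 0) / (1 - 0) * N⌋₊
  have hK : Antitone K := fun x y hxy => by
    simp only [K]
    gcongr
    refine hκ (Nat.floor_mono ?_)
    gcongr
  have hint : ∀ g : ℝ → ℝ≥0∞, ∫⁻ x, K x * g x ∂lam01 = ∑ i ∈ Finset.range N,
      ∫⁻ x in Ico (0 + i * ((1 - 0) / N : ℝ)) (0 + (i + 1) * ((1 - 0) / N : ℝ)),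
        (N * κ i) * g x := by
    intro g
    rw [← setLIntegral_cell hN zero_lt_one (fun i => N * (κ i : ℝ≥0∞)) g, lam01,
      restrict_Ioo_eq_restrict_Ico]
  -- Hardy–Littlewood replaces `g` by `g^*`; since `K` is constant on cells, only the cell means of
  -- `g^*` matter, and averaging over the cells does not increase the norm.
  have hassoc : assocNorm X K ≤ 1 := by
    refine iSup_le fun g => iSup_le fun hg => iSup_le fun hg1 => ?_
    have hr1 : X (rearr lam01 g) ≤ 1 := by rwa [hX.map_rearr hg]
    have hrm := antitone_rearr lam01 g
    let e : ℕ → ℝ≥0∞ := fun i => (∫⁻ x in Ico (i * (1 / N : ℝ)) ((i + 1) * (1 / N : ℝ)),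
      rearr lam01 g x) / ENNReal.ofReal (1 / N)
    have hefin : ∀ i < N, e i ≠ ∞ := by
      intro i hi
      refine ENNReal.div_ne_top ?_ ?_
      · refine ne_top_of_le_ne_top (hX.lintegral_lt_top hrm.measurable.aemeasurable
          (hr1.trans_lt ENNReal.one_lt_top)).ne ?_
        rw [lam01, restrict_Ioo_eq_restrict_Ico]
        refine lintegral_mono_set (Ico_subset_Ico (by positivity) ?_)
        rw [mul_one_div, div_le_one hN']; exact_mod_cast hi
      · simpa using hN.ne'
    calc ∫⁻ t, K t * g t ∂lam01 = ∫⁻ t, g t * K t ∂lam01 := by simp only [mul_comm]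
      _ ≤ ∫⁻ t, rearr lam01 g t * K t ∂lam01 := lintegral_mul_le_rearr hg hK
      _ = ∫⁻ t, K t * rearr lam01 g t ∂lam01 := by simp only [mul_comm]
      _ = ∑ i ∈ Finset.range N, (κ i : ℝ≥0∞) * e i := by
          rw [hint]
          refine Finset.sum_congr rfl fun i _ => ?_
          rw [lintegral_const_mul _ hrm.measurable]
          simp only [e]
          rw [sub_zero] at hNe
          rw [hNe, ENNReal.div_eq_inv_mul, inv_inv]
          simp only [zero_add, sub_zero]
          rw [← mul_assoc, mul_comm (κ i : ℝ≥0∞)]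
      _ = ((∑ i ∈ Finset.range N, κ i * (e i).toNNReal : ℝ≥0) : ℝ≥0∞) := by
          push_cast
          refine Finset.sum_congr rfl fun i hi => ?_
          rw [ENNReal.coe_toNNReal (hefin i (Finset.mem_range.1 hi))]
      _ ≤ X (cellStep N 0 1 (fun i => (e i).toNNReal) 0) := hκle _
      _ ≤ X (cellStep N 0 1 e 0) := by
          refine hX.mono _ _ (measurable_cellStep _ _ _ _ measurable_const).aemeasurable
            (measurable_cellStep _ _ _ _ measurable_const).aemeasurable (ae_of_all _ fun x => ?_)
          refine (piecewise_mono (fun y _ => ?_) fun y _ => le_rfl :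
            (Ico (0 : ℝ) 1).piecewise _ _ ≤ (Ico (0 : ℝ) 1).piecewise _ _) x
          exact ENNReal.coe_toNNReal_le_self
      _ ≤ X (rearr lam01 g) := hX.cellStep_mean_le hrm hN
      _ ≤ 1 := hr1
  calc X (L m) = ((∑ i ∈ Finset.range N, κ i * v m i : ℝ≥0) : ℝ≥0∞) := hκeq
    _ = ∑ i ∈ Finset.range N,
      ∫⁻ x in Ico (0 + i * ((1 - 0) / N : ℝ)) (0 + (i + 1) * ((1 - 0) / N : ℝ)),
        (N * κ i) * (v m i : ℝ≥0∞) := by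
        push_cast
        refine Finset.sum_congr rfl fun i _ => ?_
        rw [setLIntegral_const, Real.volume_Ico, show 0 + ((i : ℝ) + 1) * ((1 - 0) / N) -
          (0 + i * ((1 - 0) / N)) = (1 - 0) / N by ring, hNe]
        calc (κ i * v m i : ℝ≥0∞) = (N * (N : ℝ≥0∞)⁻¹) * (κ i * v m i) := by
              rw [ENNReal.mul_inv_cancel hN0 hNt, one_mul]
          _ = _ := by ring
    _ ≤ ∫⁻ x, K x * G x ∂lam01 := by
        rw [hint]
        refine Finset.sum_le_sum fun i _ => setLIntegral_mono
          (measurable_const.mul hG.measurable) fun x hx => ?_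
        gcongr
        rw [hv]
        exact hG hx.2.le
    _ = ∫⁻ x, G x * K x ∂lam01 := by simp only [mul_comm]
    _ ≤ M := H K hK (fun t => ENNReal.mul_lt_top hNt.lt_top ENNReal.coe_lt_top) hassoc

/-- Hölder's inequality, by normalising `g`. The degenerate norms `0` and `∞` of `g` need separate
arguments because `∞ * 0 = 0`. -/
theorem lintegral_mul_le_assocNorm (hX : IsRIBanachNorm X) {f g : ℝ → ℝ≥0∞}
    (hf : AEMeasurable f lam01) (hg : AEMeasurable g lam01) :
    ∫⁻ t, f t * g t ∂lam01 ≤ X g * assocNorm X f := by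
  by_cases h0 : X g = 0
  · have : (fun t => f t * g t) =ᵐ[lam01] 0 :=
      ((hX.eq_zero_iff g hg).1 h0).mono fun t ht => by simp [ht]
    rw [lintegral_congr_ae this]; simp
  by_cases htop : X g = ∞
  -- If the associate norm of `f` vanishes, testing with a constant function of norm at most one
  -- shows that `f = 0` a.e.
  · by_cases hA : assocNorm X f = 0
    · have h1 := hX.one_lt_top
      set a := (X fun _ => 1).toNNReal with ha
      have hXa : X (fun _ => 1) = a := (ENNReal.coe_toNNReal h1.ne).symm
      have ha0 : a ≠ 0 := by
        intro h
        rw [h] at hXa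
        have := (hX.eq_zero_iff (fun _ => 1) aemeasurable_const).1 (by simpa using hXa)
        obtain ⟨t, ht⟩ := this.exists
        exact one_ne_zero ht
      have h2 : X (fun _ => ((a⁻¹ : ℝ≥0) : ℝ≥0∞)) ≤ 1 := by
        have := hX.smul (fun _ => 1) aemeasurable_const a⁻¹
        simp only [mul_one] at this
        rw [this, hXa, ← ENNReal.coe_mul, inv_mul_cancel₀ ha0, ENNReal.coe_one]
      have h3 : ∫⁻ t, f t * ((a⁻¹ : ℝ≥0) : ℝ≥0∞) ∂lam01 ≤ 0 := by
        rw [← hA]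
        exact le_iSup_of_le (fun _ => ((a⁻¹ : ℝ≥0) : ℝ≥0∞))
          (le_iSup_of_le aemeasurable_const (le_iSup_of_le h2 le_rfl))
      rw [nonpos_iff_eq_zero, lintegral_eq_zero_iff' (hf.mul_const _)] at h3
      have : (fun t => f t * g t) =ᵐ[lam01] 0 := h3.mono fun t ht => by
        have : f t = 0 := by
          rcases mul_eq_zero.1 ht with h | h
          · exact h
          · simp [ha0] at h
        simp [this]
      rw [lintegral_congr_ae this]; simp
    · rw [htop, ENNReal.top_mul hA]; exact le_top
  set c := (X g).toNNReal with hc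
  have hXc : X g = c := (ENNReal.coe_toNNReal htop).symm
  have hc0 : c ≠ 0 := fun h => h0 (by rw [hXc, h]; rfl)
  have h2 : X (fun t => ((c⁻¹ : ℝ≥0) : ℝ≥0∞) * g t) ≤ 1 := by
    rw [hX.smul g hg, hXc, ← ENNReal.coe_mul, inv_mul_cancel₀ hc0, ENNReal.coe_one]
  have h3 : ∫⁻ t, f t * (((c⁻¹ : ℝ≥0) : ℝ≥0∞) * g t) ∂lam01 ≤ assocNorm X f :=
    le_iSup_of_le (fun t => ((c⁻¹ : ℝ≥0) : ℝ≥0∞) * g t)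
      (le_iSup_of_le (hg.const_mul _) (le_iSup_of_le h2 le_rfl))
  calc ∫⁻ t, f t * g t ∂lam01 = ∫⁻ t, c * (f t * (((c⁻¹ : ℝ≥0) : ℝ≥0∞) * g t)) ∂lam01 := by
        refine lintegral_congr fun t => ?_
        rw [mul_left_comm (f t), ← mul_assoc, ← ENNReal.coe_mul, mul_inv_cancel₀ hc0,
          ENNReal.coe_one, one_mul]
    _ = c * ∫⁻ t, f t * (((c⁻¹ : ℝ≥0) : ℝ≥0∞) * g t) ∂lam01 :=
        lintegral_const_mul'' _ (hf.mul (hg.const_mul _))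
    _ ≤ X g * assocNorm X f := by rw [hXc]; gcongr

end IsRIBanachNorm

/-! ### The change of variables -/

/-- The function `φ(t) = ½ ∫_0^t ℓ`. -/
noncomputable def phi (t : ℝ) : ℝ := t * (1 + ell t) / 2

/-- The inverse of `phi` on `[0,1]`. -/
noncomputable def psi : ℝ → ℝ := Function.invFunOn phi (Icc 0 1)

theorem measurable_ell : Measurable ell := measurable_const.sub Real.measurable_log

theorem one_le_ell {t : ℝ} (h0 : 0 < t) (h1 : t ≤ 1) : 1 ≤ ell t := by
  have := Real.log_nonpos h0.le h1
  unfold ell; linarith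

theorem ell_le_ell {s t : ℝ} (hs : 0 < s) (hst : s ≤ t) : ell t ≤ ell s := by
  have := Real.log_le_log hs hst
  unfold ell; linarith

theorem ell_pos {t : ℝ} (ht : t ∈ Ioo (0 : ℝ) 1) : 0 < ell t :=
  zero_lt_one.trans_le (one_le_ell ht.1 ht.2.le)

theorem phi_zero : phi 0 = 0 := by simp [phi]

theorem phi_one : phi 1 = 1 := by simp [phi, ell]

theorem measurable_phi : Measurable phi :=
  (measurable_id.mul (measurable_const.add measurable_ell)).div_const 2

theorem continuous_phi : Continuous phi := by
  have : phi = fun t => (2 * t - t * Real.log t) / 2 := by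
    funext t; simp only [phi, ell]; ring
  rw [this]
  exact ((continuous_const.mul continuous_id).sub Real.continuous_mul_log).div_const 2

theorem hasDerivAt_phi {t : ℝ} (ht : t ≠ 0) : HasDerivAt phi (ell t / 2) t := by
  have h1 : HasDerivAt ell (-t⁻¹) t := (Real.hasDerivAt_log ht).const_sub 1
  have h2 := ((hasDerivAt_id t).mul (h1.const_add 1)).div_const 2
  refine h2.congr_deriv ?_
  simp only [id]
  field_simp
  ring

theorem strictMonoOn_phi : StrictMonoOn phi (Icc 0 1) := by
  refine strictMonoOn_of_deriv_pos (convex_Icc 0 1) continuous_phi.continuousOn fun x hx => ?_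
  rw [interior_Icc] at hx
  rw [(hasDerivAt_phi hx.1.ne').deriv]
  have := ell_pos hx
  positivity

theorem phi_mem_Ioo {t : ℝ} (ht : t ∈ Ioo (0 : ℝ) 1) : phi t ∈ Ioo (0 : ℝ) 1 := by
  have h0 := strictMonoOn_phi (by simp) (Ioo_subset_Icc_self ht) ht.1
  have h1 := strictMonoOn_phi (Ioo_subset_Icc_self ht) (by simp) ht.2
  rw [phi_zero] at h0
  rw [phi_one] at h1
  exact ⟨h0, h1⟩

theorem phi_mem_Icc {t : ℝ} (ht : t ∈ Icc (0 : ℝ) 1) : phi t ∈ Icc (0 : ℝ) 1 := by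
  have h0 := strictMonoOn_phi.monotoneOn (by simp) ht ht.1
  have h1 := strictMonoOn_phi.monotoneOn ht (by simp) ht.2
  rw [phi_zero] at h0
  rw [phi_one] at h1
  exact ⟨h0, h1⟩

theorem bijOn_phi : BijOn phi (Icc 0 1) (Icc 0 1) := by
  refine ⟨fun t ht => phi_mem_Icc ht, strictMonoOn_phi.injOn, ?_⟩
  have := intermediate_value_Icc zero_le_one continuous_phi.continuousOn
  rwa [phi_zero, phi_one] at this

theorem psi_phi {t : ℝ} (ht : t ∈ Icc (0 : ℝ) 1) : psi (phi t) = t :=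
  bijOn_phi.invOn_invFunOn.1 ht

theorem phi_psi {s : ℝ} (hs : s ∈ Icc (0 : ℝ) 1) : phi (psi s) = s :=
  bijOn_phi.invOn_invFunOn.2 hs

theorem psi_mem_Icc {s : ℝ} (hs : s ∈ Icc (0 : ℝ) 1) : psi s ∈ Icc (0 : ℝ) 1 := by
  obtain ⟨t, ht, rfl⟩ := bijOn_phi.surjOn hs
  rwa [psi_phi ht]

theorem psi_mem_Ioo {s : ℝ} (hs : s ∈ Ioo (0 : ℝ) 1) : psi s ∈ Ioo (0 : ℝ) 1 := by
  have h := psi_mem_Icc (Ioo_subset_Icc_self hs)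
  have h2 := phi_psi (Ioo_subset_Icc_self hs)
  refine ⟨lt_of_le_of_ne h.1 fun h0 => ?_, lt_of_le_of_ne h.2 fun h1 => ?_⟩
  · rw [← h0, phi_zero] at h2; exact hs.1.ne h2
  · rw [h1, phi_one] at h2; exact hs.2.ne h2.symm

theorem psi_lt_psi {s t : ℝ} (hs : s ∈ Icc (0 : ℝ) 1) (ht : t ∈ Icc (0 : ℝ) 1) (h : s < t) :
    psi s < psi t := by
  rw [← strictMonoOn_phi.lt_iff_lt (psi_mem_Icc hs) (psi_mem_Icc ht), phi_psi hs, phi_psi ht]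
  exact h

theorem image_phi_Ioo {c d : ℝ} (hc : 0 ≤ c) (hcd : c ≤ d) (hd : d ≤ 1) :
    phi '' Ioo c d = Ioo (phi c) (phi d) := by
  refine Subset.antisymm ?_ (intermediate_value_Ioo hcd continuous_phi.continuousOn)
  rintro _ ⟨t, ht, rfl⟩
  have h : t ∈ Icc (0 : ℝ) 1 := ⟨hc.trans ht.1.le, ht.2.le.trans hd⟩
  exact ⟨strictMonoOn_phi ⟨hc, hcd.trans hd⟩ h ht.1, strictMonoOn_phi h ⟨hc.trans hcd, hd⟩ ht.2⟩

theorem setLIntegral_phi {c d : ℝ} (hc : 0 ≤ c) (hcd : c ≤ d) (hd : d ≤ 1) (F : ℝ → ℝ≥0∞) :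
    ∫⁻ s in Ioo (phi c) (phi d), F s = ∫⁻ t in Ioo c d, ENNReal.ofReal (ell t / 2) * F (phi t) := by
  have hsub : Ioo c d ⊆ Icc (0 : ℝ) 1 := fun t ht => ⟨hc.trans ht.1.le, ht.2.le.trans hd⟩
  rw [← image_phi_Ioo hc hcd hd, lintegral_image_eq_lintegral_abs_deriv_mul measurableSet_Ioo
    (fun t ht => (hasDerivAt_phi (hc.trans_lt ht.1).ne').hasDerivWithinAt)
    (strictMonoOn_phi.injOn.mono hsub)]
  refine setLIntegral_congr_fun measurableSet_Ioo fun t ht => ?_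
  have : 0 < ell t := ell_pos ⟨hc.trans_lt ht.1, ht.2.trans_le hd⟩
  rw [abs_of_pos (by positivity)]

theorem lintegral_phi (F : ℝ → ℝ≥0∞) :
    ∫⁻ s, F s ∂lam01 = ∫⁻ t, ENNReal.ofReal (ell t / 2) * F (phi t) ∂lam01 := by
  have := setLIntegral_phi le_rfl zero_le_one le_rfl F
  rwa [phi_zero, phi_one] at this

/-- As `ell` is decreasing, its mean over `(c,d)` is at most its mean over `(0,d)`, which is `1 +
ell d ≤ 2 ell d`. -/
theorem phi_sub_phi_le {c d : ℝ} (hc : 0 ≤ c) (hcd : c < d) (hd : d ≤ 1) :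
    phi d - phi c ≤ ell d * (d - c) := by
  have hd0 : 0 < d := hc.trans_lt hcd
  have h1 : (d - c) * Real.log d ≤ 0 :=
    mul_nonpos_of_nonneg_of_nonpos (by linarith) (Real.log_nonpos hd0.le hd)
  have h2 : c * Real.log c ≤ c * Real.log d := by
    rcases hc.eq_or_lt with rfl | hc
    · simp
    · exact mul_le_mul_of_nonneg_left (Real.log_le_log hc hcd.le) hc.le
  simp only [phi, ell]
  nlinarith

/-! ### The supremum operator -/

/-- The operator `k ↦ sup_{s ≤ u < 1} k(ψ(u)) ℓ(ψ(u))^{-a}`. -/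
noncomputable def supOp (a : ℝ) (k : ℝ → ℝ≥0∞) (s : ℝ) : ℝ≥0∞ :=
  ⨆ u ∈ Ico s 1, k (psi u) / ENNReal.ofReal (ell (psi u) ^ a)

theorem antitone_supOp (a : ℝ) (k : ℝ → ℝ≥0∞) : Antitone (supOp a k) := fun _ _ hst =>
  biSup_mono fun _ hu => ⟨hst.trans hu.1, hu.2⟩

/-- Moving `u` slightly to the right loses arbitrarily little of `k(psi u)`, by right continuity,
and does not increase the denominator since `a ≥ 0`. Points of a dense sequence therefore suffice.
-/
theorem supOp_le_iSup {a : ℝ} (ha : 0 ≤ a) {k : ℝ → ℝ≥0∞} {q : ℕ → ℝ}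
    (hk : ∀ t l, l < k t → ∃ s, t < s ∧ l < k s) (hkanti : Antitone k)
    (hq : ∀ x y : ℝ, 0 < x → y ≤ 1 → x < y → ∃ n, q n ∈ Ioo x y) {s : ℝ} (hs : 0 < s) :
    supOp a k s ≤ ⨆ n, ⨆ (_ : s < q n), k (psi (q n)) / ENNReal.ofReal (ell (psi (q n)) ^ a) := by
  refine iSup₂_le fun u hu => ?_
  have hu0 : u ∈ Ioo (0 : ℝ) 1 := ⟨hs.trans_le hu.1, hu.2⟩
  have hpos : 0 < ell (psi u) ^ a := Real.rpow_pos_of_pos (ell_pos (psi_mem_Ioo hu0)) a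
  rw [ENNReal.div_le_iff (by simpa using hpos) ENNReal.ofReal_ne_top]
  refine le_of_forall_lt fun l hl => ?_
  obtain ⟨t, hut, hlt⟩ := hk _ _ hl
  -- The point `t` supplied by right continuity may lie beyond `1`, where `phi` is not controlled.
  have hm : min t 1 ∈ Icc (0 : ℝ) 1 :=
    ⟨le_min ((psi_mem_Ioo hu0).1.trans hut).le zero_le_one, min_le_right _ _⟩
  have hlt1 : u < phi (min t 1) := by
    conv_lhs => rw [← phi_psi (Ioo_subset_Icc_self hu0)]
    exact strictMonoOn_phi (psi_mem_Icc (Ioo_subset_Icc_self hu0)) hm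
      (lt_min hut (psi_mem_Ioo hu0).2)
  obtain ⟨n, hn⟩ := hq u (phi (min t 1)) hu0.1 (phi_mem_Icc hm).2 hlt1
  have hn0 : q n ∈ Ioo (0 : ℝ) 1 := ⟨hu0.1.trans hn.1, hn.2.trans_le (phi_mem_Icc hm).2⟩
  have h1 : psi (q n) ≤ t := by
    have := psi_lt_psi (Ioo_subset_Icc_self hn0) (phi_mem_Icc hm) hn.2
    rw [psi_phi hm] at this
    exact this.le.trans (min_le_left _ _)
  have h2 : ell (psi (q n)) ^ a ≤ ell (psi u) ^ a := by
    refine Real.rpow_le_rpow (ell_pos (psi_mem_Ioo hn0)).le (ell_le_ell (psi_mem_Ioo hu0).1 ?_) ha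
    exact (psi_lt_psi (Ioo_subset_Icc_self hu0) (Ioo_subset_Icc_self hn0) hn.1).le
  have hpos' : 0 < ell (psi (q n)) ^ a := Real.rpow_pos_of_pos (ell_pos (psi_mem_Ioo hn0)) a
  refine (hlt.trans_le (hkanti h1)).trans_le ?_
  calc k (psi (q n)) = k (psi (q n)) / ENNReal.ofReal (ell (psi (q n)) ^ a) *
        ENNReal.ofReal (ell (psi (q n)) ^ a) :=
        (ENNReal.div_mul_cancel (by simpa using hpos') ENNReal.ofReal_ne_top).symm
    _ ≤ _ := by
        gcongr
        exact le_iSup₂_of_le (f := fun n (_ : s < q n) =>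
          k (psi (q n)) / ENNReal.ofReal (ell (psi (q n)) ^ a)) n (hu.1.trans_lt hn.1) le_rfl

/-- After the substitution `s = phi t` the integrand is `ell^(1-a) k / 2`, which is nonincreasing
because `a ≤ 1`, so it is bounded below by its value at the right endpoint. `phi_sub_phi_le`
compares the lengths of the two intervals. -/
theorem setLIntegral_mean_bound {a : ℝ} (ha1 : a ≤ 1) {k : ℝ → ℝ≥0∞} (hk : Antitone k) {c d : ℝ}
    (hc : 0 ≤ c) (hcd : c < d) (hd : d < 1) :
    k (psi d) / ENNReal.ofReal (ell (psi d) ^ a) * ENNReal.ofReal (d - c) ≤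
      2 * ∫⁻ s in Ico c d, k (psi s) / ENNReal.ofReal (ell (psi s) ^ a) := by
  have hc' : c ∈ Icc (0 : ℝ) 1 := ⟨hc, (hcd.trans hd).le⟩
  have hd' : d ∈ Ioo (0 : ℝ) 1 := ⟨hc.trans_lt hcd, hd⟩
  obtain ⟨c, hc0, rfl⟩ := bijOn_phi.surjOn hc'
  have hd0 := psi_mem_Ioo hd'
  obtain ⟨d, hdI, rfl⟩ := bijOn_phi.surjOn (Ioo_subset_Icc_self hd')
  rw [psi_phi hdI] at hd0 ⊢
  have hcd' : c < d := (strictMonoOn_phi.lt_iff_lt hc0 hdI).1 hcd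
  have hed : 0 < ell d := ell_pos hd0
  rw [← restrict_Ioo_eq_restrict_Ico, setLIntegral_phi hc0.1 hcd'.le hdI.2]
  have low : ∀ t ∈ Ioo c d, ENNReal.ofReal (ell d ^ (1 - a) / 2) * k d ≤
      ENNReal.ofReal (ell t / 2) * (k (psi (phi t)) / ENNReal.ofReal (ell (psi (phi t)) ^ a)) := by
    intro t ht
    have ht0 : t ∈ Ioo (0 : ℝ) 1 := ⟨hc0.1.trans_lt ht.1, ht.2.trans hd0.2⟩
    have het : 0 < ell t := ell_pos ht0
    rw [psi_phi (Ioo_subset_Icc_self ht0)]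
    have e : ENNReal.ofReal (ell t / 2) * (k t / ENNReal.ofReal (ell t ^ a)) =
        ENNReal.ofReal (ell t ^ (1 - a) / 2) * k t := by
      have h1 : ell t ^ (1 - a) / 2 = ell t / 2 / ell t ^ a := by
        rw [Real.rpow_sub het, Real.rpow_one]; ring
      have hpos : 0 < ell t ^ a := by positivity
      rw [h1, ENNReal.ofReal_div_of_pos (x := ell t / 2) hpos]
      simp only [ENNReal.div_eq_inv_mul]
      ring
    rw [e]
    gcongr
    · exact ell_le_ell ht0.1 ht.2.le
    · exact hk ht.2.le
  calc k d / ENNReal.ofReal (ell d ^ a) * ENNReal.ofReal (phi d - phi c)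
      ≤ k d / ENNReal.ofReal (ell d ^ a) * ENNReal.ofReal (ell d * (d - c)) := by
        gcongr; exact phi_sub_phi_le hc0.1 hcd' hdI.2
    _ = 2 * ∫⁻ t in Ioo c d, ENNReal.ofReal (ell d ^ (1 - a) / 2) * k d := by
        have hpos : 0 < ell d ^ a := by positivity
        rw [setLIntegral_const, Real.volume_Ioo, Real.rpow_sub hed, Real.rpow_one,
          ENNReal.ofReal_mul hed.le, ENNReal.ofReal_div_of_pos (by norm_num),
          ENNReal.ofReal_div_of_pos hpos]
        have h2 : (2 : ℝ≥0∞) * 2⁻¹ = 1 := ENNReal.mul_inv_cancel (by simp) (by simp)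
        simp only [div_eq_mul_inv, ENNReal.ofReal_ofNat]
        calc _ = (2 * 2⁻¹ : ℝ≥0∞) * (k d * (ENNReal.ofReal (ell d ^ a))⁻¹ *
              (ENNReal.ofReal (ell d) * ENNReal.ofReal (d - c))) := by rw [h2, one_mul]
          _ = _ := by ring
    _ ≤ _ := by
        gcongr 2 * ?_
        exact setLIntegral_mono' measurableSet_Ioo low

/-- Let `d` maximise `H` on `D`. On `[c,d)` the supremum is at most `H d`; replacing `f` by its mean
there and using `hH` gives the estimate with constant `C`. Beyond `d` only the points of `D` to the
right of `d` matter, which are fewer, and `C` does not grow because the intervals are disjoint. -/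
theorem IsRIBanachNorm.exists_setLIntegral_iSup_le {X : (ℝ → ℝ≥0∞) → ℝ≥0∞}
    (hX : IsRIBanachNorm X) {H : ℝ → ℝ≥0∞} {C : ℝ≥0}
    (hH : ∀ c d : ℝ, 0 ≤ c → c < d → d < 1 →
      H d * ENNReal.ofReal (d - c) ≤ C * ∫⁻ s in Ico c d, H s) (n : ℕ) :
    ∀ (D : Finset ℝ) (c : ℝ) (f : ℝ → ℝ≥0∞), D.card ≤ n → 0 ≤ c → c ≤ 1 → ↑D ⊆ Ioo c 1 →
      Antitone f → ∃ g : ℝ → ℝ≥0∞, Antitone g ∧ X g ≤ X f ∧ (∀ x < c, g x = f x) ∧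
      ∫⁻ t in Ico c 1, f t * (⨆ d ∈ D, ⨆ (_ : t < d), H d) ≤ C * ∫⁻ t in Ico c 1, g t * H t := by
  induction n with
  | zero =>
    intro D c f hD _ _ _ hf
    have : D = ∅ := by simpa using hD
    subst this
    exact ⟨f, hf, le_rfl, fun _ _ => rfl, by simp⟩
  | succ n ih =>
    intro D c f hDn hc hc1 hDc hf
    rcases D.eq_empty_or_nonempty with rfl | hne
    · exact ⟨f, hf, le_rfl, fun _ _ => rfl, by simp⟩
    obtain ⟨d, hdD, hmax⟩ := D.exists_max_image H hne
    obtain ⟨hcd, hd1⟩ := hDc hdD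
    have hsub : D.filter (d < ·) ⊆ D.erase d := fun x hx => by
      rw [Finset.mem_filter] at hx
      exact Finset.mem_erase.2 ⟨hx.2.ne', hx.1⟩
    have hcard : (D.filter (d < ·)).card ≤ n := by
      have h1 := Finset.card_le_card hsub
      rw [Finset.card_erase_of_mem hdD] at h1
      omega
    -- The recursion leaves the function unchanged to the left of `d`, so the mean just created on
    -- `[c,d)` survives.
    obtain ⟨g, hg, hgX, hgf, hgle⟩ := ih (D.filter (d < ·)) d (meanOn c d f) hcard
      (hc.trans hcd.le) hd1.le (fun x hx => by
        have hx := Finset.mem_filter.1 (Finset.mem_coe.1 hx)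
        exact ⟨hx.2, (hDc hx.1).2⟩) (antitone_meanOn hf hcd)
    refine ⟨g, hg, hgX.trans (hX.meanOn_le hf hc hcd hd1.le), fun x hx => ?_, ?_⟩
    · rw [hgf x (hx.trans hcd)]
      exact piecewise_eq_of_notMem _ _ _ fun h => absurd h.1 (not_le.2 hx)
    have hun : Ico c 1 = Ico c d ∪ Ico d 1 := (Ico_union_Ico_eq_Ico hcd.le hd1.le).symm
    have hdis : Disjoint (Ico c d) (Ico d 1) := Ico_disjoint_Ico_same
    rw [hun, lintegral_union measurableSet_Ico hdis, lintegral_union measurableSet_Ico hdis, mul_add]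
    refine add_le_add ?_ ?_
    · set A := (∫⁻ x in Ico c d, f x) / ENNReal.ofReal (d - c) with hA
      have hpos : ENNReal.ofReal (d - c) ≠ 0 := by simpa using hcd
      have hAg : ∀ t ∈ Ico c d, g t = A := fun t ht => by
        rw [hgf t ht.2]; exact piecewise_eq_of_mem _ _ _ ht
      calc ∫⁻ t in Ico c d, f t * (⨆ e ∈ D, ⨆ (_ : t < e), H e)
          ≤ ∫⁻ t in Ico c d, f t * H d := by
            refine setLIntegral_mono' measurableSet_Ico fun t _ => ?_
            gcongr
            exact iSup₂_le fun e he => iSup_le fun _ => hmax e he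
        _ = (∫⁻ t in Ico c d, f t) * H d := lintegral_mul_const _ hf.measurable
        _ = A * (H d * ENNReal.ofReal (d - c)) := by
            rw [mul_comm (H d), ← mul_assoc, hA, ENNReal.div_mul_cancel hpos ENNReal.ofReal_ne_top]
        _ ≤ A * (C * ∫⁻ s in Ico c d, H s) := by gcongr A * ?_; exact hH c d hc hcd hd1
        _ = C * (A * ∫⁻ s in Ico c d, H s) := by ring
        _ ≤ C * ∫⁻ t in Ico c d, A * H t := by gcongr; exact lintegral_const_mul_le _ _
        _ = C * ∫⁻ t in Ico c d, g t * H t := by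
            congr 1
            exact setLIntegral_congr_fun measurableSet_Ico fun t ht => by simp only [hAg t ht]
    · refine le_trans (le_of_eq ?_) hgle
      refine setLIntegral_congr_fun measurableSet_Ico fun t ht => ?_
      congr 1
      · exact (piecewise_eq_of_notMem _ _ _ fun h => absurd h.2 (not_lt.2 ht.1)).symm
      · refine le_antisymm (iSup₂_le fun e he => iSup_le fun hte => ?_)
          (iSup₂_le fun e he => iSup_le fun hte => ?_)
        · exact le_iSup₂_of_le e (Finset.mem_filter.2 ⟨he, ht.1.trans_lt hte⟩)
            (le_iSup_of_le hte le_rfl)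
        · exact le_iSup₂_of_le e (Finset.mem_filter.1 he).1 (le_iSup_of_le hte le_rfl)

theorem exists_seq_dense_Ioo : ∃ q : ℕ → ℝ, (∀ n, q n ∈ Ioo (0 : ℝ) 1) ∧
    ∀ x y : ℝ, 0 < x → y ≤ 1 → x < y → ∃ n, q n ∈ Ioo x y := by
  have : Nonempty (Ioo (0 : ℝ) 1) := ⟨⟨1 / 2, by norm_num, by norm_num⟩⟩
  refine ⟨fun n => TopologicalSpace.denseSeq (Ioo (0 : ℝ) 1) n, fun n => Subtype.coe_prop _,
    fun x y hx hy hxy => ?_⟩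
  have hopen : IsOpen (Subtype.val ⁻¹' Ioo x y : Set (Ioo (0 : ℝ) 1)) :=
    isOpen_Ioo.preimage continuous_subtype_val
  have hne : (Subtype.val ⁻¹' Ioo x y : Set (Ioo (0 : ℝ) 1)).Nonempty :=
    ⟨⟨(x + y) / 2, by linarith, by linarith⟩, by
      simp only [mem_preimage, mem_Ioo]; constructor <;> linarith⟩
  obtain ⟨n, hn⟩ := (TopologicalSpace.denseRange_denseSeq (Ioo (0 : ℝ) 1)).exists_mem_open hopen hne
  exact ⟨n, hn⟩

/-! ### Duality between the supremum operator and the operator `U` -/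

section SupOp

variable {X Y : (ℝ → ℝ≥0∞) → ℝ≥0∞}

theorem IsRIBanachNorm.assocNorm_supOp_le (hX : IsRIBanachNorm X) (hY : IsRIBanachNorm Y) {a : ℝ}
    (ha : 0 ≤ a) (ha1 : a ≤ 1) {C : ℝ≥0}
    (hU : ∀ h : ℝ → ℝ≥0∞, AEMeasurable h lam01 →
      Y (fun t => rearr lam01 h (phi t) * ENNReal.ofReal (ell t ^ (1 - a))) ≤ C * X h)
    {E : Type*} [ENorm E] (f : ℝ → E) :
    assocNorm X (supOp a (rearr lam01 f)) ≤ C * assocNorm Y (rearr lam01 f) := by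
  set k := rearr lam01 f with hk
  have hkanti : Antitone k := antitone_rearr _ _
  let H : ℝ → ℝ≥0∞ := fun s => k (psi s) / ENNReal.ofReal (ell (psi s) ^ a)
  obtain ⟨q, hq0, hq⟩ := exists_seq_dense_Ioo
  -- Suprema over finitely many points, increasing with `n`, so that monotone convergence reduces
  -- the pairing to the finite case.
  let T : ℕ → ℝ → ℝ≥0∞ := fun n t =>
    ⨆ d ∈ (Finset.range n).image q, ⨆ (_ : t < d), H d
  have hTanti : ∀ n, Antitone (T n) := fun n s t hst =>
    iSup₂_mono fun d _ => iSup_mono' fun h => ⟨hst.trans_lt h, le_rfl⟩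
  have hTmono : Monotone T := fun m n hmn t => biSup_mono fun d hd =>
    Finset.image_subset_image (Finset.range_mono hmn) hd
  refine iSup_le fun g => iSup_le fun hg => iSup_le fun hg1 => ?_
  have hrm := antitone_rearr lam01 g
  calc ∫⁻ t, supOp a k t * g t ∂lam01 = ∫⁻ t, g t * supOp a k t ∂lam01 := by simp only [mul_comm]
    _ ≤ ∫⁻ t, rearr lam01 g t * supOp a k t ∂lam01 := lintegral_mul_le_rearr hg (antitone_supOp a k)
    _ ≤ ∫⁻ t, ⨆ n, rearr lam01 g t * T n t ∂lam01 := by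
        refine lintegral_mono_ae (ae_lam01_mem.mono fun t ht => ?_)
        rw [← ENNReal.mul_iSup]
        gcongr
        refine (supOp_le_iSup ha (fun t l hl => exists_lt_rearr hl) hkanti hq ht.1).trans ?_
        refine iSup_le fun n => iSup_le fun hn => le_iSup_of_le (n + 1) ?_
        exact le_iSup₂_of_le (f := fun d (_ : d ∈ (Finset.range (n + 1)).image q) =>
          ⨆ (_ : t < d), H d) (q n) (Finset.mem_image_of_mem q (Finset.self_mem_range_succ n))
          (le_iSup_of_le hn le_rfl)
    _ = ⨆ n, ∫⁻ t, rearr lam01 g t * T n t ∂lam01 :=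
        lintegral_iSup (fun n => hrm.measurable.mul (hTanti n).measurable)
          fun m n hmn t => mul_le_mul_right (hTmono hmn t) _
    _ ≤ C * assocNorm Y k := iSup_le fun n => ?_
  obtain ⟨f', hf', hfX, -, hle⟩ := hX.exists_setLIntegral_iSup_le (H := H) (C := 2)
    (fun c d h0 h1 h2 => by simpa using setLIntegral_mean_bound ha1 hkanti h0 h1 h2) _
    ((Finset.range n).image q) 0 (rearr lam01 g) le_rfl le_rfl zero_le_one (by
      intro x hx
      obtain ⟨i, -, rfl⟩ := Finset.mem_image.1 (Finset.mem_coe.1 hx)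
      exact hq0 i) hrm
  rw [← restrict_Ioo_eq_restrict_Ico] at hle
  refine le_trans hle ?_
  change ((2 : ℝ≥0) : ℝ≥0∞) * ∫⁻ t, f' t * H t ∂lam01 ≤ _
  have hae : ∫⁻ t, f' t * H t ∂lam01 = ∫⁻ t, rearr lam01 f' t * H t ∂lam01 :=
    lintegral_congr_ae ((rearr_ae_eq_of_antitone hf').mono fun t ht => by simp only [ht])
  have hUm : AEMeasurable (fun t => rearr lam01 f' (phi t) * ENNReal.ofReal (ell t ^ (1 - a)))
      lam01 := (((measurable_rearr _ _).comp measurable_phi).mul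
        (measurable_ell.pow_const _).ennreal_ofReal).aemeasurable
  calc ((2 : ℝ≥0) : ℝ≥0∞) * ∫⁻ t, f' t * H t ∂lam01
      = ∫⁻ t, 2 * (ENNReal.ofReal (ell t / 2) * (rearr lam01 f' (phi t) * H (phi t))) ∂lam01 := by
        rw [hae, lintegral_phi, lintegral_const_mul' _ _ (by simp)]
        rfl
    -- The factor `2` cancels the `1/2` in `phi' = ell / 2`, and `ell / ell^a` is exactly the weight
    -- of `U`.
    _ = ∫⁻ t, k t * (rearr lam01 f' (phi t) * ENNReal.ofReal (ell t ^ (1 - a))) ∂lam01 := by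
        refine lintegral_congr_ae (ae_lam01_mem.mono fun t ht => ?_)
        have het := ell_pos ht
        have hpos : 0 < ell t ^ a := Real.rpow_pos_of_pos het a
        simp only [H]
        rw [psi_phi (Ioo_subset_Icc_self ht), Real.rpow_sub het, Real.rpow_one,
          ENNReal.ofReal_div_of_pos hpos, ENNReal.ofReal_div_of_pos two_pos]
        have h2 : (2 : ℝ≥0∞) * 2⁻¹ = 1 := ENNReal.mul_inv_cancel (by simp) (by simp)
        simp only [div_eq_mul_inv, ENNReal.ofReal_ofNat]
        calc _ = (2 * 2⁻¹ : ℝ≥0∞) * (k t * (rearr lam01 f' (phi t) * (ENNReal.ofReal (ell t) *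
              (ENNReal.ofReal (ell t ^ a))⁻¹))) := by ring
          _ = _ := by rw [h2, one_mul]
    _ ≤ Y (fun t => rearr lam01 f' (phi t) * ENNReal.ofReal (ell t ^ (1 - a))) * assocNorm Y k :=
        hY.lintegral_mul_le_assocNorm hkanti.measurable.aemeasurable hUm
    _ ≤ C * assocNorm Y k := by
        gcongr
        refine (hU f' hf'.measurable.aemeasurable).trans ?_
        calc (C : ℝ≥0∞) * X f' ≤ C * 1 := by
              gcongr
              exact hfX.trans (by rwa [hX.map_rearr hg])
          _ = C := mul_one _

/-- Hardy's lemma needs a nonincreasing multiplier, which `K / ell^a` need not be. The function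
`supOp a K^* ∘ phi` is one, and it dominates `K / ell^a` a.e., as `u = phi t` is admissible in the
supremum. -/
theorem IsRIBanachNorm.le_of_setLIntegral_le (hX : IsRIBanachNorm X) (hY : IsRIBanachNorm Y)
    {a : ℝ} {C : ℝ≥0}
    (hT : ∀ K : ℝ → ℝ≥0∞, Antitone K → (∀ t, K t < ∞) → assocNorm Y (rearr lam01 K) ≤ 1 →
      assocNorm X (supOp a (rearr lam01 K)) ≤ C) {F G : ℝ → ℝ≥0∞} (hF : Antitone F)
    (hG : Antitone G) (hGfin : ∀ t, 0 < t → G t < ∞) {c : ℝ≥0}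
    (H : ∀ t ∈ Ioo (0 : ℝ) 1, ∫⁻ s in Ioo 0 t, G s * ENNReal.ofReal (ell s ^ a) ≤
      c * ∫⁻ s in Ioo 0 t, F (phi s) * ENNReal.ofReal (ell s)) :
    Y G ≤ (2 * c * C : ℝ≥0) * X F := by
  refine hY.le_of_forall_antitone hG hGfin fun K hK hKfin hK1 => ?_
  have hae := rearr_ae_eq_of_antitone hK
  set k := rearr lam01 K with hk
  have hk1 : assocNorm Y k ≤ 1 := by
    refine le_trans (le_of_eq ?_) hK1
    refine iSup_congr fun g => iSup_congr fun _ => iSup_congr fun _ => lintegral_congr_ae ?_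
    exact hae.mono fun t ht => by simp only [ht]
  have hT' := hT K hK hKfin hk1
  set S := supOp a k with hS
  -- Clamping to `[0,1]`, where `phi` is increasing, makes `h` nonincreasing on the whole line.
  let h : ℝ → ℝ≥0∞ := fun t => S (phi (max 0 (min t 1)))
  have hh : Antitone h := fun s t hst => by
    refine antitone_supOp a k (strictMonoOn_phi.monotoneOn ?_ ?_ ?_)
    · exact ⟨le_max_left _ _, max_le zero_le_one (min_le_right _ _)⟩
    · exact ⟨le_max_left _ _, max_le zero_le_one (min_le_right _ _)⟩
    · exact max_le_max_left _ (min_le_min_right _ hst)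
  have hhS : ∀ t ∈ Ioo (0 : ℝ) 1, h t = S (phi t) := fun t ht => by
    simp only [h]; rw [min_eq_left ht.2.le, max_eq_right ht.1.le]
  have hGm : AEMeasurable (fun s => G s * ENNReal.ofReal (ell s ^ a)) lam01 :=
    (hG.measurable.mul (measurable_ell.pow_const _).ennreal_ofReal).aemeasurable
  have hFm : Measurable fun s => F (phi s) * ENNReal.ofReal (ell s) :=
    (hF.measurable.comp measurable_phi).mul measurable_ell.ennreal_ofReal
  calc ∫⁻ t, G t * K t ∂lam01 ≤ ∫⁻ t, G t * ENNReal.ofReal (ell t ^ a) * h t ∂lam01 := by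
        refine lintegral_mono_ae ((hae.and ae_lam01_mem).mono fun t ht => ?_)
        have ht0 := Ioo_subset_Icc_self ht.2
        have hpos : 0 < ell t ^ a := Real.rpow_pos_of_pos (ell_pos ht.2) a
        rw [← ht.1, hhS t ht.2, mul_assoc]
        gcongr
        calc k t = k t / ENNReal.ofReal (ell t ^ a) * ENNReal.ofReal (ell t ^ a) :=
              (ENNReal.div_mul_cancel (by simpa using hpos) ENNReal.ofReal_ne_top).symm
          _ ≤ S (phi t) * ENNReal.ofReal (ell t ^ a) := by
              gcongr
              refine le_iSup₂_of_le (f := fun u (_ : u ∈ Ico (phi t) 1) =>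
                k (psi u) / ENNReal.ofReal (ell (psi u) ^ a)) (phi t)
                ⟨le_rfl, (phi_mem_Ioo ht.2).2⟩ ?_
              rw [psi_phi ht0]
          _ = _ := mul_comm _ _
    _ ≤ ∫⁻ t, (c * (F (phi t) * ENNReal.ofReal (ell t))) * h t ∂lam01 := by
        refine lintegral_mul_le_of_setLIntegral_le hGm (hFm.const_mul _).aemeasurable hh
          fun t ht => (H t ht).trans ?_
        rw [lintegral_const_mul _ hFm]
    _ = ∫⁻ t, (2 * c) * (ENNReal.ofReal (ell t / 2) * (S (phi t) * F (phi t))) ∂lam01 := by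
        refine lintegral_congr_ae (ae_lam01_mem.mono fun t ht => ?_)
        have h2 : (2 : ℝ≥0∞) * 2⁻¹ = 1 := ENNReal.mul_inv_cancel (by simp) (by simp)
        simp only
        rw [hhS t ht, ENNReal.ofReal_div_of_pos two_pos, ENNReal.ofReal_ofNat, div_eq_mul_inv]
        calc _ = (2 * 2⁻¹ : ℝ≥0∞) * (c * (F (phi t) * ENNReal.ofReal (ell t)) * S (phi t)) := by
              rw [h2, one_mul]
          _ = _ := by ring
    _ = (2 * c) * ∫⁻ t, S t * F t ∂lam01 := by
        rw [lintegral_const_mul' _ _ (ENNReal.mul_ne_top (by simp) (by simp)),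
          lintegral_phi fun t => S t * F t]
    _ ≤ (2 * c) * (X F * C) := by
        gcongr
        refine (hX.lintegral_mul_le_assocNorm (antitone_supOp a k).measurable.aemeasurable
          hF.measurable.aemeasurable).trans ?_
        gcongr
    _ = _ := by push_cast; ring

end SupOp

/-! ### The functions `σ` and `σ⁻¹` for logarithmic weights -/

theorem integral_ell {x : ℝ} : ∫ s in (0 : ℝ)..x, ell s = 2 * phi x := by
  have : ∫ s in (0 : ℝ)..x, ell s = (∫ s in (0 : ℝ)..x, (1 : ℝ)) - ∫ s in (0 : ℝ)..x, Real.log s :=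
    intervalIntegral.integral_sub intervalIntegrable_const intervalIntegral.intervalIntegrable_log'
  rw [this, integral_log]
  simp only [intervalIntegral.integral_const, phi, ell]
  simp
  ring

theorem intervalIntegrable_ell (a b : ℝ) : IntervalIntegrable ell volume a b :=
  intervalIntegrable_const.sub intervalIntegral.intervalIntegrable_log'

/-- The exponent is `(α + β) p = 1`; this is why `phi` and `psi` depend on none of the parameters.
-/
theorem weight_quotient {p α β : ℝ} (hp : 0 < p) (hβ : β = 1 / p - α) {s : ℝ}
    (hs : 0 < ell s) : (ell s ^ α * (ell s ^ (-β))⁻¹) ^ p = ell s := by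
  rw [Real.rpow_neg hs.le, inv_inv, ← Real.rpow_add hs, ← Real.rpow_mul hs.le, hβ]
  have : (α + (1 / p - α)) * p = 1 := by field_simp; ring
  rw [this, Real.rpow_one]

theorem integral_weight_quotient {p α β : ℝ} (hp : 0 < p) (hβ : β = 1 / p - α) {x : ℝ}
    (hx : x ∈ Icc (0 : ℝ) 1) :
    ∫ s in (0 : ℝ)..x, (ell s ^ α * (ell s ^ (-β))⁻¹) ^ p = 2 * phi x := by
  rw [← integral_ell]
  refine intervalIntegral.integral_congr_ae (ae_of_all _ fun s hs => ?_)
  rw [uIoc_of_le hx.1] at hs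
  exact weight_quotient hp hβ (zero_lt_one.trans_le (one_le_ell hs.1 (hs.2.trans hx.2)))

theorem rpow_mem_Icc {t q : ℝ} (ht : t ∈ Icc (0 : ℝ) 1) (hq : 0 ≤ q) : t ^ q ∈ Icc (0 : ℝ) 1 :=
  ⟨Real.rpow_nonneg ht.1 q, Real.rpow_le_one ht.1 ht.2 hq⟩

theorem sigmaInv_ell {p α β : ℝ} (hp : 0 < p) (hβ : β = 1 / p - α) {t : ℝ}
    (ht : t ∈ Icc (0 : ℝ) 1) :
    sigmaInv (fun t => ell t ^ α) (fun t => ell t ^ (-β)) p (t ^ (1 / p)) = phi t ^ (1 / p) := by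
  have h1 : (t ^ (1 / p)) ^ p = t := by
    rw [← Real.rpow_mul ht.1, one_div_mul_cancel hp.ne', Real.rpow_one]
  rw [sigmaInv, h1, integral_weight_quotient hp hβ ht, integral_weight_quotient hp hβ (by simp),
    phi_one, mul_one, mul_div_cancel_left₀ _ two_ne_zero]

theorem sigmaInv_ell_rpow {p α β : ℝ} (hp : 0 < p) (hβ : β = 1 / p - α) {t : ℝ}
    (ht : t ∈ Icc (0 : ℝ) 1) :
    sigmaInv (fun t => ell t ^ α) (fun t => ell t ^ (-β)) p (t ^ (1 / p)) ^ p = phi t := by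
  rw [sigmaInv_ell hp hβ ht, ← Real.rpow_mul (phi_mem_Icc ht).1, one_div_mul_cancel hp.ne',
    Real.rpow_one]

theorem sigma_ell_rpow {p α β : ℝ} (hp : 0 < p) (hβ : β = 1 / p - α) {u : ℝ}
    (hu : u ∈ Icc (0 : ℝ) 1) :
    sigma (fun t => ell t ^ α) (fun t => ell t ^ (-β)) p (u ^ (1 / p)) ^ p = psi u := by
  have hint : IntervalIntegrable (fun s => (ell s ^ α * (ell s ^ (-β))⁻¹) ^ p) volume 0 1 := by
    refine (intervalIntegrable_ell 0 1).congr_ae ?_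
    filter_upwards [ae_restrict_mem measurableSet_uIoc] with s hs
    rw [uIoc_of_le zero_le_one] at hs
    exact (weight_quotient hp hβ (zero_lt_one.trans_le (one_le_ell hs.1 hs.2))).symm
  obtain ⟨-, -, -, hinv⟩ := sigma_spec (fun t => ell t ^ α) (fun t => ell t ^ (-β)) p hp
    (fun t ht => Real.rpow_pos_of_pos (ell_pos ht) _)
    (fun t ht => Real.rpow_pos_of_pos (ell_pos ht) _) hint
  have hpsi := psi_mem_Icc hu
  have hq : 0 ≤ 1 / p := by positivity
  have h := hinv.2 (rpow_mem_Icc hpsi hq)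
  rw [sigmaInv_ell hp hβ hpsi, phi_psi hu] at h
  rw [h, ← Real.rpow_mul hpsi.1, one_div_mul_cancel hp.ne', Real.rpow_one]

theorem opU_ell {p α β : ℝ} (hp : 0 < p) (hβ : β = 1 / p - α) (f : ℝ → ℂ) {t : ℝ}
    (ht : t ∈ Ioo (0 : ℝ) 1) :
    opU (fun t => ell t ^ α) (fun t => ell t ^ (-β)) p f t =
      rearr lam01 f (phi t) * ENNReal.ofReal (ell t ^ β) := by
  have hpos := Real.rpow_pos_of_pos (ell_pos ht) (-β)
  rw [opU, sigmaInv_ell_rpow hp hβ (Ioo_subset_Icc_self ht), ← ENNReal.ofReal_inv_of_pos hpos,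
    Real.rpow_neg (ell_pos ht).le, inv_inv]

theorem opT_ell {p α β : ℝ} (hp : 0 < p) (hβ : β = 1 / p - α) (f : ℝ → ℂ) {t : ℝ}
    (ht : t ∈ Ioo (0 : ℝ) 1) :
    opT (fun t => ell t ^ α) (fun t => ell t ^ (-β)) p f t = supOp (α * p) (rearr lam01 f) t := by
  refine biSup_congr fun s hs => ?_
  have hs' : s ∈ Ioo (0 : ℝ) 1 := ⟨ht.1.trans_le hs.1, hs.2⟩
  simp only
  rw [sigma_ell_rpow hp hβ (Ioo_subset_Icc_self hs'), ← Real.rpow_mul (ell_pos (psi_mem_Ioo hs')).le]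

/-! ### Powers of function norms -/

theorem ENNReal.rpow_rpow_one_div {p : ℝ} (hp : 0 < p) (x : ℝ≥0∞) : (x ^ p) ^ (1 / p) = x := by
  rw [← ENNReal.rpow_mul, mul_one_div_cancel hp.ne', ENNReal.rpow_one]

theorem ENNReal.rpow_one_div_rpow {p : ℝ} (hp : 0 < p) (x : ℝ≥0∞) : (x ^ (1 / p)) ^ p = x := by
  rw [← ENNReal.rpow_mul, one_div_mul_cancel hp.ne', ENNReal.rpow_one]

theorem powNorm_rpow {p : ℝ} (hp : 0 < p) (X : (ℝ → ℝ≥0∞) → ℝ≥0∞) (f : ℝ → ℝ≥0∞) :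
    powNorm p X (fun t => f t ^ p) = X f ^ p := by
  simp only [powNorm, ENNReal.rpow_rpow_one_div hp]

theorem assocNorm_congr {X : (ℝ → ℝ≥0∞) → ℝ≥0∞} {f g : ℝ → ℝ≥0∞} (h : f =ᵐ[lam01] g) :
    assocNorm X f = assocNorm X g :=
  iSup_congr fun _ => iSup_congr fun _ => iSup_congr fun _ =>
    lintegral_congr_ae (h.mono fun t ht => by simp only [ht])

theorem enorm_toReal_complex {x : ℝ≥0∞} (hx : x ≠ ∞) : ‖((x.toReal : ℝ) : ℂ)‖ₑ = x := by
  rw [← ofReal_norm, Complex.norm_real, Real.norm_of_nonneg ENNReal.toReal_nonneg,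
    ENNReal.ofReal_toReal hx]

/-! ### The implications 3 → 4 and 4 → 1 -/

section Equivalence

variable {p α β : ℝ} {X Y : (ℝ → ℝ≥0∞) → ℝ≥0∞}

/-- Transfers the bound for `U` to the power norms and to `[0,∞]`-valued functions. A function of
finite norm is integrable, hence finite a.e., and its root is then the modulus of a complex
function. -/
theorem exists_powNorm_opU_le (hp : 0 < p) (hβ : β = 1 / p - α)
    (hXp : IsPConvex p X) (hY : IsRIFunctional Y)
    (h : IsBounded01 X Y (opU (fun t => ell t ^ α) (fun t => ell t ^ (-β)) p)) :
    ∃ C : ℝ≥0, ∀ h : ℝ → ℝ≥0∞, AEMeasurable h lam01 →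
      powNorm p Y (fun t => rearr lam01 h (phi t) * ENNReal.ofReal (ell t ^ (1 - α * p))) ≤
        C * powNorm p X h := by
  obtain ⟨C, hC⟩ := h
  -- A positive constant keeps the right-hand side infinite when the norm of `h` is.
  refine ⟨max (C ^ p) 1, fun h hh => ?_⟩
  by_cases htop : powNorm p X h = ∞
  · rw [htop, ENNReal.mul_top (by simp)]; exact le_top
  have hfin : ∀ᵐ t ∂lam01, h t < ∞ :=
    ae_lt_top' hh (IsRIBanachNorm.lintegral_lt_top hXp hh (lt_top_iff_ne_top.2 htop)).ne
  have hp' : 0 < 1 / p := by positivity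
  let f : ℝ → ℂ := fun t => (((h t) ^ (1 / p)).toReal : ℝ)
  have hf : AEStronglyMeasurable f lam01 := (Complex.measurable_ofReal.comp_aemeasurable
    (hh.pow_const (1 / p)).ennreal_toReal).aestronglyMeasurable
  have hr : ∀ t, rearr lam01 f t = rearr lam01 h t ^ (1 / p) := fun t => by
    rw [← rearr_rpow h hp' t]
    refine congrFun (rearr_congr (hfin.mono fun x hx => ?_)) t
    rw [enorm_toReal_complex (ENNReal.rpow_ne_top_of_nonneg hp'.le hx.ne), enorm_eq_self]
  have hXf : riNorm X lam01 f ^ p = powNorm p X h := by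
    rw [← IsRIFunctional.map_rearr hXp.toIsRIFunctional hh]
    simp only [riNorm, powNorm]
    congr 2
    exact funext hr
  have hlt : riNorm X lam01 f < ∞ := by
    rw [lt_top_iff_ne_top]
    intro ht
    rw [ht, ENNReal.top_rpow_of_pos hp] at hXf
    exact htop hXf.symm
  have hmeas : Measurable fun t =>
      (rearr lam01 h (phi t) * ENNReal.ofReal (ell t ^ (1 - α * p))) ^ (1 / p) :=
    (((measurable_rearr _ _).comp measurable_phi).mul
      (measurable_ell.pow_const _).ennreal_ofReal).pow_const _
  calc powNorm p Y (fun t => rearr lam01 h (phi t) * ENNReal.ofReal (ell t ^ (1 - α * p)))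
      = Y (opU (fun t => ell t ^ α) (fun t => ell t ^ (-β)) p f) ^ p := by
        simp only [powNorm]
        congr 1
        refine hY.congr_ae hmeas.aemeasurable (ae_lam01_mem.mono fun t ht => ?_)
        have he := ell_pos ht
        simp only
        rw [opU_ell hp hβ f ht, hr, ENNReal.mul_rpow_of_nonneg _ _ hp'.le,
          ENNReal.ofReal_rpow_of_pos (Real.rpow_pos_of_pos he _), ← Real.rpow_mul he.le, hβ]
        congr 4
        field_simp
    _ ≤ (C * riNorm X lam01 f) ^ p := ENNReal.rpow_le_rpow (hC f hf hlt) hp.le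
    _ = (C : ℝ≥0∞) ^ p * powNorm p X h := by rw [ENNReal.mul_rpow_of_nonneg _ _ hp.le, hXf]
    _ ≤ _ := by
        gcongr
        rw [← ENNReal.coe_rpow_of_nonneg _ hp.le]
        exact_mod_cast le_max_left _ _

theorem isBounded01_opT (hp : 0 < p) (hα₀ : 0 ≤ α) (hα : α < 1 / p) (hβ : β = 1 / p - α)
    (hXp : IsPConvex p X) (hY : IsRIFunctional Y) (hYp : IsPConvex p Y)
    (h : IsBounded01 X Y (opU (fun t => ell t ^ α) (fun t => ell t ^ (-β)) p)) :
    IsBounded01 (assocNorm (powNorm p Y)) (assocNorm (powNorm p X))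
      (opT (fun t => ell t ^ α) (fun t => ell t ^ (-β)) p) := by
  obtain ⟨C, hC⟩ := exists_powNorm_opU_le hp hβ hXp hY h
  refine ⟨C, fun f _ _ => ?_⟩
  have ha1 : α * p ≤ 1 := by
    rw [lt_div_iff₀ hp] at hα; exact hα.le
  rw [assocNorm_congr (ae_lam01_mem.mono fun t ht => opT_ell hp hβ f ht)]
  exact IsRIBanachNorm.assocNorm_supOp_le hXp hYp (by positivity) ha1 hC f

variable {R S : Type*} [MeasurableSpace R] [MeasurableSpace S] {μ : Measure R} {ν : Measure S}

theorem gaussible_lhs (hp : 0 < p) {t : ℝ} (ht : t ∈ Ioo (0 : ℝ) 1) (x : ℝ≥0∞) :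
    (x * ENNReal.ofReal (ell t ^ α)) ^ p = x ^ p * ENNReal.ofReal (ell t ^ (α * p)) := by
  have he := ell_pos ht
  rw [ENNReal.mul_rpow_of_nonneg _ _ hp.le, ENNReal.ofReal_rpow_of_pos (Real.rpow_pos_of_pos he _),
    ← Real.rpow_mul he.le]

theorem gaussible_rhs (hp : 0 < p) (hβ : β = 1 / p - α) {t : ℝ} (ht : t ∈ Ioo (0 : ℝ) 1)
    (x : ℝ≥0∞) :
    (x * ENNReal.ofReal (ell t ^ α) * (ENNReal.ofReal (ell t ^ (-β)))⁻¹) ^ p =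
      x ^ p * ENNReal.ofReal (ell t) := by
  have he := ell_pos ht
  have h1 := Real.rpow_pos_of_pos he α
  have h2 := Real.rpow_pos_of_pos he (-β)
  rw [mul_assoc, ← ENNReal.ofReal_inv_of_pos h2, ← ENNReal.ofReal_mul h1.le,
    ENNReal.mul_rpow_of_nonneg _ _ hp.le, ENNReal.ofReal_rpow_of_pos (by positivity),
    weight_quotient hp hβ he]

theorem setLIntegral_gaussible_rhs (hp : 0 < p) (hβ : β = 1 / p - α) {E : Type*} [ENorm E]
    (f : R → E) {t : ℝ} (ht : t ∈ Ioo (0 : ℝ) 1) :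
    ∫⁻ s in Ioo 0 t, (rearr μ f (sigmaInv (fun t => ell t ^ α) (fun t => ell t ^ (-β)) p
      (s ^ (1 / p)) ^ p) * ENNReal.ofReal (ell s ^ α) * (ENNReal.ofReal (ell s ^ (-β)))⁻¹) ^ p =
    ∫⁻ s in Ioo 0 t, rearr μ f (phi s) ^ p * ENNReal.ofReal (ell s) := by
  refine setLIntegral_congr_fun measurableSet_Ioo fun s hs => ?_
  have hs' : s ∈ Ioo (0 : ℝ) 1 := ⟨hs.1, hs.2.trans ht.2⟩
  rw [sigmaInv_ell_rpow hp hβ (Ioo_subset_Icc_self hs'), gaussible_rhs hp hβ hs']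

theorem isBoundedOp_of_isGaussible [IsProbabilityMeasure ν] (hp : 0 < p)
    (hβ : β = 1 / p - α) (hXp : IsPConvex p X) (hYp : IsPConvex p Y)
    (h : IsBounded01 (assocNorm (powNorm p Y)) (assocNorm (powNorm p X))
      (opT (fun t => ell t ^ α) (fun t => ell t ^ (-β)) p))
    {T : Lp ℂ (ENNReal.ofReal p) μ → (S →ₘ[ν] ℂ)}
    (hT : IsGaussible p (fun t => ell t ^ α) (fun t => ell t ^ (-β)) T) :
    IsBoundedOp X Y T := by
  obtain ⟨C, hC⟩ := h
  obtain ⟨c, hc⟩ := hT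
  have hT' : ∀ K : ℝ → ℝ≥0∞, Antitone K → (∀ t, K t < ∞) →
      assocNorm (powNorm p Y) (rearr lam01 K) ≤ 1 →
      assocNorm (powNorm p X) (supOp (α * p) (rearr lam01 K)) ≤ C := by
    intro K hK hKfin hK1
    -- Statement 4 tests complex functions only; this is where finiteness of `K` is needed.
    let f : ℝ → ℂ := fun t => ((K t).toReal : ℝ)
    have hf : AEStronglyMeasurable f lam01 := (Complex.measurable_ofReal.comp
      hK.measurable.ennreal_toReal).aestronglyMeasurable
    have hr : rearr lam01 f = rearr lam01 K :=
      rearr_congr (ae_of_all _ fun t => enorm_toReal_complex (hKfin t).ne)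
    have h1 := hC f hf (by rw [riNorm, hr]; exact hK1.trans_lt ENNReal.one_lt_top)
    rw [assocNorm_congr (ae_lam01_mem.mono fun t ht => opT_ell hp hβ f ht), riNorm, hr] at h1
    refine h1.trans ?_
    calc (C : ℝ≥0∞) * _ ≤ C * 1 := by gcongr
      _ = C := mul_one _
  refine ⟨(2 * c * C) ^ (1 / p), fun f _ => ?_⟩
  have main := IsRIBanachNorm.le_of_setLIntegral_le (a := α * p) hXp hYp hT'
    (F := fun t => rearr μ f t ^ p) (G := fun t => rearr ν (T f) t ^ p)
    (fun s t hst => ENNReal.rpow_le_rpow (antitone_rearr _ _ hst) hp.le)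
    (fun s t hst => ENNReal.rpow_le_rpow (antitone_rearr _ _ hst) hp.le)
    (fun t ht => ENNReal.rpow_lt_top_of_nonneg hp.le (rearr_lt_top
      (f := fun x => ‖T f x‖ₑ) (T f).aestronglyMeasurable.enorm
      (ae_of_all _ fun x => enorm_lt_top) ht).ne) (c := c) (fun t ht => by
        have h1 := hc f t ht
        rw [setLIntegral_gaussible_rhs hp hβ f ht] at h1
        refine le_trans (le_of_eq ?_) h1
        refine setLIntegral_congr_fun measurableSet_Ioo fun s hs => ?_
        exact (gaussible_lhs hp ⟨hs.1, hs.2.trans ht.2⟩ _).symm)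
  rw [powNorm_rpow hp, powNorm_rpow hp] at main
  have := ENNReal.rpow_le_rpow main (one_div_nonneg.2 hp.le)
  rw [ENNReal.mul_rpow_of_nonneg _ _ (one_div_nonneg.2 hp.le), ENNReal.rpow_rpow_one_div hp,
    ENNReal.rpow_rpow_one_div hp, ← ENNReal.coe_rpow_of_nonneg _ (one_div_nonneg.2 hp.le)] at this
  exact this

end Equivalence

/-! ### Estimates of `K`-functionals -/

theorem ENNReal.add_rpow_le_two_rpow_mul {p : ℝ} (hp : 0 < p) (a b : ℝ≥0∞) :
    (a + b) ^ p ≤ 2 ^ p * (a ^ p + b ^ p) := by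
  calc (a + b) ^ p ≤ (2 * max a b) ^ p := by
        refine ENNReal.rpow_le_rpow ?_ hp.le
        rw [two_mul]
        exact add_le_add (le_max_left _ _) (le_max_right _ _)
    _ = 2 ^ p * (max a b) ^ p := ENNReal.mul_rpow_of_nonneg _ _ hp.le
    _ ≤ 2 ^ p * (a ^ p + b ^ p) := by
        gcongr
        rcases le_total a b with h | h
        · rw [max_eq_right h]; exact le_add_self
        · rw [max_eq_left h]; exact le_self_add

theorem eLpNorm_ofReal_rpow {R E : Type*} [MeasurableSpace R] [TopologicalSpace E]
    [ContinuousENorm E] {μ : Measure R} {p : ℝ} (hp : 0 < p) (f : R → E) :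
    eLpNorm f (ENNReal.ofReal p) μ ^ p = ∫⁻ x, ‖f x‖ₑ ^ p ∂μ := by
  rw [eLpNorm_eq_lintegral_rpow_enorm_toReal (by simpa using hp) ENNReal.ofReal_ne_top,
    ENNReal.toReal_ofReal hp.le, ENNReal.rpow_one_div_rpow hp]

theorem le_mul_kFunctional_rpow {R : Type*} [MeasurableSpace R] {μ : Measure R}
    {N₀ N₁ : (R → ℂ) → ℝ≥0∞} {f : R →ₘ[μ] ℂ} {t p : ℝ} (hp : 0 < p) {A : ℝ≥0∞} {c : ℝ≥0∞}
    (hc0 : c ≠ 0) (hc : c ≠ ∞)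
    (H : ∀ g h : R →ₘ[μ] ℂ, f = g + h → A ≤ c * (N₀ g + ENNReal.ofReal t * N₁ h) ^ p) :
    A ≤ c * kFunctional N₀ N₁ f t ^ p := by
  have h1 : (A / c) ^ (1 / p) ≤ kFunctional N₀ N₁ f t := by
    refine le_iInf fun g => le_iInf fun h => le_iInf fun hf => le_iInf fun _ => le_iInf fun _ => ?_
    rw [one_div, ENNReal.rpow_inv_le_iff hp, ENNReal.div_le_iff hc0 hc, mul_comm]
    exact H g h hf
  rw [one_div, ENNReal.rpow_inv_le_iff hp, ENNReal.div_le_iff hc0 hc, mul_comm] at h1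
  exact h1

theorem kFunctional_le {R : Type*} [MeasurableSpace R] {μ : Measure R}
    {N₀ N₁ : (R → ℂ) → ℝ≥0∞} {f : R →ₘ[μ] ℂ} {t : ℝ} (g h : R →ₘ[μ] ℂ) (hf : f = g + h)
    (hg : N₀ g < ∞) (hh : N₁ h < ∞) :
    kFunctional N₀ N₁ f t ≤ N₀ g + ENNReal.ofReal t * N₁ h :=
  iInf_le_of_le g (iInf_le_of_le h (iInf_le_of_le hf (iInf_le_of_le hg (iInf_le _ hh))))

theorem setLIntegral_half (x : ℝ) (Φ : ℝ → ℝ≥0∞) :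
    ∫⁻ s in Ioo 0 x, Φ (s / 2) = 2 * ∫⁻ u in Ioo 0 (x / 2), Φ u := by
  have himg : (fun u : ℝ => 2 * u) '' Ioo 0 (x / 2) = Ioo 0 x := by
    rw [image_mul_left_Ioo two_pos]; congr 1 <;> ring
  rw [← himg, lintegral_image_eq_lintegral_abs_deriv_mul measurableSet_Ioo
    (f' := fun _ => 2) (fun u _ => by simpa using ((hasDerivAt_id u).const_mul 2).hasDerivWithinAt)
    (fun u _ v _ h => by simpa using h)]
  rw [← lintegral_const_mul' _ _ (by simp)]
  refine lintegral_congr fun u => ?_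
  simp

theorem setLIntegral_ell {x : ℝ} (hx : x ∈ Icc (0 : ℝ) 1) :
    ∫⁻ s in Ioo 0 x, ENNReal.ofReal (ell s) = 2 * ENNReal.ofReal (phi x) := by
  have h := setLIntegral_phi le_rfl hx.1 hx.2 1
  simp only [phi_zero, Pi.one_apply, mul_one, lintegral_one, Measure.restrict_apply_univ,
    Real.volume_Ioo, sub_zero] at h
  rw [h, ← lintegral_const_mul' _ _ (by simp)]
  refine lintegral_congr fun s => ?_
  rw [← ENNReal.ofReal_ofNat, ← ENNReal.ofReal_mul zero_le_two]
  congr 1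
  ring

section KFunctional

variable {R S : Type*} [MeasurableSpace R] [MeasurableSpace S] {μ : Measure R} {ν : Measure S}
variable {p α β : ℝ}

theorem rearr_zero_le_eLpNorm_top (f : R → ℂ) : rearr μ f 0 ≤ eLpNorm f ∞ μ := by
  refine rearr_le_of_meas_le ?_
  rw [ENNReal.ofReal_zero, nonpos_iff_eq_zero, eLpNorm_exponent_top]
  have := ae_iff.1 (enorm_ae_le_eLpNormEssSup f μ)
  simpa only [not_le] using this

/-- Lower bound for the `K`-functional of the couple `(L^p, L^∞)`. -/
theorem setLIntegral_rearr_le_kFunctional [IsProbabilityMeasure μ] (hp : 0 < p) (f : R →ₘ[μ] ℂ)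
    {y : ℝ} (hy : y ∈ Ioo (0 : ℝ) 1) :
    ∫⁻ s in Ioo 0 y, rearr μ f s ^ p ≤ (2 ^ p * 2) *
      kFunctional (fun g => eLpNorm g (ENNReal.ofReal p) μ) (fun h => eLpNorm h ∞ μ) f
        (y ^ (1 / p)) ^ p := by
  refine le_mul_kFunctional_rpow hp (by simp) (ENNReal.mul_ne_top (by simp) (by simp))
    fun g h hf => ?_
  set N₀ := eLpNorm g (ENNReal.ofReal p) μ
  set N₁ := eLpNorm h ∞ μ
  have hae : ∀ᵐ x ∂μ, ‖f x‖ₑ ≤ ‖g x‖ₑ + ‖h x‖ₑ := by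
    rw [hf]
    filter_upwards [AEEqFun.coeFn_add g h] with x hx
    rw [hx]; exact enorm_add_le _ _
  -- The bounded part enters through `h^*(0)`, so that `g^*` is not shifted.
  have hpt : ∀ s, 0 ≤ s → rearr μ f s ≤ rearr μ g s + N₁ := fun s hs => by
    have h1 := rearr_add_le (g := fun x => ‖g x‖ₑ) (h := fun x => ‖h x‖ₑ) hae hs le_rfl
    rw [add_zero] at h1
    exact h1.trans (add_le_add le_rfl (rearr_zero_le_eLpNorm_top h))
  have hN₀ : ∫⁻ s in Ioo 0 y, rearr μ g s ^ p ≤ N₀ ^ p := by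
    rw [eLpNorm_ofReal_rpow hp, ← lintegral_rearr (g := fun x => ‖g x‖ₑ)
      g.aestronglyMeasurable.enorm (ENNReal.continuous_rpow_const (y := p)).measurable]
    exact lintegral_mono_set (Ioo_subset_Ioo_right hy.2.le)
  have hy' : ENNReal.ofReal (y ^ (1 / p)) ^ p = ENNReal.ofReal y := by
    rw [ENNReal.ofReal_rpow_of_pos (Real.rpow_pos_of_pos hy.1 _), ← Real.rpow_mul hy.1.le,
      one_div_mul_cancel hp.ne', Real.rpow_one]
  calc ∫⁻ s in Ioo 0 y, rearr μ f s ^ p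
      ≤ ∫⁻ s in Ioo 0 y, 2 ^ p * (rearr μ g s ^ p + N₁ ^ p) := by
        refine setLIntegral_mono' measurableSet_Ioo fun s hs => ?_
        exact (ENNReal.rpow_le_rpow (hpt s hs.1.le) hp.le).trans
          (ENNReal.add_rpow_le_two_rpow_mul hp _ _)
    _ = 2 ^ p * (∫⁻ s in Ioo 0 y, rearr μ g s ^ p) + 2 ^ p * (ENNReal.ofReal y * N₁ ^ p) := by
        rw [lintegral_const_mul' _ _ (by simp),
          lintegral_add_right _ measurable_const, setLIntegral_const, Real.volume_Ioo, sub_zero,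
          mul_add, mul_comm (ENNReal.ofReal y)]
    _ ≤ 2 ^ p * (N₀ + ENNReal.ofReal (y ^ (1 / p)) * N₁) ^ p +
        2 ^ p * (N₀ + ENNReal.ofReal (y ^ (1 / p)) * N₁) ^ p := by
        rw [← hy', ← ENNReal.mul_rpow_of_nonneg _ _ hp.le]
        gcongr
        · exact hN₀.trans (ENNReal.rpow_le_rpow le_self_add hp.le)
        · exact le_add_self
    _ = _ := by ring

/-- Lower bound for the `K`-functional of the couple `(L^p (log L)^α, exp L^{1/β})`. -/
theorem setLIntegral_weighted_le_kFunctional (hp : 0 < p) (hα₀ : 0 ≤ α)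
    (hβ : β = 1 / p - α) (f : S →ₘ[ν] ℂ) {x : ℝ} (hx : x ∈ Ioo (0 : ℝ) 1) :
    ∫⁻ s in Ioo 0 x, (rearr ν f s * ENNReal.ofReal (ell s ^ α)) ^ p ≤ (2 ^ p * 6) *
      kFunctional (karamataNorm (ENNReal.ofReal p) (fun t => ell t ^ α) ν)
        (karamataNorm ∞ (fun t => ell t ^ (-β)) ν) f (phi x ^ (1 / p)) ^ p := by
  refine le_mul_kFunctional_rpow hp (by simp) (ENNReal.mul_ne_top (by simp) (by simp))
    fun g h hf => ?_
  set N₀ := karamataNorm (ENNReal.ofReal p) (fun t => ell t ^ α) ν g with hN₀def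
  set N₁ := karamataNorm ∞ (fun t => ell t ^ (-β)) ν h with hN₁def
  have hae : ∀ᵐ x ∂ν, ‖f x‖ₑ ≤ ‖g x‖ₑ + ‖h x‖ₑ := by
    rw [hf]
    filter_upwards [AEEqFun.coeFn_add g h] with x hx
    rw [hx]; exact enorm_add_le _ _
  let w : ℝ → ℝ≥0∞ := fun s => ENNReal.ofReal (ell s ^ α)
  let Ψ : ℝ → ℝ≥0∞ := fun u => ((rearr ν g u + rearr ν h u) * w u) ^ p
  have hphi := phi_mem_Ioo hx
  have hN₀ : ∫⁻ s in Ioo 0 x, (rearr ν g s * w s) ^ p ≤ N₀ ^ p := by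
    rw [hN₀def, karamataNorm, eLpNorm_ofReal_rpow hp]
    refine le_trans (lintegral_mono_set (Ioo_subset_Ioo_right hx.2.le)) (le_of_eq ?_)
    exact lintegral_congr fun s => by rw [enorm_eq_self, mul_comm]
  have hN₁ : ∀ᵐ s ∂lam01, (rearr ν h s * w s) ^ p ≤ N₁ ^ p * ENNReal.ofReal (ell s) := by
    have h1 := enorm_ae_le_eLpNormEssSup
      (fun t => ENNReal.ofReal (ell t ^ (-β)) * rearr ν h t) lam01
    rw [← eLpNorm_exponent_top] at h1
    filter_upwards [h1, ae_lam01_mem] with s hs hs0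
    have he := ell_pos hs0
    have hpos := Real.rpow_pos_of_pos he (-β)
    rw [enorm_eq_self] at hs
    calc (rearr ν h s * w s) ^ p = ((ENNReal.ofReal (ell s ^ (-β)) * rearr ν h s) * w s *
          (ENNReal.ofReal (ell s ^ (-β)))⁻¹) ^ p := by
          congr 1
          have h2 : ENNReal.ofReal (ell s ^ (-β)) * (ENNReal.ofReal (ell s ^ (-β)))⁻¹ = 1 :=
            ENNReal.mul_inv_cancel (by simpa using hpos) ENNReal.ofReal_ne_top
          rw [← one_mul (rearr ν h s * w s), ← h2]
          ring
      _ = (ENNReal.ofReal (ell s ^ (-β)) * rearr ν h s) ^ p * ENNReal.ofReal (ell s) :=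
          gaussible_rhs hp hβ hs0 _
      _ ≤ _ := by
          gcongr
          exact hs
  have hy' : ENNReal.ofReal (phi x ^ (1 / p)) ^ p = ENNReal.ofReal (phi x) := by
    rw [ENNReal.ofReal_rpow_of_pos (Real.rpow_pos_of_pos hphi.1 _), ← Real.rpow_mul hphi.1.le,
      one_div_mul_cancel hp.ne', Real.rpow_one]
  have hgm : Measurable fun u => (rearr ν g u * w u) ^ p :=
    ((measurable_rearr _ _).mul (measurable_ell.pow_const _).ennreal_ofReal).pow_const _
  -- Here `h` may be unbounded, so `s` is split into two halves; the weight only grows from `s` to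
  -- `s / 2`. The substitution costs a factor `2`, and `∫ ell = 2 phi(x)` doubles the term with `h`,
  -- whence `2 + 4 = 6`.
  calc ∫⁻ s in Ioo 0 x, (rearr ν f s * w s) ^ p ≤ ∫⁻ s in Ioo 0 x, Ψ (s / 2) := by
        refine setLIntegral_mono' measurableSet_Ioo fun s hs => ?_
        refine ENNReal.rpow_le_rpow ?_ hp.le
        have hs2 : 0 < s / 2 := half_pos hs.1
        have h1 := rearr_add_le (g := fun x => ‖g x‖ₑ) (h := fun x => ‖h x‖ₑ) hae hs2.le hs2.le
        rw [add_halves] at h1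
        refine mul_le_mul' h1 (ENNReal.ofReal_le_ofReal ?_)
        exact Real.rpow_le_rpow (ell_pos ⟨hs.1, hs.2.trans hx.2⟩).le
          (ell_le_ell hs2 (half_le_self hs.1.le)) hα₀
    _ = 2 * ∫⁻ u in Ioo 0 (x / 2), Ψ u := setLIntegral_half x Ψ
    _ ≤ 2 * ∫⁻ u in Ioo 0 x, Ψ u := by
        gcongr
        exact half_le_self hx.1.le
    _ ≤ 2 * ∫⁻ u in Ioo 0 x, 2 ^ p * ((rearr ν g u * w u) ^ p + N₁ ^ p * ENNReal.ofReal (ell u)) := by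
        gcongr 2 * ?_
        refine lintegral_mono_ae ?_
        rw [← lam01_restrict_Ioo le_rfl hx.2.le]
        filter_upwards [ae_restrict_of_ae hN₁] with u hu
        simp only [Ψ]
        rw [add_mul]
        refine (ENNReal.add_rpow_le_two_rpow_mul hp _ _).trans ?_
        gcongr
    _ = 2 * 2 ^ p * (∫⁻ u in Ioo 0 x, (rearr ν g u * w u) ^ p) +
        4 * 2 ^ p * (ENNReal.ofReal (phi x) * N₁ ^ p) := by
        rw [lintegral_const_mul' _ _ (by simp),
          lintegral_add_left hgm,
          lintegral_const_mul _ measurable_ell.ennreal_ofReal,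
          setLIntegral_ell (Ioo_subset_Icc_self hx)]
        ring
    _ ≤ 2 * 2 ^ p * (N₀ + ENNReal.ofReal (phi x ^ (1 / p)) * N₁) ^ p +
        4 * 2 ^ p * (N₀ + ENNReal.ofReal (phi x ^ (1 / p)) * N₁) ^ p := by
        rw [← hy', ← ENNReal.mul_rpow_of_nonneg _ _ hp.le]
        gcongr
        · exact hN₀.trans (ENNReal.rpow_le_rpow le_self_add hp.le)
        · exact le_add_self
    _ = _ := by ring

theorem rearr_eq_zero_of_meas_le {f : R → ℂ} {s : ℝ}
    (h : μ {x | 0 < ‖f x‖ₑ} ≤ ENNReal.ofReal s) : rearr μ f s = 0 :=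
  nonpos_iff_eq_zero.1 (rearr_le_of_meas_le h)

theorem ofReal_mul_rearr_rpow_le (hp : 0 < p) (f : R → ℂ) (y : ℝ) :
    ENNReal.ofReal y * rearr μ f y ^ p ≤ ∫⁻ s in Ioo 0 y, rearr μ f s ^ p := by
  calc ENNReal.ofReal y * rearr μ f y ^ p = ∫⁻ s in Ioo 0 y, rearr μ f y ^ p := by
        rw [setLIntegral_const, Real.volume_Ioo, sub_zero, mul_comm]
    _ ≤ _ := setLIntegral_mono' measurableSet_Ioo fun s hs =>
        ENNReal.rpow_le_rpow (antitone_rearr μ f hs.2.le) hp.le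

/-- Upper bound for the `K`-functional of the couple `(L^p, L^∞)`. -/
theorem kFunctional_le_setLIntegral_rearr [IsProbabilityMeasure μ] (hp : 0 < p)
    (f : Lp ℂ (ENNReal.ofReal p) μ) {y : ℝ} (hy : y ∈ Ioo (0 : ℝ) 1) :
    kFunctional (fun g => eLpNorm g (ENNReal.ofReal p) μ) (fun h => eLpNorm h ∞ μ) (f : R →ₘ[μ] ℂ)
        (y ^ (1 / p)) ≤ 2 * (∫⁻ s in Ioo 0 y, rearr μ f s ^ p) ^ (1 / p) := by
  set l := rearr μ f y with hl
  set I := ∫⁻ s in Ioo 0 y, rearr μ f s ^ p with hI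
  have hlfin : l < ∞ := rearr_lt_top (f := fun x => ‖f x‖ₑ)
    (f : R →ₘ[μ] ℂ).aestronglyMeasurable.enorm (ae_of_all _ fun x => enorm_lt_top) hy.1
  -- Truncation at the level `l = f^*(y)`. Since `μ A ≤ y`, the large part has a rearrangement below
  -- `f^*` that vanishes from `y` on; the remainder is bounded by `l`, and `y l^p` is at most the
  -- integral of `(f^*)^p` over `(0,y)`.
  set A : Set R := {x | l < ‖f x‖ₑ} with hA
  have hAm : MeasurableSet A :=
    measurableSet_lt measurable_const (f : R →ₘ[μ] ℂ).stronglyMeasurable.enorm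
  have hfs : StronglyMeasurable (f : R → ℂ) := (f : R →ₘ[μ] ℂ).stronglyMeasurable
  have h0 : AEStronglyMeasurable (A.indicator f) μ := (hfs.indicator hAm).aestronglyMeasurable
  have h1 : AEStronglyMeasurable (Aᶜ.indicator f) μ := (hfs.indicator hAm.compl).aestronglyMeasurable
  have hsum : (f : R →ₘ[μ] ℂ) = AEEqFun.mk _ h0 + AEEqFun.mk _ h1 := by
    refine AEEqFun.ext ?_
    filter_upwards [AEEqFun.coeFn_add (AEEqFun.mk _ h0) (AEEqFun.mk _ h1), AEEqFun.coeFn_mk _ h0,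
      AEEqFun.coeFn_mk _ h1] with x hx hx0 hx1
    rw [hx, Pi.add_apply, hx0, hx1, indicator_self_add_compl_apply]
  have hN₀le : eLpNorm (AEEqFun.mk _ h0) (ENNReal.ofReal p) μ ≤ eLpNorm f (ENNReal.ofReal p) μ := by
    rw [eLpNorm_congr_ae (AEEqFun.coeFn_mk _ h0)]
    exact eLpNorm_indicator_le _
  have hN₀ : eLpNorm (AEEqFun.mk _ h0) (ENNReal.ofReal p) μ ≤ I ^ (1 / p) := by
    rw [one_div, ENNReal.le_rpow_inv_iff hp, eLpNorm_congr_ae (AEEqFun.coeFn_mk _ h0),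
      eLpNorm_ofReal_rpow hp, ← lintegral_rearr (g := fun x => ‖A.indicator f x‖ₑ)
      h0.enorm (ENNReal.continuous_rpow_const (y := p)).measurable]
    have : I = ∫⁻ s, (Ioo 0 y).indicator (fun s => rearr μ f s ^ p) s ∂lam01 := by
      rw [lintegral_indicator measurableSet_Ioo, lam01_restrict_Ioo le_rfl hy.2.le]
    rw [this]
    refine lintegral_mono_ae (ae_lam01_mem.mono fun s hs => ?_)
    rcases lt_or_ge s y with hsy | hsy
    · rw [indicator_of_mem (mem_Ioo.2 ⟨hs.1, hsy⟩)]
      refine ENNReal.rpow_le_rpow (rearr_mono (ae_of_all _ fun x => ?_) s) hp.le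
      exact enorm_indicator_le_enorm_self _ _
    · have hz : rearr μ (A.indicator f) s = 0 := by
        refine rearr_eq_zero_of_meas_le ?_
        refine le_trans (measure_mono fun x hx => ?_)
          ((meas_rearr_le (f := (f : R → ℂ)) y).trans (ENNReal.ofReal_le_ofReal hsy))
        by_contra hn
        rw [mem_ofPred_eq, indicator_of_notMem hn] at hx
        simp at hx
      change rearr μ (A.indicator f) s ^ p ≤ _
      rw [hz, ENNReal.zero_rpow_of_pos hp]
      exact zero_le
  have hN₁ : eLpNorm (AEEqFun.mk _ h1) ∞ μ ≤ l := by
    rw [eLpNorm_congr_ae (AEEqFun.coeFn_mk _ h1), eLpNorm_exponent_top]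
    refine eLpNormEssSup_le_of_ae_enorm_bound (ae_of_all _ fun x => ?_)
    by_cases hx : x ∈ A
    · rw [indicator_of_notMem (notMem_compl_iff.2 hx)]; simp
    · rw [indicator_of_mem hx]
      exact not_lt.1 hx
  have htl : ENNReal.ofReal (y ^ (1 / p)) * l ≤ I ^ (1 / p) := by
    rw [one_div, ENNReal.le_rpow_inv_iff hp, ENNReal.mul_rpow_of_nonneg _ _ hp.le,
      ENNReal.ofReal_rpow_of_pos (Real.rpow_pos_of_pos hy.1 _), ← Real.rpow_mul hy.1.le,
      inv_mul_cancel₀ hp.ne', Real.rpow_one]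
    exact ofReal_mul_rearr_rpow_le hp _ y
  refine (kFunctional_le (N₀ := fun g => eLpNorm g (ENNReal.ofReal p) μ)
    (N₁ := fun h => eLpNorm h ∞ μ) _ _ hsum (hN₀le.trans_lt (Lp.eLpNorm_lt_top f))
    (hN₁.trans_lt hlfin)).trans ?_
  rw [two_mul]
  refine add_le_add hN₀ (le_trans ?_ htl)
  gcongr

theorem isGaussible_of_satisfiesKInequality [IsProbabilityMeasure μ] (hp : 0 < p) (hα₀ : 0 ≤ α)
    (hβ : β = 1 / p - α) {T : Lp ℂ (ENNReal.ofReal p) μ → (S →ₘ[ν] ℂ)}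
    (hT : SatisfiesKInequality p (fun t => ell t ^ α) (fun t => ell t ^ (-β)) T) :
    IsGaussible p (fun t => ell t ^ α) (fun t => ell t ^ (-β)) T := by
  obtain ⟨c, hc⟩ := hT
  refine ⟨2 ^ p * 6 * (c * 2) ^ p, fun f x hx => ?_⟩
  rw [setLIntegral_gaussible_rhs hp hβ f hx]
  have hy := phi_mem_Ioo hx
  have ht : phi x ^ (1 / p) ∈ Ioo (0 : ℝ) 1 :=
    ⟨Real.rpow_pos_of_pos hy.1 _, Real.rpow_lt_one hy.1.le hy.2 (by positivity)⟩
  refine (setLIntegral_weighted_le_kFunctional hp hα₀ hβ (T f) hx).trans ?_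
  have hcv : ∫⁻ s in Ioo 0 (phi x), rearr μ f s ^ p ≤
      ∫⁻ s in Ioo 0 x, rearr μ f (phi s) ^ p * ENNReal.ofReal (ell s) := by
    have h1 := setLIntegral_phi le_rfl hx.1.le hx.2.le fun s => rearr μ f s ^ p
    rw [phi_zero] at h1
    rw [h1]
    refine setLIntegral_mono' measurableSet_Ioo fun s hs => ?_
    rw [mul_comm]
    gcongr
    exact half_le_self (ell_pos ⟨hs.1, hs.2.trans hx.2⟩).le
  calc (2 ^ p * 6) * kFunctional (karamataNorm (ENNReal.ofReal p) (fun t => ell t ^ α) ν)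
        (karamataNorm ∞ (fun t => ell t ^ (-β)) ν) (T f) (phi x ^ (1 / p)) ^ p
      ≤ (2 ^ p * 6) * (c * (2 * (∫⁻ s in Ioo 0 (phi x), rearr μ f s ^ p) ^ (1 / p))) ^ p := by
        gcongr
        refine (hc f _ ht).trans ?_
        gcongr
        exact kFunctional_le_setLIntegral_rearr hp f hy
    _ = (2 ^ p * 6 * (c * 2) ^ p) * ∫⁻ s in Ioo 0 (phi x), rearr μ f s ^ p := by
        rw [← mul_assoc (c : ℝ≥0∞), ENNReal.mul_rpow_of_nonneg _ _ hp.le,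
          ENNReal.rpow_one_div_rpow hp, mul_assoc]
        ring
    _ ≤ _ := by
        push_cast [ENNReal.coe_rpow_of_nonneg _ hp.le]
        gcongr

end KFunctional

/-! ### The model operator -/

section ModelOperator

variable {R S : Type*} [MeasurableSpace R] [MeasurableSpace S] {μ : Measure R} {ν : Measure S}
variable {p α β : ℝ}

/-- The function `t ↦ f^*(φ(t)) ℓ(t)^β`. -/
noncomputable def modelFun (β : ℝ) (μ : Measure R) (f : R → ℂ) (t : ℝ) : ℝ≥0∞ :=
  rearr μ f (phi t) * ENNReal.ofReal (ell t ^ β)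

theorem measurable_modelFun (β : ℝ) (μ : Measure R) (f : R → ℂ) : Measurable (modelFun β μ f) :=
  ((measurable_rearr _ _).comp measurable_phi).mul (measurable_ell.pow_const _).ennreal_ofReal

theorem antitoneOn_modelFun (hβ : 0 ≤ β) (f : R → ℂ) : AntitoneOn (modelFun β μ f) (Ioo 0 1) := by
  intro s hs t ht hst
  refine mul_le_mul' (antitone_rearr _ _ ?_) (ENNReal.ofReal_le_ofReal ?_)
  · exact strictMonoOn_phi.monotoneOn (Ioo_subset_Icc_self hs) (Ioo_subset_Icc_self ht) hst
  · exact Real.rpow_le_rpow (ell_pos ht).le (ell_le_ell hs.1 hst) hβ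

theorem modelFun_lt_top [IsFiniteMeasure μ] {f : R → ℂ} (hf : AEStronglyMeasurable f μ) {t : ℝ}
    (ht : t ∈ Ioo (0 : ℝ) 1) : modelFun β μ f t < ∞ :=
  ENNReal.mul_lt_top (rearr_lt_top (f := fun x => ‖f x‖ₑ) hf.enorm
    (ae_of_all _ fun _ => enorm_lt_top) (phi_mem_Ioo ht).1) ENNReal.ofReal_lt_top

/-- The class of the complex function `W ∘ τ`. -/
noncomputable def compClass {τ : S → ℝ} (hτ : MeasurePreserving τ ν lam01) {W : ℝ → ℝ≥0∞}
    (hW : Measurable W) : S →ₘ[ν] ℂ :=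
  AEEqFun.mk (fun s => (((W (τ s)).toReal : ℝ) : ℂ))
    (Complex.measurable_ofReal.comp
      (hW.comp hτ.measurable).ennreal_toReal).aestronglyMeasurable

theorem rearr_compClass {τ : S → ℝ} (hτ : MeasurePreserving τ ν lam01) {W : ℝ → ℝ≥0∞}
    (hW : Measurable W) (hfin : ∀ t ∈ Ioo (0 : ℝ) 1, W t ≠ ∞) :
    rearr ν (compClass hτ hW) = rearr lam01 W := by
  rw [← rearr_comp hτ hW.aemeasurable]
  refine rearr_congr ?_
  filter_upwards [AEEqFun.coeFn_mk (μ := ν) _ (Complex.measurable_ofReal.comp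
    (hW.comp hτ.measurable).ennreal_toReal).aestronglyMeasurable,
    hτ.quasiMeasurePreserving.ae ae_lam01_mem] with s hs hs0
  rw [compClass]
  exact (congrArg _ hs).trans (enorm_toReal_complex (hfin _ hs0))

/-- For `t = y^(1/p)`, cut `W` at `x = psi y`. The `p`-th power of the norm of the head in `L^p(log
L)^α` is at most the integral of `f^*(phi)^p ell` over `(0,x)`, that is `2 I`. On the tail `ell^(-β)
W = f^*(phi)` is at most `f^*(y)`. -/
theorem satisfiesKInequality_compClass [IsProbabilityMeasure μ] (hp : 0 < p)
    (hα : α < 1 / p) (hβ : β = 1 / p - α) {τ : S → ℝ} (hτ : MeasurePreserving τ ν lam01) :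
    SatisfiesKInequality p (fun t => ell t ^ α) (fun t => ell t ^ (-β))
      fun f : Lp ℂ (ENNReal.ofReal p) μ => compClass hτ (measurable_modelFun β μ f) := by
  have hβ0 : 0 ≤ β := by rw [hβ]; linarith
  have hp' : 0 ≤ 1 / p := by positivity
  refine ⟨(2 ^ (1 / p) + 1) * (2 ^ p * 2) ^ (1 / p), fun f t ht => ?_⟩
  set W := modelFun β μ f with hWdef
  have hWm : Measurable W := measurable_modelFun β μ f
  have hWfin : ∀ t ∈ Ioo (0 : ℝ) 1, W t ≠ ∞ := fun t ht =>
    (modelFun_lt_top (f : R →ₘ[μ] ℂ).aestronglyMeasurable ht).ne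
  have hWanti : AntitoneOn W (Ioo 0 1) := antitoneOn_modelFun hβ0 f
  obtain ⟨y, hy, rfl⟩ : ∃ y ∈ Ioo (0 : ℝ) 1, y ^ (1 / p) = t :=
    ⟨t ^ p, ⟨Real.rpow_pos_of_pos ht.1 _, Real.rpow_lt_one ht.1.le ht.2 hp⟩, by
      rw [← Real.rpow_mul ht.1.le, mul_one_div_cancel hp.ne', Real.rpow_one]⟩
  set x := psi y with hx
  have hx0 : x ∈ Ioo (0 : ℝ) 1 := psi_mem_Ioo hy
  have hphi : phi x = y := phi_psi (Ioo_subset_Icc_self hy)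
  set l := rearr μ f y with hl
  set I := ∫⁻ s in Ioo 0 y, rearr μ f s ^ p with hI
  have hlfin : l < ∞ := rearr_lt_top (f := fun x => ‖f x‖ₑ)
    (f : R →ₘ[μ] ℂ).aestronglyMeasurable.enorm (ae_of_all _ fun x => enorm_lt_top) hy.1
  have hW0m : Measurable ((Iio x).indicator W) := hWm.indicator measurableSet_Iio
  have hW1m : Measurable ((Iio x)ᶜ.indicator W) := hWm.indicator measurableSet_Iio.compl
  have hsum : compClass hτ hWm = compClass hτ hW0m + compClass hτ hW1m := by
    rw [compClass, compClass, compClass, AEEqFun.mk_add_mk]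
    congr 1
    funext s
    by_cases hs : τ s < x
    · simp [indicator_of_mem (mem_Iio.2 hs), indicator_of_notMem (show τ s ∉ Ici x from not_le.2 hs)]
    · simp [indicator_of_notMem (show τ s ∉ Iio x from hs),
        indicator_of_mem (show τ s ∈ Ici x from not_lt.1 hs)]
  have hle0 : ∀ (A : Set ℝ) (t : ℝ), A.indicator W t ≤ W t := fun A t =>
    indicator_le_self' (fun _ _ => zero_le) t
  have hr0 := rearr_compClass hτ hW0m fun t ht => ne_top_of_le_ne_top (hWfin t ht) (hle0 _ t)
  have hr1 := rearr_compClass hτ hW1m fun t ht => ne_top_of_le_ne_top (hWfin t ht) (hle0 _ t)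
  have hIfin : I < ∞ := by
    have h1 : I ≤ eLpNorm f (ENNReal.ofReal p) μ ^ p := by
      rw [eLpNorm_ofReal_rpow hp, ← lintegral_rearr (g := fun x => ‖f x‖ₑ)
        (f : R →ₘ[μ] ℂ).aestronglyMeasurable.enorm
        (ENNReal.continuous_rpow_const (y := p)).measurable]
      exact lintegral_mono_set (Ioo_subset_Ioo_right hy.2.le)
    exact h1.trans_lt (ENNReal.rpow_lt_top_of_nonneg hp.le (Lp.eLpNorm_lt_top f).ne)
  have hN₀ : karamataNorm (ENNReal.ofReal p) (fun t => ell t ^ α) ν (compClass hτ hW0m) ≤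
      (2 * I) ^ (1 / p) := by
    rw [one_div, ENNReal.le_rpow_inv_iff hp, karamataNorm, eLpNorm_ofReal_rpow hp, hr0]
    have h0anti : AntitoneOn ((Iio x).indicator W) (Ioo 0 1) := by
      intro s hs t ht hst
      by_cases htx : t < x
      · rw [indicator_of_mem (mem_Iio.2 htx), indicator_of_mem (mem_Iio.2 (hst.trans_lt htx))]
        exact hWanti hs ht hst
      · rw [indicator_of_notMem (show t ∉ Iio x from htx)]; exact zero_le
    calc ∫⁻ s, ‖ENNReal.ofReal (ell s ^ α) * rearr lam01 ((Iio x).indicator W) s‖ₑ ^ p ∂lam01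
        ≤ ∫⁻ s, (Ioo 0 x).indicator (fun s => rearr μ f (phi s) ^ p * ENNReal.ofReal (ell s)) s
            ∂lam01 := by
          refine lintegral_mono_ae (ae_lam01_mem.mono fun s hs => ?_)
          refine (ENNReal.rpow_le_rpow (mul_le_mul_right
            (rearr_le_of_antitoneOn h0anti hs) _) hp.le).trans (le_of_eq ?_)
          by_cases hsx : s < x
          · rw [indicator_of_mem (mem_Iio.2 hsx), indicator_of_mem (mem_Ioo.2 ⟨hs.1, hsx⟩),
              ← gaussible_rhs hp hβ hs, ← ENNReal.ofReal_inv_of_pos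
              (Real.rpow_pos_of_pos (ell_pos hs) _), Real.rpow_neg (ell_pos hs).le, inv_inv, hWdef,
              modelFun]
            congr 1
            ring
          · rw [indicator_of_notMem (show s ∉ Iio x from hsx),
              indicator_of_notMem (fun h => hsx h.2), mul_zero, ENNReal.zero_rpow_of_pos hp]
      _ = 2 * ∫⁻ s in Ioo 0 x, ENNReal.ofReal (ell s / 2) * rearr μ f (phi s) ^ p := by
          rw [lintegral_indicator measurableSet_Ioo, lam01_restrict_Ioo le_rfl hx0.2.le,
            ← lintegral_const_mul' _ _ (by simp)]
          refine lintegral_congr fun s => ?_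
          rw [← mul_assoc, ← ENNReal.ofReal_ofNat, ← ENNReal.ofReal_mul zero_le_two, mul_comm,
            mul_div_cancel₀ _ (two_ne_zero' ℝ)]
      _ = 2 * I := by
          rw [← setLIntegral_phi le_rfl hx0.1.le hx0.2.le fun s => rearr μ f s ^ p, phi_zero, hphi]
  have hN₁ : karamataNorm ∞ (fun t => ell t ^ (-β)) ν (compClass hτ hW1m) ≤ l := by
    rw [karamataNorm, eLpNorm_exponent_top, hr1]
    refine eLpNormEssSup_le_of_ae_enorm_bound (ae_lam01_mem.mono fun s hs => ?_)
    -- The tail vanishes before `x` and so is not nonincreasing; its rearrangement is bounded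
    -- through the nonincreasing majorant constant up to `x`.
    have hVanti : AntitoneOn (fun s => W (max s x)) (Ioo 0 1) := fun s hs t ht hst =>
      hWanti ⟨hs.1.trans_le (le_max_left _ _), max_lt hs.2 hx0.2⟩
        ⟨ht.1.trans_le (le_max_left _ _), max_lt ht.2 hx0.2⟩ (max_le_max_right _ hst)
    have h1 : rearr lam01 ((Iio x)ᶜ.indicator W) s ≤ W (max s x) := by
      refine (rearr_mono (g := fun s => W (max s x)) (ae_of_all _ fun s => ?_) s).trans
        (rearr_le_of_antitoneOn hVanti hs)
      by_cases hsx : s < x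
      · rw [indicator_of_notMem (notMem_compl_iff.2 (mem_Iio.2 hsx))]; exact zero_le
      · rw [max_eq_left (not_lt.1 hsx)]; exact hle0 _ s
    have hm : max s x ∈ Ioo (0 : ℝ) 1 := ⟨hs.1.trans_le (le_max_left _ _), max_lt hs.2 hx0.2⟩
    have hes := ell_pos hs
    have hem := ell_pos hm
    calc ENNReal.ofReal (ell s ^ (-β)) * rearr lam01 ((Iio x)ᶜ.indicator W) s
        ≤ ENNReal.ofReal (ell s ^ (-β)) * (rearr μ f (phi (max s x)) *
          ENNReal.ofReal (ell (max s x) ^ β)) := by gcongr; exact h1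
      _ ≤ ENNReal.ofReal (ell s ^ (-β)) * (l * ENNReal.ofReal (ell s ^ β)) := by
          gcongr
          · rw [hl, ← hphi]
            exact antitone_rearr _ _ (strictMonoOn_phi.monotoneOn (Ioo_subset_Icc_self hx0)
              (Ioo_subset_Icc_self hm) (le_max_right _ _))
          · exact ell_le_ell hs.1 (le_max_left _ _)
      _ = l := by
          rw [mul_left_comm, ← ENNReal.ofReal_mul (Real.rpow_nonneg hes.le _),
            ← Real.rpow_add hes, neg_add_cancel, Real.rpow_zero, ENNReal.ofReal_one, mul_one]
  have htl : ENNReal.ofReal (y ^ (1 / p)) * l ≤ I ^ (1 / p) := by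
    rw [one_div, ENNReal.le_rpow_inv_iff hp, ENNReal.mul_rpow_of_nonneg _ _ hp.le,
      ENNReal.ofReal_rpow_of_pos (Real.rpow_pos_of_pos hy.1 _), ← Real.rpow_mul hy.1.le,
      inv_mul_cancel₀ hp.ne', Real.rpow_one]
    exact ofReal_mul_rearr_rpow_le hp _ y
  have hIK := setLIntegral_rearr_le_kFunctional hp (f : R →ₘ[μ] ℂ) hy
  refine (kFunctional_le _ _ hsum (hN₀.trans_lt (ENNReal.rpow_lt_top_of_nonneg hp'
    (ENNReal.mul_ne_top (by simp) hIfin.ne))) (hN₁.trans_lt hlfin)).trans ?_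
  calc _ ≤ (2 * I) ^ (1 / p) + I ^ (1 / p) := by
        refine add_le_add hN₀ (le_trans ?_ htl)
        gcongr
    _ = (2 ^ (1 / p) + 1) * I ^ (1 / p) := by
        rw [ENNReal.mul_rpow_of_nonneg _ _ hp']; ring
    _ ≤ (2 ^ (1 / p) + 1) * ((2 ^ p * 2) * kFunctional (fun g => eLpNorm g (ENNReal.ofReal p) μ)
          (fun h => eLpNorm h ∞ μ) (f : R →ₘ[μ] ℂ) (y ^ (1 / p)) ^ p) ^ (1 / p) := by gcongr
    _ = _ := by
        rw [ENNReal.mul_rpow_of_nonneg _ _ hp', ENNReal.rpow_rpow_one_div hp]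
        push_cast [ENNReal.coe_rpow_of_nonneg _ hp.le, ENNReal.coe_rpow_of_nonneg _ hp']
        ring

/-- Transplants `h^*` to `R` along `ρ`; `p`-convexity puts the result in `L^p`. -/
theorem exists_Lp_rearr_eq [IsProbabilityMeasure μ] (hp : 0 < p) {X : (ℝ → ℝ≥0∞) → ℝ≥0∞}
    (hXp : IsPConvex p X) {ρ : R → ℝ} (hρ : MeasurePreserving ρ μ lam01) {h : ℝ → ℂ}
    (hh : AEStronglyMeasurable h lam01) (hfin : riNorm X lam01 h < ∞) :
    ∃ f : Lp ℂ (ENNReal.ofReal p) μ, rearr μ f = rearr lam01 h := by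
  have hm := measurable_rearr lam01 h
  have hr := rearr_compClass hρ hm fun t ht => (rearr_lt_top (f := fun x => ‖h x‖ₑ) hh.enorm
    (ae_of_all _ fun _ => enorm_lt_top) ht.1).ne
  rw [rearr_rearr] at hr
  refine ⟨⟨compClass hρ hm, ?_⟩, hr⟩
  rw [Lp.mem_Lp_iff_eLpNorm_lt_top]
  have h1 : eLpNorm (compClass hρ hm) (ENNReal.ofReal p) μ ^ p < ∞ := by
    rw [eLpNorm_ofReal_rpow hp, ← lintegral_rearr (g := fun x => ‖compClass hρ hm x‖ₑ)
      (compClass hρ hm).aestronglyMeasurable.enorm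
      (ENNReal.continuous_rpow_const (y := p)).measurable]
    change ∫⁻ t, rearr μ (compClass hρ hm) t ^ p ∂lam01 < ∞
    rw [hr]
    refine IsRIBanachNorm.lintegral_lt_top hXp (hm.pow_const _).aemeasurable ?_
    rw [powNorm_rpow hp]
    exact ENNReal.rpow_lt_top_of_nonneg hp.le hfin.ne
  rw [lt_top_iff_ne_top]
  intro htop
  rw [htop, ENNReal.top_rpow_of_pos hp] at h1
  exact lt_irrefl _ h1

end ModelOperator

/-! ### The equivalence of the four statements -/

theorem mainTheorem4 {R S : Type*} [MeasurableSpace R] [MeasurableSpace S]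
    (μ : Measure R) (ν : Measure S) [IsProbabilityMeasure μ] [IsProbabilityMeasure ν]
    (hμ : IsNonatomic μ) (hν : IsNonatomic ν)
    (p α β : ℝ) (hp : 0 < p) (hα₀ : 0 ≤ α) (hα : α < 1 / p) (hβ : β = 1 / p - α)
    (b₁ b₂ : ℝ → ℝ) (hb₁ : b₁ = fun t => ell t ^ α) (hb₂ : b₂ = fun t => ell t ^ (-β))
    (X Y : (ℝ → ℝ≥0∞) → ℝ≥0∞)
    (hX : IsRIQuasiBanachNorm X) (hXp : IsPConvex p X)
    (hY : IsRIQuasiBanachNorm Y) (hYp : IsPConvex p Y) :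
    List.TFAE [
      ∀ T : Lp ℂ (ENNReal.ofReal p) μ → (S →ₘ[ν] ℂ), IsGaussible p b₁ b₂ T → IsBoundedOp X Y T,
      ∀ T : Lp ℂ (ENNReal.ofReal p) μ → (S →ₘ[ν] ℂ),
        SatisfiesKInequality p b₁ b₂ T → IsBoundedOp X Y T,
      IsBounded01 X Y (opU b₁ b₂ p),
      IsBounded01 (assocNorm (powNorm p Y)) (assocNorm (powNorm p X)) (opT b₁ b₂ p)] := by
  subst hb₁ hb₂
  tfae_have 1 → 2 := fun h T hT => h T (isGaussible_of_satisfiesKInequality hp hα₀ hβ hT)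
  tfae_have 2 → 3 := by
    intro h
    -- Only this implication uses nonatomicity: of `S` to realise the model operator, of `R` to
    -- realise every rearrangement.
    obtain ⟨τ, hτ⟩ := hν.exists_measurePreserving
    obtain ⟨ρ, hρ⟩ := hμ.exists_measurePreserving
    obtain ⟨C, hC⟩ := h _ (satisfiesKInequality_compClass (μ := μ) hp hα hβ hτ)
    refine ⟨C, fun g hg hgfin => ?_⟩
    obtain ⟨f, hf⟩ := exists_Lp_rearr_eq hp hXp hρ hg hgfin
    have hW := measurable_modelFun β μ f
    have hU : Y (opU (fun t => ell t ^ α) (fun t => ell t ^ (-β)) p g) = Y (modelFun β μ f) :=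
      (hY.congr_ae hW.aemeasurable (ae_lam01_mem.mono fun t ht => by
        rw [opU_ell hp hβ g ht, modelFun, hf])).symm
    have h1 := hC f (by rwa [riNorm, hf])
    rw [riNorm, riNorm, hf, rearr_compClass hτ hW fun t ht =>
      (modelFun_lt_top (f : R →ₘ[μ] ℂ).aestronglyMeasurable ht).ne,
      hY.map_rearr hW.aemeasurable] at h1
    rw [hU]
    exact h1
  tfae_have 3 → 4 := isBounded01_opT hp hα₀ hα hβ hXp hY.toIsRIFunctional hYp
  tfae_have 4 → 1 := fun h T hT => isBoundedOp_of_isGaussible hp hβ hXp hYp h hT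
  tfae_finish
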